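/- Let $\Gamma>0$ and $s>1$. For $2\pi$-periodic (in $\phi$) real-valued functions $U(\zeta,\phi)=\sum_{p\ \mathrm{odd}}U_p(\zeta)e^{ip\phi}$ with only odd harmonics, let $X^s$ be the space of such $U\in H^s(\mathbb R\times\mathbb T)$ (taken as continuous functions, since $s>1$), with norm $$\|U\|_{X^s}=\Big(\sum_{p\ \mathrm{odd}}\int_{\mathbb R}(p^2+\xi^2)^s|\widehat U_p(\xi)|^2\,d\xi\Big)^{1/2}.$$ For $\epsilon\in\mathbb R$ consider the interpolating system xNLS$^\epsilon$: for all odd $p\in\mathbb Z$, $$U_p''-p^2U_p+6p^2\Gamma U_p^3+\frac{2p^2}{3}\,\epsilon\,\Gamma\Big(3U_p\sum_{q}|U_q|^2+\sum_{q,r}U_qU_rU_{p-q-r}\Big)=0,$$ where the sums run over odd $q$ and odd $q,r$ and exclude the self-interaction terms, i.e. the terms with $|q|=|p|$ in the first sum and those with $|q|=|r|=|p-q-r|=|p|$ in the second. Only solutions with real envelopes are considered: $U_p=\overline{U_p}=U_{-p}$ for all odd $p$. Let $U_\star(\zeta)=(3\Gamma)^{-1/2}\operatorname{sech}\zeta$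 and $\mathcal U_\star(\zeta,\phi)=2U_\star(\zeta)\cos\phi$, which solves the system for $\epsilon=0$. Then there are $\epsilon_0>0$, $C>0$ and $\delta>0$ (depending only on $s$ and $\Gamma$) such that for every $\epsilon\in(-\epsilon_0,\epsilon_0)$ the system xNLS$^\epsilon$ has exactly one solution $U\in X^s$ with real envelopes that is even in space, $U_p(\zeta)=U_p(-\zeta)$, and satisfies $\|U-\mathcal U_\star\|_{X^s}<\delta$. This solution is localized, i.e. $U(\zeta,\phi)\to0$ as $|\zeta|\to\infty$ for every $\phi$, and $$\|U-\mathcal U_\star\|_{X^s}\le C|\epsilon|.$$ -/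

import Mathlib

open MeasureTheory Filter Topology
open scoped ENNReal FourierTransform ComplexConjugate

noncomputable section

namespace XNLS

/-- The `p`-th Fourier mode `U_p(ζ) = (1/2π) ∫_{-π}^{π} U(ζ,φ) e^{-ipφ} dφ` of a function
`U(ζ,φ)` that is `2π`-periodic in `φ`. -/
def mode (U : ℝ → ℝ → ℝ) (p : ℤ) (ζ : ℝ) : ℂ :=
  (1 / (2 * Real.pi) : ℂ) *
    ∫ φ in (-Real.pi)..Real.pi, (U ζ φ : ℂ) * Complex.exp (-(Complex.I * p * φ))

open Classical in
/-- The contribution `∫ (p² + ξ²)^s |f̂(ξ)|² dξ` of the `p`-th mode `f` to the squared norm of `X^s`;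
it is `∞` if `f` is not square integrable. Here `f̂` is the Fourier-Plancherel transform on `L²`,
and the frequency is written as `ξ = 2πη`, since Mathlib's transform has the kernel `e^{-2πiηζ}`
(then `|f̂(ξ)|² dξ` for the unitary transform in `ξ` is `|𝓕 f(η)|² dη`). -/
def modeEnergy (s : ℝ) (p : ℤ) (f : ℝ → ℂ) : ℝ≥0∞ :=
  if h : MemLp f 2 (volume : Measure ℝ) then
    ∫⁻ η : ℝ, ENNReal.ofReal (((p : ℝ) ^ 2 + (2 * Real.pi * η) ^ 2) ^ s) *
      ‖(𝓕 (h.toLp f) : Lp ℂ 2 (volume : Measure ℝ)) η‖ₑ ^ 2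
  else ⊤

/-- The norm of `X^s`, with values in `[0,∞]`:
`‖U‖ = (∑_{p odd} ∫ (p² + ξ²)^s |Û_p(ξ)|² dξ)^{1/2}`. -/
def xNorm (s : ℝ) (U : ℝ → ℝ → ℝ) : ℝ≥0∞ :=
  (∑' p : {p : ℤ // Odd p}, modeEnergy s p (mode U p)) ^ (1 / 2 : ℝ)

/-- The space `X^s` for `s > 1`: the real-valued functions in `H^s(ℝ × 𝕋)` whose even harmonics
vanish. As `H^s(ℝ × 𝕋)` embeds into the continuous functions for `s > 1`, each class is given by
its continuous representative. -/
structure MemX (s : ℝ) (U : ℝ → ℝ → ℝ) : Prop where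
  continuous : Continuous (Function.uncurry U)
  periodic : ∀ ζ, Function.Periodic (U ζ) (2 * Real.pi)
  even_harmonics : ∀ p : ℤ, Even p → ∀ ζ, mode U p ζ = 0
  norm_lt_top : xNorm s U < ⊤

/-- The envelope of each harmonic is real, and `U_{-p} = U_p`. -/
def RealEnvelopes (U : ℝ → ℝ → ℝ) : Prop :=
  ∀ (p : ℤ) (ζ : ℝ), conj (mode U p ζ) = mode U p ζ ∧ mode U (-p) ζ = mode U p ζ

/-- Even symmetry in the space variable: `U_p(ζ) = U_p(-ζ)`. -/
def EvenModes (U : ℝ → ℝ → ℝ) : Prop :=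
  ∀ (p : ℤ) (ζ : ℝ), mode U p ζ = mode U p (-ζ)

/-- Indices `q` of the sum `∑ |U_q|²` without self-interaction in the equation of mode `p`. -/
def crossIndex (p : ℤ) : Set ℤ :=
  {q | Odd q ∧ |q| ≠ |p|}

/-- Indices `(q, r)` of the sum `∑ U_q U_r U_{p-q-r}` without self-interaction in the equation of
mode `p`: the terms with all three of `q`, `r`, `p-q-r` equal to `p` or `-p` are left out (when
`U_{-p} = U_p` is real, they are exactly the terms equal to `U_p³` for that reason). -/
def mixIndex (p : ℤ) : Set (ℤ × ℤ) :=
  {m | Odd m.1 ∧ Odd m.2 ∧ ¬(|m.1| = |p| ∧ |m.2| = |p| ∧ |p - m.1 - m.2| = |p|)}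

/-- `3 U_p ∑_q |U_q|² + ∑_{q,r} U_q U_r U_{p-q-r}`, without the self-interaction terms. -/
def coupling (U : ℝ → ℝ → ℝ) (p : ℤ) (ζ : ℝ) : ℂ :=
  3 * mode U p ζ * ∑' q : crossIndex p, ((‖mode U q ζ‖ ^ 2 : ℝ) : ℂ) +
    ∑' m : mixIndex p, mode U m.1.1 ζ * mode U m.1.2 ζ * mode U (p - m.1.1 - m.1.2) ζ

/-- `U` solves the interpolating system with parameter `ε`: the modes are twice continuously
differentiable, the series converge absolutely, and for every odd `p`
`U_p'' - p² U_p + 6 p² Γ U_p³ + (2p²/3) ε Γ (3 U_p ∑_q |U_q|² + ∑_{q,r} U_q U_r U_{p-q-r}) = 0`,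
where the sums exclude the self-interaction terms. -/
structure Solves (Γ ε : ℝ) (U : ℝ → ℝ → ℝ) : Prop where
  contDiff : ∀ p : ℤ, Odd p → ContDiff ℝ 2 (mode U p)
  summable_cross : ∀ p : ℤ, Odd p → ∀ ζ,
    Summable fun q : crossIndex p => ‖mode U q ζ‖ ^ 2
  summable_mix : ∀ p : ℤ, Odd p → ∀ ζ,
    Summable fun m : mixIndex p =>
      ‖mode U m.1.1 ζ * mode U m.1.2 ζ * mode U (p - m.1.1 - m.1.2) ζ‖
  equation : ∀ p : ℤ, Odd p → ∀ ζ : ℝ,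
    deriv (deriv (mode U p)) ζ - (p : ℂ) ^ 2 * mode U p ζ
      + 6 * (p : ℂ) ^ 2 * (Γ : ℂ) * mode U p ζ ^ 3
      + 2 * (p : ℂ) ^ 2 / 3 * (ε : ℂ) * (Γ : ℂ) * coupling U p ζ = 0

/-- The NLS soliton `U_*(ζ) = (3Γ)^{-1/2} sech ζ`. -/
def soliton (Γ : ℝ) (ζ : ℝ) : ℝ :=
  1 / Real.sqrt (3 * Γ) * (1 / Real.cosh ζ)

/-- The monochromatic soliton `2 U_*(ζ) cos φ`. -/
def monoSoliton (Γ : ℝ) (ζ φ : ℝ) : ℝ :=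
  2 * soliton Γ ζ * Real.cos φ

/-- An even solution of the interpolating system in `X^s` with real envelopes. -/
structure IsEvenSolution (s Γ ε : ℝ) (U : ℝ → ℝ → ℝ) : Prop where
  memX : MemX s U
  realEnvelopes : RealEnvelopes U
  evenModes : EvenModes U
  solves : Solves Γ ε U

end XNLS

end

noncomputable section

namespace XNLS

/-! ### Fourier transform on the line -/

/-! After a Fourier transform in both variables, a field with real, even envelopes is a real
function u(n, η), where p = 2n + 1 and ξ = 2πη, invariant under p ↦ -p and under ξ ↦ -ξ. Its X^s
norm is the L² norm of u with weight (p² + ξ²)^s (`xNorm_sub_eq`), so the problem lives in the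
Hilbert space `EvenSpace s`.

Inverting p² - ∂² in the equation of mode p gives the fixed point equation u = p²/(p² + ξ²) · N(u)
(`solves_iff`). The symbol is at most 1, so the unbounded factor p² of the nonlinearity does no
harm. N(u) is a combination of trilinear convolutions, with masks on the harmonics that encode which
terms count as self-interaction. Such convolutions are bounded on the weighted space
(`lintegral_eweight_mul_etriple_sq_le`), because (p² + ξ²)^(-s) is integrable over ℤ × ℝ for s > 1.
The residual u - p²/(p² + ξ²) N(u) is therefore a polynomial map of (ε, u), and the implicit
function theorem at (0, soliton) gives existence, local uniqueness and the bound C|ε|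
(`exists_branch`).

What remains is to invert the linearization 1 - K, with K v = 18 Γ p² (p² - ∂²)⁻¹ (U_*² v) on the
harmonics ±1 and K v = 0 on the others. Only two harmonics are involved and the soliton decays
rapidly, so K is Hilbert-Schmidt, hence compact (`isCompactOperator_selfCLM`), and by the Fredholm
alternative it is enough that 1 - K is injective. A kernel element satisfies V'' = p² V for |p| ≠ 1,
which has no bounded solution but 0, and V'' = (1 - 6 sech²) V for |p| = 1. The bounded solutions of
the latter are the multiples of the translation mode sech', which is odd; evenness excludes it
(`eq_zero_of_linearized`). -/

theorem memLp_fourierInv_toLp {g : ℝ → ℂ} (hg : Integrable g) (hg2 : MemLp g 2) :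
    𝓕⁻ g =ᵐ[volume] (𝓕⁻ (hg2.toLp g) : Lp ℂ 2 (volume : Measure ℝ)) := by
  set G : Lp ℂ 2 (volume : Measure ℝ) := 𝓕⁻ (hg2.toLp g) with hG
  have hcont : Continuous (𝓕⁻ g) := by
    rw [Real.fourierInv_eq_fourier_comp_neg]
    exact VectorFourier.fourierIntegral_continuous Real.continuous_fourierChar
      continuous_inner hg.comp_neg
  have hloc : LocallyIntegrable (fun x => 𝓕⁻ g x - G x) volume :=
    hcont.locallyIntegrable.sub ((Lp.memLp G).locallyIntegrable one_le_two)
  -- The L² transform is known only through its action on tempered distributions, so both sides are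
  -- compared on smooth compactly supported test functions.
  have key := ae_eq_zero_of_integral_contDiff_smul_eq_zero hloc ?_
  · filter_upwards [key] with x hx
    exact sub_eq_zero.1 hx
  intro φ hφ hφc
  have hc : HasCompactSupport (fun x => (φ x : ℂ)) := hφc.comp_left Complex.ofReal_zero
  let ψ : SchwartzMap ℝ ℂ := hc.toSchwartzMap (Complex.ofRealCLM.contDiff.comp hφ)
  have hψ : ∀ x, ψ x = φ x := fun x => rfl
  have h1 := congrArg (fun T : TemperedDistribution ℝ ℂ => T ψ)
    (Lp.fourierInv_toTemperedDistribution_eq (hg2.toLp g))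
  simp only [TemperedDistribution.fourierInv_apply, Lp.toTemperedDistribution_apply] at h1
  -- Fubini with the symmetric kernel e^{2πixη} moves the inverse transform from the test function
  -- to g.
  have h2 : ∫ x, (𝓕⁻ ψ : SchwartzMap ℝ ℂ) x • (hg2.toLp g) x = ∫ x, ψ x • 𝓕⁻ g x := by
    rw [integral_congr_ae (g := fun x => 𝓕⁻ (ψ : ℝ → ℂ) x • g x)]
    · have := VectorFourier.integral_fourierIntegral_smul_eq_flip (e := Real.fourierChar)
        (L := -innerₗ ℝ) (μ := (volume : Measure ℝ)) (ν := (volume : Measure ℝ))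
        (f := (ψ : ℝ → ℂ)) (g := g) Real.continuous_fourierChar
        (by have : Continuous fun p : ℝ × ℝ => -(p.2 * p.1) := by fun_prop
            simpa using this) ψ.integrable hg
      have hflip : (-innerₗ ℝ : ℝ →ₗ[ℝ] ℝ →ₗ[ℝ] ℝ).flip = -innerₗ ℝ := by
        ext; simp
      rw [hflip] at this
      exact this
    · filter_upwards [hg2.coeFn_toLp] with x hx
      rw [hx, SchwartzMap.fourierInv_coe]
  rw [h2] at h1
  have hi1 : Integrable (fun x => (φ x : ℂ) • 𝓕⁻ g x) :=
    hcont.locallyIntegrable.integrable_smul_left_of_hasCompactSupport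
      (Complex.continuous_ofReal.comp hφ.continuous) hc
  have hi2 : Integrable (fun x => (φ x : ℂ) • G x) :=
    ((Lp.memLp G).locallyIntegrable one_le_two).integrable_smul_left_of_hasCompactSupport
      (Complex.continuous_ofReal.comp hφ.continuous) hc
  calc ∫ x, φ x • (𝓕⁻ g x - G x) = ∫ x, ((φ x : ℂ) • 𝓕⁻ g x - (φ x : ℂ) • G x) := by
        congr with x
        simp [mul_sub]
    _ = 0 := by
        rw [integral_sub hi1 hi2, sub_eq_zero]
        simpa [hψ] using h1

theorem continuous_fourierInv {g : ℝ → ℂ} (hg : Integrable g) : Continuous (𝓕⁻ g) := by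
  rw [Real.fourierInv_eq_fourier_comp_neg]
  exact VectorFourier.fourierIntegral_continuous Real.continuous_fourierChar
    continuous_inner hg.comp_neg

theorem norm_fourierInv_le (g : ℝ → ℂ) (ζ : ℝ) : ‖𝓕⁻ g ζ‖ ≤ ∫ η, ‖g η‖ :=
  VectorFourier.norm_fourierIntegral_le_integral_norm _ _ _ _ _

theorem norm_fourier_le (g : ℝ → ℂ) (ζ : ℝ) : ‖𝓕 g ζ‖ ≤ ∫ η, ‖g η‖ :=
  VectorFourier.norm_fourierIntegral_le_integral_norm _ _ _ _ _

theorem memLp_fourierInv {g : ℝ → ℂ} (hg : Integrable g) (hg2 : MemLp g 2) :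
    MemLp (𝓕⁻ g) 2 :=
  (memLp_congr_ae (memLp_fourierInv_toLp hg hg2)).2 (Lp.memLp _)

theorem fourier_toLp_fourierInv {g : ℝ → ℂ} (hg : Integrable g) (hg2 : MemLp g 2)
    (h : MemLp (𝓕⁻ g) 2) : 𝓕 (h.toLp (𝓕⁻ g)) = hg2.toLp g := by
  have : h.toLp (𝓕⁻ g) = 𝓕⁻ (hg2.toLp g) := by
    ext1
    exact h.coeFn_toLp.trans (memLp_fourierInv_toLp hg hg2)
  rw [this, FourierTransform.fourier_fourierInv_eq]

theorem ae_eq_of_fourierInv_eq {f g : ℝ → ℂ} (hf : Integrable f) (hf2 : MemLp f 2)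
    (hg : Integrable g) (hg2 : MemLp g 2) (h : 𝓕⁻ f = 𝓕⁻ g) : f =ᵐ[volume] g := by
  have h1 := fourier_toLp_fourierInv hf hf2 (memLp_fourierInv hf hf2)
  have h2 := fourier_toLp_fourierInv hg hg2 (memLp_fourierInv hg hg2)
  have h3 : (memLp_fourierInv hf hf2).toLp _ = (memLp_fourierInv hg hg2).toLp _ :=
    (MemLp.toLp_eq_toLp_iff _ _).2 (by rw [h])
  rw [h3, h2] at h1
  exact ((MemLp.toLp_eq_toLp_iff _ _).1 h1).symm

/-- An integrable transform has a continuous inverse transform, and continuous functions that agree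
almost everywhere agree everywhere. -/
theorem eq_fourierInv_of_integrable {V : ℝ → ℂ} (hV : Continuous V) (hV2 : MemLp V 2)
    (hi : Integrable (𝓕 (hV2.toLp V) : Lp ℂ 2 (volume : Measure ℝ))) :
    V = 𝓕⁻ ((𝓕 (hV2.toLp V) : Lp ℂ 2 (volume : Measure ℝ)) : ℝ → ℂ) := by
  refine (Continuous.ae_eq_iff_eq volume hV (continuous_fourierInv hi)).1 ?_
  refine EventuallyEq.trans ?_ (memLp_fourierInv_toLp hi (Lp.memLp _)).symm
  rw [Lp.toLp_coeFn, FourierTransform.fourierInv_fourier_eq]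
  exact hV2.coeFn_toLp.symm

/-- The Fourier symbol of `p² (p² - ∂²)⁻¹`. -/
def resolvent (p : ℤ) (η : ℝ) : ℝ := (p : ℝ) ^ 2 / ((p : ℝ) ^ 2 + (2 * Real.pi * η) ^ 2)

theorem resolvent_nonneg (p : ℤ) (η : ℝ) : 0 ≤ resolvent p η := by
  unfold resolvent; positivity

theorem resolvent_le_one (p : ℤ) (η : ℝ) : resolvent p η ≤ 1 := by
  unfold resolvent
  apply div_le_one_of_le₀ _ (by positivity)
  nlinarith [sq_nonneg (2 * Real.pi * η)]

theorem measurable_resolvent (p : ℤ) : Measurable (resolvent p) := by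
  unfold resolvent; fun_prop

theorem resolvent_neg (p : ℤ) (η : ℝ) : resolvent p (-η) = resolvent p η := by
  simp [resolvent]

/-- The denominator of the symbol absorbs two powers of η. This is what makes the transform of
`resolvent p` times an integrable function twice differentiable. -/
theorem norm_pow_mul_resolvent_le {p : ℤ} (hp : p ≠ 0) {k : ℕ} (hk : k ≤ 2) (η : ℝ) :
    |η| ^ k * resolvent p η ≤ (p : ℝ) ^ 2 := by
  have hp1 : (1 : ℝ) ≤ (p : ℝ) ^ 2 := by
    have : (1 : ℤ) ≤ p ^ 2 := Int.add_one_le_iff.2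
      (lt_of_le_of_ne (sq_nonneg p) (pow_ne_zero 2 hp).symm)
    exact_mod_cast this
  have hpi : (1 : ℝ) ≤ 2 * Real.pi := by linarith [Real.pi_gt_three]
  have h2 : η ^ 2 ≤ (2 * Real.pi * η) ^ 2 := by
    rw [mul_pow]
    exact le_mul_of_one_le_left (sq_nonneg η) (one_le_pow₀ hpi)
  have hd : 0 < (p : ℝ) ^ 2 + (2 * Real.pi * η) ^ 2 := by positivity
  have h1 : |η| ^ k ≤ (p : ℝ) ^ 2 + (2 * Real.pi * η) ^ 2 := by
    interval_cases k
    · simp; nlinarith [sq_nonneg (2 * Real.pi * η)]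
    · nlinarith [sq_abs η, sq_nonneg (|η| - 1)]
    · rw [sq_abs]; linarith
  rw [resolvent, mul_div_assoc', div_le_iff₀ hd, mul_comm]
  exact mul_le_mul_of_nonneg_left h1 (by positivity)

theorem integrable_pow_smul_resolvent {p : ℤ} (hp : p ≠ 0) {g : ℝ → ℂ} (hg : Integrable g)
    {k : ℕ} (hk : k ≤ 2) :
    Integrable (fun η : ℝ => (η : ℂ) ^ k * ((resolvent p η : ℂ) * g η)) := by
  simp_rw [← mul_assoc]
  refine hg.bdd_mul (c := (p : ℝ) ^ 2) ?_ (ae_of_all _ fun η => ?_)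
  · have := measurable_resolvent p
    exact Measurable.aestronglyMeasurable (by fun_prop)
  · rw [norm_mul, norm_pow, Complex.norm_real, Complex.norm_real,
      Real.norm_of_nonneg (resolvent_nonneg p η)]
    exact norm_pow_mul_resolvent_le hp hk η

/-- Two derivatives under the integral bring down -ξ², and (p² + ξ²) times the symbol is p². The
bound on the first derivative is used later to make a Wronskian decay. -/
theorem fourier_resolvent {p : ℤ} (hp : p ≠ 0) {g : ℝ → ℂ} (hg : Integrable g) :
    ContDiff ℝ 2 (𝓕 fun η => (resolvent p η : ℂ) * g η) ∧
    (∃ M, ∀ ζ, ‖deriv (𝓕 fun η => (resolvent p η : ℂ) * g η) ζ‖ ≤ M) ∧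
    ∀ ζ, deriv (deriv (𝓕 fun η => (resolvent p η : ℂ) * g η)) ζ =
      (p : ℂ) ^ 2 * 𝓕 (fun η => (resolvent p η : ℂ) * g η) ζ - (p : ℂ) ^ 2 * 𝓕 g ζ := by
  have hi := fun k hk => integrable_pow_smul_resolvent hp hg (k := k) hk
  set f : ℝ → ℂ := fun η => (resolvent p η : ℂ) * g η with hf
  have h0 : Integrable f := by simpa using hi 0 (by norm_num)
  have h1 : Integrable (fun x : ℝ => x • f x) := by
    simpa [Complex.real_smul] using hi 1 (by norm_num)
  have h2 : Integrable (fun x : ℝ => (x : ℂ) ^ 2 * f x) := hi 2 (by norm_num)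
  have hd1 := Real.deriv_fourier h0 h1
  have h1' : Integrable (fun x : ℝ => (-2 * (Real.pi : ℂ) * Complex.I * x) • f x) := by
    refine (h1.const_mul (-2 * (Real.pi : ℂ) * Complex.I)).congr (ae_of_all _ fun x => ?_)
    simp only [Complex.real_smul, smul_eq_mul]
    ring
  have h2' : Integrable (fun x : ℝ => x • ((-2 * (Real.pi : ℂ) * Complex.I * x) • f x)) := by
    refine (h2.const_mul (-2 * (Real.pi : ℂ) * Complex.I)).congr (ae_of_all _ fun x => ?_)
    simp only [Complex.real_smul, smul_eq_mul]
    ring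
  have hd2 := Real.deriv_fourier h1' h2'
  refine ⟨?_, ⟨∫ x : ℝ, ‖(-2 * (Real.pi : ℂ) * Complex.I * x) • f x‖, fun ζ => ?_⟩,
    fun ζ => ?_⟩
  · refine Real.contDiff_fourier (N := 2) fun n hn => ?_
    have := (hi n (by exact_mod_cast hn)).norm
    simpa [hf, norm_mul, norm_pow] using this
  · rw [hd1]
    exact norm_fourier_le _ ζ
  · rw [hd1, hd2]
    have e : (fun x : ℝ => (-2 * (Real.pi : ℂ) * Complex.I * x) •
        ((-2 * (Real.pi : ℂ) * Complex.I * x) • f x)) =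
        fun x => (p : ℂ) ^ 2 * f x - (p : ℂ) ^ 2 * g x := by
      ext x
      have hr : (resolvent p x : ℂ) * ((p : ℂ) ^ 2 + (2 * Real.pi * x) ^ 2) = (p : ℂ) ^ 2 := by
        have hd : (p : ℝ) ^ 2 + (2 * Real.pi * x) ^ 2 ≠ 0 := by positivity
        have : resolvent p x * ((p : ℝ) ^ 2 + (2 * Real.pi * x) ^ 2) = (p : ℝ) ^ 2 :=
          div_mul_cancel₀ _ hd
        exact_mod_cast this
      simp only [hf, smul_eq_mul]
      linear_combination (4 * (Real.pi : ℂ) ^ 2 * x ^ 2 * (resolvent p x * g x)) * Complex.I_sq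
        - g x * hr
    rw [e, Real.fourier_real_eq, Real.fourier_real_eq, Real.fourier_real_eq]
    rw [← integral_const_mul, ← integral_const_mul, ← integral_sub]
    · congr with x
      simp only [Circle.smul_def, smul_eq_mul]
      ring
    · refine Integrable.const_mul ?_ _
      simpa [mul_comm ζ] using (Real.fourierIntegral_convergent_iff (V := ℝ) ζ).2 h0
    · refine Integrable.const_mul ?_ _
      simpa [mul_comm ζ] using (Real.fourierIntegral_convergent_iff (V := ℝ) ζ).2 hg

theorem fourierInv_resolvent {p : ℤ} (hp : p ≠ 0) {f g : ℝ → ℂ} (hg : Integrable g)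
    (hf : f =ᵐ[volume] fun η => (resolvent p η : ℂ) * g η) :
    ContDiff ℝ 2 (𝓕⁻ f) ∧ (∃ M, ∀ ζ, ‖deriv (𝓕⁻ f) ζ‖ ≤ M) ∧
    ∀ ζ, deriv (deriv (𝓕⁻ f)) ζ = (p : ℂ) ^ 2 * 𝓕⁻ f ζ - (p : ℂ) ^ 2 * 𝓕⁻ g ζ := by
  have : 𝓕⁻ f = 𝓕⁻ fun η => (resolvent p η : ℂ) * g η :=
    funext fun ζ => Real.fourierInv_congr_ae hf ζ
  rw [this, Real.fourierInv_eq_fourier_comp_neg, Real.fourierInv_eq_fourier_comp_neg g]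
  simpa only [resolvent_neg] using fourier_resolvent hp hg.comp_neg

/-! ### Bounded solutions of linear equations -/

theorem eq_const_mul_exp_of_hasDerivAt {f : ℝ → ℂ} {a : ℝ}
    (h : ∀ x, HasDerivAt f (a * f x) x) (x : ℝ) : f x = f 0 * Complex.exp (a * x) := by
  have hd : ∀ x : ℝ, HasDerivAt (fun x : ℝ => f x * Complex.exp (-(a * x))) 0 x := fun x => by
    have h1 : HasDerivAt (fun x : ℝ => Complex.exp (-(a * x)))
        (Complex.exp (-(a * x)) * -(a * 1)) x :=
      (((hasDerivAt_id x).ofReal_comp.const_mul (a : ℂ)).neg).cexp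
    exact ((h x).mul h1).congr_deriv (by ring)
  have := is_const_of_deriv_eq_zero (fun x => (hd x).differentiableAt)
    (fun x => (hd x).deriv) x 0
  simp only [Complex.ofReal_zero, mul_zero, neg_zero, Complex.exp_zero, mul_one] at this
  rw [← this, mul_assoc, ← Complex.exp_add]
  simp

/-- Factor ∂² - a² as (∂ - a)(∂ + a): D' + aD and D' - aD are pure exponentials, so 2aD = b e^{ax} -
c e^{-ax}. Boundedness at +∞ forces b = 0 and at -∞ forces c = 0. -/
theorem eq_zero_of_bounded_of_deriv_deriv {D : ℝ → ℂ} {a : ℝ} (ha : 0 < a)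
    (hD : ContDiff ℝ 2 D) (h : ∀ x, deriv (deriv D) x = (a : ℂ) ^ 2 * D x)
    {M : ℝ} (hM : ∀ x, ‖D x‖ ≤ M) : D = 0 := by
  have hd0 : ∀ x, HasDerivAt D (deriv D x) x := fun x =>
    (hD.differentiable (by norm_num) x).hasDerivAt
  have hd1 : ∀ x, HasDerivAt (deriv D) ((a : ℂ) ^ 2 * D x) x := fun x => by
    rw [← h x]
    have : ContDiff ℝ 1 (deriv D) := (contDiff_succ_iff_deriv.1 hD).2.2
    exact (this.differentiable (by norm_num) x).hasDerivAt
  have e1 := eq_const_mul_exp_of_hasDerivAt (f := fun x => deriv D x + a * D x) (a := a)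
    (fun x => ((hd1 x).add ((hd0 x).const_mul (a : ℂ))).congr_deriv (by ring))
  have e2 := eq_const_mul_exp_of_hasDerivAt (f := fun x => deriv D x - a * D x) (a := -a)
    (fun x => ((hd1 x).sub ((hd0 x).const_mul (a : ℂ))).congr_deriv (by push_cast; ring))
  set b := deriv D 0 + a * D 0
  set c := deriv D 0 - a * D 0
  have hsum : ∀ x : ℝ, 2 * a * D x = b * Complex.exp (a * x) - c * Complex.exp (-(a * x)) := by
    intro x
    have h1 := e1 x
    have h2 := e2 x
    push_cast at h2
    rw [neg_mul] at h2
    linear_combination h1 - h2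
  have hM0 : 0 ≤ M := (norm_nonneg _).trans (hM 0)
  have hlim : Tendsto (fun x : ℝ => Real.exp (-(a * x))) atTop (𝓝 0) :=
    Real.tendsto_exp_neg_atTop_nhds_zero.comp (tendsto_id.const_mul_atTop ha)
  have small : ∀ (u v : ℂ), (∀ x : ℝ, 0 ≤ x → ‖u * Complex.exp (a * x)
      - v * Complex.exp (-(a * x))‖ ≤ 2 * a * M) → u = 0 := by
    intro u v huv
    have hb : ∀ x : ℝ, 0 ≤ x → ‖u‖ ≤ (2 * a * M + ‖v‖) * Real.exp (-(a * x)) := by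
      intro x hx
      have h1 : u = (u * Complex.exp (a * x) - v * Complex.exp (-(a * x)) +
          v * Complex.exp (-(a * x))) * Complex.exp (-(a * x)) := by
        rw [sub_add_cancel, mul_assoc, ← Complex.exp_add]; simp
      have hn : ‖Complex.exp (-(a * x))‖ = Real.exp (-(a * x)) := by
        rw [Complex.norm_exp]; simp
      rw [h1, norm_mul, hn]
      gcongr
      refine (norm_add_le _ _).trans ?_
      gcongr
      · exact huv x hx
      · rw [norm_mul, hn]
        refine mul_le_of_le_one_right (norm_nonneg _) (Real.exp_le_one_iff.2 ?_)
        nlinarith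
    have h0 : ‖u‖ ≤ 0 := by
      have := hlim.const_mul (2 * a * M + ‖v‖)
      rw [mul_zero] at this
      exact ge_of_tendsto this ((eventually_ge_atTop 0).mono hb)
    exact norm_le_zero_iff.1 h0
  have hn : ∀ x : ℝ, ‖b * Complex.exp (a * x) - c * Complex.exp (-(a * x))‖ ≤ 2 * a * M := by
    intro x
    rw [← hsum, norm_mul, norm_mul, Complex.norm_real, Real.norm_of_nonneg ha.le]
    norm_num
    exact mul_le_mul_of_nonneg_left (hM x) (by positivity)
  have hb0 : b = 0 := small b c fun x _ => hn x
  -- The reflection x ↦ -x exchanges the roles of b and c.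
  have hc0 : c = 0 := small c b fun x _ => by
    have := hn (-x)
    rw [norm_sub_rev] at this
    simpa using this
  ext x
  have := hsum x
  rw [hb0, hc0] at this
  have ha' : (a : ℂ) ≠ 0 := by exact_mod_cast ha.ne'
  simpa [ha'] using this

/-! ### The frequency space and its weights

A frequency `(n, η)` stands for the harmonic `p = 2 n + 1` and the spatial frequency `ξ = 2 π η`. -/

/-- The measure on the frequency space. -/
abbrev freqMeasure : Measure (ℤ × ℝ) := Measure.count.prod volume

/-- The weight `(p² + ξ²)^s`. -/
def weight (s : ℝ) (x : ℤ × ℝ) : ℝ :=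
  (((2 * x.1 + 1 : ℤ) : ℝ) ^ 2 + (2 * Real.pi * x.2) ^ 2) ^ s

/-- The weight `(p² + ξ²)^s` with values in `[0, ∞]`. -/
def eweight (s : ℝ) (x : ℤ × ℝ) : ℝ≥0∞ := ENNReal.ofReal (weight s x)

theorem one_le_odd_sq (n : ℤ) : (1 : ℝ) ≤ ((2 * n + 1 : ℤ) : ℝ) ^ 2 := by
  have h : (1 : ℤ) ≤ (2 * n + 1) ^ 2 :=
    Int.add_one_le_iff.2 (lt_of_le_of_ne (sq_nonneg _) (pow_ne_zero 2 (by omega)).symm)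
  exact_mod_cast h

theorem one_le_symbol (x : ℤ × ℝ) :
    1 ≤ ((2 * x.1 + 1 : ℤ) : ℝ) ^ 2 + (2 * Real.pi * x.2) ^ 2 :=
  (one_le_odd_sq x.1).trans (le_add_of_nonneg_right (sq_nonneg _))

theorem one_le_weight {s : ℝ} (hs : 0 ≤ s) (x : ℤ × ℝ) : 1 ≤ weight s x :=
  Real.one_le_rpow (one_le_symbol x) hs

theorem weight_pos (s : ℝ) (x : ℤ × ℝ) : 0 < weight s x :=
  Real.rpow_pos_of_pos (zero_lt_one.trans_le (one_le_symbol x)) s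

theorem measurable_weight (s : ℝ) : Measurable (weight s) := by
  refine measurable_from_prod_countable_right fun n => ?_
  unfold weight
  fun_prop

theorem measurable_eweight (s : ℝ) : Measurable (eweight s) :=
  (measurable_weight s).ennreal_ofReal

theorem eweight_ne_zero (s : ℝ) (x : ℤ × ℝ) : eweight s x ≠ 0 :=
  (ENNReal.ofReal_pos.2 (weight_pos s x)).ne'

theorem eweight_ne_top (s : ℝ) (x : ℤ × ℝ) : eweight s x ≠ ⊤ := ENNReal.ofReal_ne_top

theorem one_le_eweight {s : ℝ} (hs : 0 ≤ s) (x : ℤ × ℝ) : 1 ≤ eweight s x :=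
  ENNReal.one_le_ofReal.2 (one_le_weight hs x)

theorem rpow_add_three_le {s a b c : ℝ} (hs : 0 ≤ s) (ha : 0 ≤ a) (hb : 0 ≤ b) (hc : 0 ≤ c) :
    (a + b + c) ^ s ≤ 3 ^ s * (a ^ s + b ^ s + c ^ s) := by
  set m := max a (max b c)
  have hm : a + b + c ≤ 3 * m := by
    have h1 : a ≤ m := le_max_left _ _
    have h2 : b ≤ m := (le_max_left _ _).trans (le_max_right _ _)
    have h3 : c ≤ m := (le_max_right _ _).trans (le_max_right _ _)
    linarith
  have hm0 : 0 ≤ m := ha.trans (le_max_left _ _)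
  have h4 : m ^ s ≤ a ^ s + b ^ s + c ^ s := by
    have h1 := Real.rpow_nonneg ha s
    have h2 := Real.rpow_nonneg hb s
    have h3 := Real.rpow_nonneg hc s
    rcases max_choice a (max b c) with h | h
    · simp only [m, h]; linarith
    · rcases max_choice b c with h' | h' <;> simp only [m, h, h'] <;> linarith
  calc (a + b + c) ^ s ≤ (3 * m) ^ s := Real.rpow_le_rpow (by positivity) hm hs
    _ = 3 ^ s * m ^ s := Real.mul_rpow (by norm_num) hm0
    _ ≤ _ := by gcongr

/-- The shift by (1, 0) makes the three odd harmonics add up: 2x + 1 is the sum of the 2· + 1 of the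
three arguments. One factor 3^s comes from the square of a sum of three terms, the other from the
power s of such a sum. -/
theorem weight_le {s : ℝ} (hs : 0 ≤ s) (x y z : ℤ × ℝ) :
    weight s x ≤ 9 ^ s * (weight s y + weight s z + weight s (x - y - z - (1, 0))) := by
  set t := x - y - z - (1, 0)
  have hp : ((2 * x.1 + 1 : ℤ) : ℝ) = ((2 * y.1 + 1 : ℤ) : ℝ) + ((2 * z.1 + 1 : ℤ) : ℝ)
      + ((2 * t.1 + 1 : ℤ) : ℝ) := by
    simp [t]; ring
  have hx : 2 * Real.pi * x.2 = 2 * Real.pi * y.2 + 2 * Real.pi * z.2 + 2 * Real.pi * t.2 := by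
    simp [t]; ring
  have sq3 : ∀ a b c : ℝ, (a + b + c) ^ 2 ≤ 3 * (a ^ 2 + b ^ 2 + c ^ 2) := fun a b c => by
    nlinarith [sq_nonneg (a - b), sq_nonneg (b - c), sq_nonneg (a - c)]
  have key : ((2 * x.1 + 1 : ℤ) : ℝ) ^ 2 + (2 * Real.pi * x.2) ^ 2 ≤
      3 * ((((2 * y.1 + 1 : ℤ) : ℝ) ^ 2 + (2 * Real.pi * y.2) ^ 2) +
      (((2 * z.1 + 1 : ℤ) : ℝ) ^ 2 + (2 * Real.pi * z.2) ^ 2) +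
      (((2 * t.1 + 1 : ℤ) : ℝ) ^ 2 + (2 * Real.pi * t.2) ^ 2)) := by
    rw [hp, hx]
    have h1 := sq3 ((2 * y.1 + 1 : ℤ) : ℝ) ((2 * z.1 + 1 : ℤ) : ℝ) ((2 * t.1 + 1 : ℤ) : ℝ)
    have h2 := sq3 (2 * Real.pi * y.2) (2 * Real.pi * z.2) (2 * Real.pi * t.2)
    linarith
  unfold weight
  refine (Real.rpow_le_rpow (by positivity) key hs).trans ?_
  rw [Real.mul_rpow (by norm_num) (by positivity), show (9 : ℝ) = 3 * 3 by norm_num,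
    Real.mul_rpow (by norm_num) (by norm_num), mul_assoc ((3 : ℝ) ^ s)]
  exact mul_le_mul_of_nonneg_left
    (rpow_add_three_le hs (by positivity) (by positivity) (by positivity)) (by positivity)

theorem eweight_le {s : ℝ} (hs : 0 ≤ s) (x y z : ℤ × ℝ) :
    eweight s x ≤ ENNReal.ofReal (9 ^ s) *
      (eweight s y + eweight s z + eweight s (x - y - z - (1, 0))) := by
  have h1 := (weight_pos s y).le
  have h2 := (weight_pos s z).le
  have h3 := (weight_pos s (x - y - z - (1, 0))).le
  unfold eweight
  rw [← ENNReal.ofReal_add h1 h2, ← ENNReal.ofReal_add (add_nonneg h1 h2) h3,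
    ← ENNReal.ofReal_mul (by positivity)]
  exact ENNReal.ofReal_le_ofReal (weight_le hs x y z)

/-- Since (p² + ξ²)² ≥ p² (1 + η²), the inverse weight is at most |p|^(-s) (1 + η²)^(-s/2). Both the
sum over p and the integral over η converge exactly for s > 1. -/
theorem lintegral_inv_eweight_lt_top {s : ℝ} (hs : 1 < s) :
    ∫⁻ x, (eweight s x)⁻¹ ∂freqMeasure < ⊤ := by
  have hb : ∀ x : ℤ × ℝ, (eweight s x)⁻¹ ≤
      ENNReal.ofReal (|((2 * x.1 + 1 : ℤ) : ℝ)| ^ (-s)) *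
        ENNReal.ofReal ((1 + ‖x.2‖ ^ 2) ^ (-s / 2)) := by
    intro x
    rw [eweight, ← ENNReal.ofReal_inv_of_pos (weight_pos s x),
      ← ENNReal.ofReal_mul (by positivity)]
    apply ENNReal.ofReal_le_ofReal
    have h1 := one_le_odd_sq x.1
    have h2 : (1 : ℝ) ≤ 2 * Real.pi := by linarith [Real.pi_gt_three]
    have h3 : x.2 ^ 2 ≤ (2 * Real.pi * x.2) ^ 2 := by
      rw [mul_pow]
      exact le_mul_of_one_le_left (sq_nonneg _) (one_le_pow₀ h2)
    have e1 : |((2 * x.1 + 1 : ℤ) : ℝ)| ^ (-s) = ((((2 * x.1 + 1 : ℤ) : ℝ) ^ 2) ^ (s / 2))⁻¹ := by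
      rw [← sq_abs, ← Real.rpow_natCast, ← Real.rpow_mul (abs_nonneg _),
        ← Real.rpow_neg (abs_nonneg _)]
      congr 1
      push_cast
      ring
    have e2 : (1 + ‖x.2‖ ^ 2) ^ (-s / 2) = ((1 + x.2 ^ 2) ^ (s / 2))⁻¹ := by
      rw [Real.norm_eq_abs, sq_abs, neg_div, Real.rpow_neg (by positivity)]
    rw [e1, e2, ← mul_inv]
    have hpos : 0 < (((2 * x.1 + 1 : ℤ) : ℝ) ^ 2) ^ (s / 2) * (1 + x.2 ^ 2) ^ (s / 2) := by
      have := zero_lt_one.trans_le h1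
      positivity
    refine inv_anti₀ hpos ?_
    rw [← Real.mul_rpow (by positivity) (by positivity), weight]
    have e3 : (((2 * x.1 + 1 : ℤ) : ℝ) ^ 2 + (2 * Real.pi * x.2) ^ 2) ^ s =
        ((((2 * x.1 + 1 : ℤ) : ℝ) ^ 2 + (2 * Real.pi * x.2) ^ 2) ^ 2) ^ (s / 2) := by
      have hB : ∀ B : ℝ, 0 ≤ B → B ^ s = (B ^ 2) ^ (s / 2) := fun B hB => by
        rw [← Real.rpow_natCast, ← Real.rpow_mul hB]
        congr 1
        push_cast
        ring
      exact hB _ (by positivity)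
    rw [e3]
    refine Real.rpow_le_rpow (by positivity) ?_ (by linarith)
    rw [pow_two (((2 * x.1 + 1 : ℤ) : ℝ) ^ 2 + (2 * Real.pi * x.2) ^ 2)]
    refine mul_le_mul ?_ ?_ (by positivity) (by positivity)
    · linarith [sq_nonneg (2 * Real.pi * x.2)]
    · linarith
  refine (lintegral_mono hb).trans_lt ?_
  rw [lintegral_prod_mul (f := fun n : ℤ => ENNReal.ofReal (|((2 * n + 1 : ℤ) : ℝ)| ^ (-s)))
    (g := fun η : ℝ => ENNReal.ofReal ((1 + ‖η‖ ^ 2) ^ (-s / 2)))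
    (measurable_of_countable _).aemeasurable (by fun_prop)]
  refine ENNReal.mul_lt_top ?_ ?_
  · rw [lintegral_count]
    have hsum : Summable fun n : ℤ => |((2 * n + 1 : ℤ) : ℝ)| ^ (-s) :=
      (Real.summable_abs_int_rpow hs).comp_injective
        (i := fun n : ℤ => 2 * n + 1) (fun a b h => by simpa using h)
    exact hsum.tsum_ofReal_lt_top
  · have hi : Integrable (fun η : ℝ => (1 + ‖η‖ ^ 2) ^ (-s / 2)) :=
      integrable_rpow_neg_one_add_norm_sq (by simpa using hs)
    exact hi.lintegral_lt_top

/-- Allows the substitution z ↦ c - z in convolution integrals. -/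
instance : (freqMeasure).IsNegInvariant := by
  refine ⟨?_⟩
  have h1 : MeasurePreserving (fun n : ℤ => -n) Measure.count Measure.count :=
    ⟨measurable_neg, by
      ext A hA
      rw [Measure.map_apply measurable_neg hA, Measure.count_apply (measurable_neg hA),
        Measure.count_apply hA]
      congr 1
      simp⟩
  have h2 : MeasurePreserving (fun x : ℝ => -x) volume volume := Measure.measurePreserving_neg _
  exact (h1.prod h2).map_eq

/-! ### Cauchy-Schwarz bounds for trilinear convolutions -/

section CauchySchwarz

variable {α : Type*} [MeasurableSpace α] {μ : Measure α}

theorem lintegral_mul_le_sqrt {f g : α → ℝ≥0∞} (hf : AEMeasurable f μ) (hg : AEMeasurable g μ) :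
    ∫⁻ a, f a * g a ∂μ ≤ (∫⁻ a, f a ^ 2 ∂μ) ^ (1 / 2 : ℝ) * (∫⁻ a, g a ^ 2 ∂μ) ^ (1 / 2 : ℝ) := by
  have := ENNReal.lintegral_mul_le_Lp_mul_Lq μ Real.HolderConjugate.two_two hf hg
  simpa using this

theorem sqrt_sq (a : ℝ≥0∞) : (a ^ (1 / 2 : ℝ)) ^ 2 = a := by
  rw [← ENNReal.rpow_natCast, ← ENNReal.rpow_mul]
  simp

/-- Cauchy-Schwarz for the splitting f = h^(-1/2) · (h^(1/2) f). -/
theorem sq_lintegral_le_weighted {f h : α → ℝ≥0∞} (hf : AEMeasurable f μ) (hh : AEMeasurable h μ)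
    (h0 : ∀ a, h a ≠ 0) (ht : ∀ a, h a ≠ ⊤) :
    (∫⁻ a, f a ∂μ) ^ 2 ≤ (∫⁻ a, (h a)⁻¹ ∂μ) * ∫⁻ a, h a * f a ^ 2 ∂μ := by
  have e : ∀ a, f a = ((h a)⁻¹ ^ (1 / 2 : ℝ)) * (h a ^ (1 / 2 : ℝ) * f a) := fun a => by
    rw [← mul_assoc, ← ENNReal.mul_rpow_of_nonneg _ _ (by norm_num),
      ENNReal.inv_mul_cancel (h0 a) (ht a)]
    simp
  have h1 := lintegral_mul_le_sqrt (μ := μ) (f := fun a => (h a)⁻¹ ^ (1 / 2 : ℝ))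
    (g := fun a => h a ^ (1 / 2 : ℝ) * f a) (hh.inv.pow_const _) ((hh.pow_const _).mul hf)
  simp_rw [← e, mul_pow, sqrt_sq] at h1
  calc (∫⁻ a, f a ∂μ) ^ 2 ≤ _ := pow_le_pow_left₀ (zero_le) h1 2
    _ = _ := by rw [mul_pow, sqrt_sq, sqrt_sq]

end CauchySchwarz

/-- The trilinear convolution of nonnegative functions on the frequency space. The shift by
`(1, 0)` turns the sum of odd harmonics into the sum of their indices. -/
def etriple (a b c : ℤ × ℝ → ℝ≥0∞) (x : ℤ × ℝ) : ℝ≥0∞ :=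
  ∫⁻ z : (ℤ × ℝ) × (ℤ × ℝ), a z.1 * b z.2 * c (x - z.1 - z.2 - (1, 0))
    ∂(freqMeasure.prod freqMeasure)

theorem lintegral_third (c : ℤ × ℝ → ℝ≥0∞) (x y : ℤ × ℝ) :
    ∫⁻ z, c (x - y - z - (1, 0)) ∂freqMeasure = ∫⁻ z, c z ∂freqMeasure := by
  have : ∀ z : ℤ × ℝ, x - y - z - (1, 0) = (x - y - (1, 0)) - z := fun z => by abel
  simp_rw [this]
  exact lintegral_sub_left_eq_self c _

theorem lintegral_third' (c : ℤ × ℝ → ℝ≥0∞) (x y : ℤ × ℝ) :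
    ∫⁻ z, c (x - z - y - (1, 0)) ∂freqMeasure = ∫⁻ z, c z ∂freqMeasure := by
  simp_rw [sub_right_comm x _ y]
  exact lintegral_third c x y

/-- The bound L¹ · L² · L² → L^∞: Cauchy-Schwarz in the second variable, where the third factor is a
reflected translate, and then integration over the first. -/
theorem etriple_le_pointwise {a b c : ℤ × ℝ → ℝ≥0∞} (ha : Measurable a) (hb : Measurable b)
    (hc : Measurable c) (x : ℤ × ℝ) :
    etriple a b c x ≤ (∫⁻ y, a y ∂freqMeasure) * ((∫⁻ y, b y ^ 2 ∂freqMeasure) ^ (1 / 2 : ℝ) *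
      (∫⁻ y, c y ^ 2 ∂freqMeasure) ^ (1 / 2 : ℝ)) := by
  unfold etriple
  have hm : Measurable fun z : (ℤ × ℝ) × (ℤ × ℝ) =>
      a z.1 * b z.2 * c (x - z.1 - z.2 - (1, 0)) := by fun_prop
  rw [lintegral_prod _ hm.aemeasurable, ← lintegral_mul_const _ ha]
  refine lintegral_mono fun y => ?_
  dsimp only
  simp_rw [mul_assoc]
  rw [lintegral_const_mul _ (by fun_prop)]
  gcongr
  refine (lintegral_mul_le_sqrt hb.aemeasurable (by fun_prop)).trans_eq ?_
  rw [lintegral_third (fun t => c t ^ 2)]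

/-- Dividing the bound of w(x) by a sum of three weights by the product of these weights leaves
three terms, each the inverse of a product of two weights. By translation invariance each term
integrates to the square of the integral of the inverse weight. -/
theorem lintegral_inv_eweight_pairs {s : ℝ} (hs : 0 ≤ s) (x : ℤ × ℝ) :
    eweight s x * ∫⁻ z : (ℤ × ℝ) × (ℤ × ℝ), (eweight s z.1 * eweight s z.2 *
      eweight s (x - z.1 - z.2 - (1, 0)))⁻¹ ∂(freqMeasure.prod freqMeasure) ≤
    ENNReal.ofReal (9 ^ s) * (3 * (∫⁻ y, (eweight s y)⁻¹ ∂freqMeasure) ^ 2) := by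
  set I := ∫⁻ y, (eweight s y)⁻¹ ∂freqMeasure with hI
  have hW := measurable_eweight s
  have hbound : ∀ z : (ℤ × ℝ) × (ℤ × ℝ), eweight s x * (eweight s z.1 * eweight s z.2 *
      eweight s (x - z.1 - z.2 - (1, 0)))⁻¹ ≤ ENNReal.ofReal (9 ^ s) *
      ((eweight s z.2)⁻¹ * (eweight s (x - z.1 - z.2 - (1, 0)))⁻¹ +
        (eweight s z.1)⁻¹ * (eweight s (x - z.1 - z.2 - (1, 0)))⁻¹ +
        (eweight s z.1)⁻¹ * (eweight s z.2)⁻¹) := by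
    intro z
    have h1 := eweight_ne_zero s z.1
    have h2 := eweight_ne_zero s z.2
    have h3 := eweight_ne_zero s (x - z.1 - z.2 - (1, 0))
    have h1' := eweight_ne_top s z.1
    have h2' := eweight_ne_top s z.2
    have h3' := eweight_ne_top s (x - z.1 - z.2 - (1, 0))
    refine (mul_le_mul_left (eweight_le hs x z.1 z.2) _).trans_eq ?_
    generalize eweight s z.1 = A at *
    generalize eweight s z.2 = B at *
    generalize eweight s (x - z.1 - z.2 - (1, 0)) = D at *
    have cA := ENNReal.mul_inv_cancel h1 h1'
    have cB := ENNReal.mul_inv_cancel h2 h2'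
    have cD := ENNReal.mul_inv_cancel h3 h3'
    rw [ENNReal.mul_inv (Or.inr h3') (Or.inr h3), ENNReal.mul_inv (Or.inl h1) (Or.inl h1'),
      mul_assoc]
    congr 1
    calc (A + B + D) * (A⁻¹ * B⁻¹ * D⁻¹) = (A * A⁻¹) * (B⁻¹ * D⁻¹) + (B * B⁻¹) * (A⁻¹ * D⁻¹) +
          (D * D⁻¹) * (A⁻¹ * B⁻¹) := by ring
      _ = _ := by rw [cA, cB, cD]; simp
  rw [← lintegral_const_mul _ (by fun_prop)]
  refine (lintegral_mono hbound).trans_eq ?_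
  rw [lintegral_const_mul _ (by fun_prop), lintegral_add_right _ (by fun_prop),
    lintegral_add_right _ (by fun_prop)]
  congr 1
  have e1 : ∫⁻ z : (ℤ × ℝ) × (ℤ × ℝ), (eweight s z.2)⁻¹ *
      (eweight s (x - z.1 - z.2 - (1, 0)))⁻¹ ∂(freqMeasure.prod freqMeasure) = I ^ 2 := by
    rw [lintegral_prod_symm _ (by fun_prop)]
    dsimp only
    have : ∀ y : ℤ × ℝ, ∫⁻ z, (eweight s y)⁻¹ * (eweight s (x - z - y - (1, 0)))⁻¹ ∂freqMeasure =
        (eweight s y)⁻¹ * I := fun y => by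
      rw [lintegral_const_mul _ (by fun_prop), lintegral_third' (fun t => (eweight s t)⁻¹)]
    simp_rw [this]
    rw [lintegral_mul_const _ (by fun_prop), pow_two]
  have e2 : ∫⁻ z : (ℤ × ℝ) × (ℤ × ℝ), (eweight s z.1)⁻¹ *
      (eweight s (x - z.1 - z.2 - (1, 0)))⁻¹ ∂(freqMeasure.prod freqMeasure) = I ^ 2 := by
    rw [lintegral_prod _ (by fun_prop)]
    dsimp only
    have : ∀ y : ℤ × ℝ, ∫⁻ z, (eweight s y)⁻¹ * (eweight s (x - y - z - (1, 0)))⁻¹ ∂freqMeasure =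
        (eweight s y)⁻¹ * I := fun y => by
      rw [lintegral_const_mul _ (by fun_prop), lintegral_third (fun t => (eweight s t)⁻¹)]
    simp_rw [this]
    rw [lintegral_mul_const _ (by fun_prop), pow_two]
  have e3 : ∫⁻ z : (ℤ × ℝ) × (ℤ × ℝ), (eweight s z.1)⁻¹ * (eweight s z.2)⁻¹
      ∂(freqMeasure.prod freqMeasure) = I ^ 2 := by
    rw [lintegral_prod_mul (f := fun y => (eweight s y)⁻¹) (g := fun y => (eweight s y)⁻¹)
      (by fun_prop) (by fun_prop), pow_two]
  rw [e1, e2, e3]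
  ring

/-- The constant of the algebra property of the weighted `L²` space. -/
def tripleConst (s : ℝ) : ℝ≥0∞ :=
  ENNReal.ofReal (9 ^ s) * (3 * (∫⁻ y, (eweight s y)⁻¹ ∂freqMeasure) ^ 2)

theorem tripleConst_lt_top {s : ℝ} (hs : 1 < s) : tripleConst s < ⊤ :=
  ENNReal.mul_lt_top ENNReal.ofReal_lt_top (ENNReal.mul_lt_top (by simp)
    (ENNReal.pow_lt_top (lintegral_inv_eweight_lt_top hs)))

/-- The algebra property. For fixed x use Cauchy-Schwarz with the product of the three weights; the
factor with the inverse weights is bounded uniformly in x by `lintegral_inv_eweight_pairs`, and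
Tonelli with translation invariance splits the rest into three norms. -/
theorem lintegral_eweight_mul_etriple_sq_le {s : ℝ} (hs : 0 ≤ s) {a b c : ℤ × ℝ → ℝ≥0∞}
    (ha : Measurable a) (hb : Measurable b) (hc : Measurable c) :
    ∫⁻ x, eweight s x * etriple a b c x ^ 2 ∂freqMeasure ≤ tripleConst s *
      ((∫⁻ x, eweight s x * a x ^ 2 ∂freqMeasure) * (∫⁻ x, eweight s x * b x ^ 2 ∂freqMeasure) *
      ∫⁻ x, eweight s x * c x ^ 2 ∂freqMeasure) := by
  have hW := measurable_eweight s
  have h1 : ∀ x, eweight s x * etriple a b c x ^ 2 ≤ tripleConst s *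
      ∫⁻ z : (ℤ × ℝ) × (ℤ × ℝ), (eweight s z.1 * a z.1 ^ 2) * (eweight s z.2 * b z.2 ^ 2) *
        (eweight s (x - z.1 - z.2 - (1, 0)) * c (x - z.1 - z.2 - (1, 0)) ^ 2)
        ∂(freqMeasure.prod freqMeasure) := by
    intro x
    have hcs := sq_lintegral_le_weighted (μ := freqMeasure.prod freqMeasure)
      (f := fun z : (ℤ × ℝ) × (ℤ × ℝ) => a z.1 * b z.2 * c (x - z.1 - z.2 - (1, 0)))
      (h := fun z => eweight s z.1 * eweight s z.2 * eweight s (x - z.1 - z.2 - (1, 0)))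
      (by fun_prop) (by fun_prop)
      (fun z => mul_ne_zero (mul_ne_zero (eweight_ne_zero _ _) (eweight_ne_zero _ _))
        (eweight_ne_zero _ _))
      (fun z => ENNReal.mul_ne_top (ENNReal.mul_ne_top (eweight_ne_top _ _) (eweight_ne_top _ _))
        (eweight_ne_top _ _))
    unfold etriple
    refine (mul_le_mul_right hcs _).trans ?_
    rw [← mul_assoc]
    refine mul_le_mul' (lintegral_inv_eweight_pairs hs x) (lintegral_mono fun z => ?_)
    exact le_of_eq (by ring)
  refine (lintegral_mono h1).trans ?_
  have hmeas : Measurable fun q : (ℤ × ℝ) × ((ℤ × ℝ) × (ℤ × ℝ)) =>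
      (eweight s q.2.1 * a q.2.1 ^ 2) * (eweight s q.2.2 * b q.2.2 ^ 2) *
        (eweight s (q.1 - q.2.1 - q.2.2 - (1, 0)) * c (q.1 - q.2.1 - q.2.2 - (1, 0)) ^ 2) := by
    fun_prop
  rw [lintegral_const_mul _ hmeas.lintegral_prod_right']
  gcongr
  rw [lintegral_lintegral_swap hmeas.aemeasurable]
  have h2 : ∀ z : (ℤ × ℝ) × (ℤ × ℝ), ∫⁻ x, (eweight s z.1 * a z.1 ^ 2) *
      (eweight s z.2 * b z.2 ^ 2) *
      (eweight s (x - z.1 - z.2 - (1, 0)) * c (x - z.1 - z.2 - (1, 0)) ^ 2) ∂freqMeasure =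
      (eweight s z.1 * a z.1 ^ 2) * (eweight s z.2 * b z.2 ^ 2) *
        ∫⁻ x, eweight s x * c x ^ 2 ∂freqMeasure := by
    intro z
    rw [lintegral_const_mul _ (by fun_prop)]
    congr 1
    have : ∀ x : ℤ × ℝ, x - z.1 - z.2 - (1, 0) = x - (z.1 + z.2 + (1, 0)) := fun x => by abel
    simp_rw [this]
    exact lintegral_sub_right_eq_self (fun t => eweight s t * c t ^ 2) _
  simp_rw [h2]
  rw [lintegral_mul_const _ (by fun_prop),
    lintegral_prod_mul (f := fun y => eweight s y * a y ^ 2) (g := fun y => eweight s y * b y ^ 2)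
      (by fun_prop) (by fun_prop)]

/-- All weights are at least 1, so each of the three summands is at most their product. -/
theorem eweight_le_mul {s : ℝ} (hs : 0 ≤ s) (x y z : ℤ × ℝ) :
    eweight s x ≤ ENNReal.ofReal (9 ^ s) * 3 *
      (eweight s y * eweight s z * eweight s (x - y - z - (1, 0))) := by
  refine (eweight_le hs x y z).trans ?_
  rw [mul_assoc]
  gcongr
  have h1 := one_le_eweight hs y
  have h2 := one_le_eweight hs z
  have h3 := one_le_eweight hs (x - y - z - (1, 0))
  generalize eweight s y = A at *
  generalize eweight s z = B at *
  generalize eweight s (x - y - z - (1, 0)) = D at *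
  have e1 : A ≤ A * B * D := by
    simpa using mul_le_mul' (mul_le_mul' (le_refl A) h2) h3
  have e2 : B ≤ A * B * D := by
    simpa using mul_le_mul' (mul_le_mul' h1 (le_refl B)) h3
  have e3 : D ≤ A * B * D := by
    simpa using mul_le_mul' (mul_le_mul' h1 h2) (le_refl D)
  calc A + B + D ≤ A * B * D + A * B * D + A * B * D := by gcongr
    _ = _ := by ring

/-- A pointwise bound for the trilinear convolution that distributes the weight onto all
factors. -/
theorem eweight_mul_etriple_sq_le {s : ℝ} (hs : 0 ≤ s) {a b c : ℤ × ℝ → ℝ≥0∞}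
    (ha : Measurable a) (hb : Measurable b) (hc : Measurable c) (x : ℤ × ℝ) :
    eweight s x * etriple a b c x ^ 2 ≤ ENNReal.ofReal (9 ^ s) * 3 *
      ((∫⁻ y, eweight s y ^ (1 / 2 : ℝ) * a y ∂freqMeasure) ^ 2 *
        ((∫⁻ y, eweight s y * b y ^ 2 ∂freqMeasure) *
          ∫⁻ y, eweight s y * c y ^ 2 ∂freqMeasure)) := by
  have hW := measurable_eweight s
  set r : ℝ≥0∞ := ENNReal.ofReal (9 ^ s) * 3 with hr
  -- The square root of the weight at x is spread multiplicatively over the three factors, after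
  -- which the unweighted L¹ · L² · L² bound applies.
  have h1 : eweight s x ^ (1 / 2 : ℝ) * etriple a b c x ≤ r ^ (1 / 2 : ℝ) *
      etriple (fun y => eweight s y ^ (1 / 2 : ℝ) * a y) (fun y => eweight s y ^ (1 / 2 : ℝ) * b y)
        (fun y => eweight s y ^ (1 / 2 : ℝ) * c y) x := by
    unfold etriple
    rw [← lintegral_const_mul _ (by fun_prop), ← lintegral_const_mul _ (by fun_prop)]
    refine lintegral_mono fun z => ?_
    have := ENNReal.rpow_le_rpow (eweight_le_mul hs x z.1 z.2) (z := 1 / 2) (by norm_num)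
    rw [← hr, ENNReal.mul_rpow_of_nonneg r _ (by norm_num),
      ENNReal.mul_rpow_of_nonneg (eweight s z.1 * eweight s z.2) _ (by norm_num),
      ENNReal.mul_rpow_of_nonneg (eweight s z.1) _ (by norm_num)] at this
    refine (mul_le_mul_left this _).trans_eq ?_
    ring
  have h2 := etriple_le_pointwise (a := fun y => eweight s y ^ (1 / 2 : ℝ) * a y)
    (b := fun y => eweight s y ^ (1 / 2 : ℝ) * b y) (c := fun y => eweight s y ^ (1 / 2 : ℝ) * c y)
    (by fun_prop) (by fun_prop) (by fun_prop) x
  have h3 := pow_le_pow_left₀ zero_le (h1.trans (mul_le_mul_right h2 _)) 2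
  simpa only [mul_pow, sqrt_sq] using h3

/-! ### Weighted square integrable functions and their trilinear convolutions -/

/-- The squared norm of the weighted `L²` space. -/
def wsq (s : ℝ) (u : ℤ × ℝ → ℝ) : ℝ≥0∞ := ∫⁻ x, eweight s x * ‖u x‖ₑ ^ 2 ∂freqMeasure

/-- Measurable functions in the weighted `L²` space. -/
structure WL2 (s : ℝ) (u : ℤ × ℝ → ℝ) : Prop where
  measurable : Measurable u
  finite : wsq s u < ⊤

theorem lintegral_enorm_sq_le_wsq {s : ℝ} (hs : 0 ≤ s) (u : ℤ × ℝ → ℝ) :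
    ∫⁻ x, ‖u x‖ₑ ^ 2 ∂freqMeasure ≤ wsq s u :=
  lintegral_mono fun x => le_mul_of_one_le_left zero_le (one_le_eweight hs x)

theorem sq_lintegral_enorm_le_wsq {s : ℝ} {u : ℤ × ℝ → ℝ} (hu : Measurable u) :
    (∫⁻ x, ‖u x‖ₑ ∂freqMeasure) ^ 2 ≤ (∫⁻ x, (eweight s x)⁻¹ ∂freqMeasure) * wsq s u :=
  sq_lintegral_le_weighted hu.enorm.aemeasurable (measurable_eweight s).aemeasurable
    (eweight_ne_zero s) (eweight_ne_top s)

theorem WL2.integrable {s : ℝ} (hs : 1 < s) {u : ℤ × ℝ → ℝ} (hu : WL2 s u) :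
    Integrable u freqMeasure := by
  refine ⟨hu.measurable.aestronglyMeasurable, ?_⟩
  have h := (sq_lintegral_enorm_le_wsq (s := s) hu.measurable).trans_lt
    (ENNReal.mul_lt_top (lintegral_inv_eweight_lt_top hs) hu.finite)
  by_contra hcon
  rw [hasFiniteIntegral_iff_enorm, not_lt, top_le_iff] at hcon
  simp [hcon] at h

theorem WL2.lintegral_lt_top {s : ℝ} (hs : 1 < s) {u : ℤ × ℝ → ℝ} (hu : WL2 s u) :
    ∫⁻ x, ‖u x‖ₑ ∂freqMeasure < ⊤ := (hu.integrable hs).2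

theorem WL2.lintegral_sq_lt_top {s : ℝ} (hs : 1 < s) {u : ℤ × ℝ → ℝ} (hu : WL2 s u) :
    ∫⁻ x, ‖u x‖ₑ ^ 2 ∂freqMeasure < ⊤ :=
  (lintegral_enorm_sq_le_wsq (by linarith) u).trans_lt hu.finite

/-- Trilinear convolution with a mask on the harmonics. -/
def triple (m : ℤ → ℤ → ℤ → ℝ) (u v w : ℤ × ℝ → ℝ) (x : ℤ × ℝ) : ℝ :=
  ∫ z : (ℤ × ℝ) × (ℤ × ℝ), m x.1 z.1.1 z.2.1 * (u z.1 * v z.2 * w (x - z.1 - z.2 - (1, 0)))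
    ∂(freqMeasure.prod freqMeasure)

/-- Bounded masks that are invariant under the change of sign of all harmonics. -/
structure IsMask (m : ℤ → ℤ → ℤ → ℝ) (M : ℝ) : Prop where
  bound : ∀ n q r, |m n q r| ≤ M
  symm : ∀ n q r, m (-1 - n) (-1 - q) (-1 - r) = m n q r

theorem measurable_triple_integrand (m : ℤ → ℤ → ℤ → ℝ) {u v w : ℤ × ℝ → ℝ} (hu : Measurable u)
    (hv : Measurable v) (hw : Measurable w) :
    Measurable fun q : (ℤ × ℝ) × ((ℤ × ℝ) × (ℤ × ℝ)) =>
      m q.1.1 q.2.1.1 q.2.2.1 * (u q.2.1 * v q.2.2 * w (q.1 - q.2.1 - q.2.2 - (1, 0))) := by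
  have hm : Measurable fun q : (ℤ × ℝ) × ((ℤ × ℝ) × (ℤ × ℝ)) => m q.1.1 q.2.1.1 q.2.2.1 :=
    (measurable_of_countable (fun k : ℤ × ℤ × ℤ => m k.1 k.2.1 k.2.2)).comp
      (by fun_prop : Measurable fun q : (ℤ × ℝ) × ((ℤ × ℝ) × (ℤ × ℝ)) =>
        (q.1.1, q.2.1.1, q.2.2.1))
  fun_prop

theorem measurable_triple (m : ℤ → ℤ → ℤ → ℝ) {u v w : ℤ × ℝ → ℝ} (hu : Measurable u)
    (hv : Measurable v) (hw : Measurable w) : Measurable (triple m u v w) :=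
  (measurable_triple_integrand m hu hv hw).stronglyMeasurable.integral_prod_right'.measurable

theorem enorm_triple_integrand_le {m : ℤ → ℤ → ℤ → ℝ} {M : ℝ} (hm : IsMask m M)
    (u v w : ℤ × ℝ → ℝ) (x : ℤ × ℝ) (z : (ℤ × ℝ) × (ℤ × ℝ)) :
    ‖m x.1 z.1.1 z.2.1 * (u z.1 * v z.2 * w (x - z.1 - z.2 - (1, 0)))‖ₑ ≤
      ENNReal.ofReal M * (‖u z.1‖ₑ * ‖v z.2‖ₑ * ‖w (x - z.1 - z.2 - (1, 0))‖ₑ) := by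
  rw [enorm_mul, enorm_mul, enorm_mul]
  gcongr
  rw [Real.enorm_eq_ofReal_abs]
  exact ENNReal.ofReal_le_ofReal (hm.bound _ _ _)

theorem lintegral_enorm_triple_integrand_le {m : ℤ → ℤ → ℤ → ℝ} {M : ℝ} (hm : IsMask m M)
    {u v w : ℤ × ℝ → ℝ} (hu : Measurable u) (hv : Measurable v) (hw : Measurable w)
    (x : ℤ × ℝ) :
    ∫⁻ z : (ℤ × ℝ) × (ℤ × ℝ), ‖m x.1 z.1.1 z.2.1 *
      (u z.1 * v z.2 * w (x - z.1 - z.2 - (1, 0)))‖ₑ ∂(freqMeasure.prod freqMeasure) ≤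
      ENNReal.ofReal M * etriple (fun y => ‖u y‖ₑ) (fun y => ‖v y‖ₑ) (fun y => ‖w y‖ₑ) x := by
  unfold etriple
  rw [← lintegral_const_mul _ (by fun_prop)]
  exact lintegral_mono fun z => enorm_triple_integrand_le hm u v w x z

theorem etriple_lt_top {s : ℝ} (hs : 1 < s) {u v w : ℤ × ℝ → ℝ} (hu : WL2 s u) (hv : WL2 s v)
    (hw : WL2 s w) (x : ℤ × ℝ) :
    etriple (fun y => ‖u y‖ₑ) (fun y => ‖v y‖ₑ) (fun y => ‖w y‖ₑ) x < ⊤ := by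
  refine (etriple_le_pointwise hu.measurable.enorm hv.measurable.enorm
    hw.measurable.enorm x).trans_lt ?_
  refine ENNReal.mul_lt_top (hu.lintegral_lt_top hs) (ENNReal.mul_lt_top ?_ ?_)
  · exact ENNReal.rpow_lt_top_of_nonneg (by norm_num) (hv.lintegral_sq_lt_top hs).ne
  · exact ENNReal.rpow_lt_top_of_nonneg (by norm_num) (hw.lintegral_sq_lt_top hs).ne

theorem integrable_triple {s : ℝ} (hs : 1 < s) {m : ℤ → ℤ → ℤ → ℝ} {M : ℝ} (hm : IsMask m M)
    {u v w : ℤ × ℝ → ℝ} (hu : WL2 s u) (hv : WL2 s v) (hw : WL2 s w) (x : ℤ × ℝ) :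
    Integrable (fun z : (ℤ × ℝ) × (ℤ × ℝ) => m x.1 z.1.1 z.2.1 *
      (u z.1 * v z.2 * w (x - z.1 - z.2 - (1, 0)))) (freqMeasure.prod freqMeasure) := by
  refine ⟨?_, ?_⟩
  · exact ((measurable_triple_integrand m hu.measurable hv.measurable hw.measurable).comp
      (measurable_prodMk_left (x := x))).aestronglyMeasurable
  · exact (lintegral_enorm_triple_integrand_le hm hu.measurable hv.measurable hw.measurable
      x).trans_lt (ENNReal.mul_lt_top ENNReal.ofReal_lt_top (etriple_lt_top hs hu hv hw x))

theorem enorm_triple_le {m : ℤ → ℤ → ℤ → ℝ} {M : ℝ} (hm : IsMask m M) {u v w : ℤ × ℝ → ℝ}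
    (hu : Measurable u) (hv : Measurable v) (hw : Measurable w) (x : ℤ × ℝ) :
    ‖triple m u v w x‖ₑ ≤ ENNReal.ofReal M *
      etriple (fun y => ‖u y‖ₑ) (fun y => ‖v y‖ₑ) (fun y => ‖w y‖ₑ) x :=
  (enorm_integral_le_lintegral_enorm _).trans (lintegral_enorm_triple_integrand_le hm hu hv hw x)

theorem wsq_triple_le {s : ℝ} (hs : 0 ≤ s) {m : ℤ → ℤ → ℤ → ℝ} {M : ℝ} (hm : IsMask m M)
    {u v w : ℤ × ℝ → ℝ} (hu : Measurable u) (hv : Measurable v) (hw : Measurable w) :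
    wsq s (triple m u v w) ≤ ENNReal.ofReal M ^ 2 * (tripleConst s *
      (wsq s u * wsq s v * wsq s w)) := by
  refine le_trans ?_ (mul_le_mul_right (lintegral_eweight_mul_etriple_sq_le hs hu.enorm hv.enorm
    hw.enorm) _)
  rw [← lintegral_const_mul' _ _ (ENNReal.pow_ne_top ENNReal.ofReal_ne_top)]
  refine lintegral_mono fun x => ?_
  refine (mul_le_mul_right (pow_le_pow_left₀ zero_le (enorm_triple_le hm hu hv hw x) 2)
    _).trans_eq ?_
  ring

theorem WL2.add {s : ℝ} {u v : ℤ × ℝ → ℝ} (hu : WL2 s u) (hv : WL2 s v) :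
    WL2 s (fun x => u x + v x) := by
  have hW := measurable_eweight s
  have hmu := hu.measurable
  have hmv := hv.measurable
  refine ⟨hmu.add hmv, ?_⟩
  have : wsq s (fun x => u x + v x) ≤ 4 * (wsq s u + wsq s v) := by
    unfold wsq
    rw [← lintegral_add_left (by fun_prop), ← lintegral_const_mul _ (by fun_prop)]
    refine lintegral_mono fun x => ?_
    rw [← mul_add, mul_left_comm]
    gcongr
    refine (pow_le_pow_left₀ zero_le (enorm_add_le (u x) (v x)) 2).trans ?_
    rcases le_total ‖u x‖ₑ ‖v x‖ₑ with h | h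
    · calc (‖u x‖ₑ + ‖v x‖ₑ) ^ 2 ≤ (‖v x‖ₑ + ‖v x‖ₑ) ^ 2 := by gcongr
        _ = 4 * ‖v x‖ₑ ^ 2 := by ring
        _ ≤ _ := by gcongr; exact le_add_self
    · calc (‖u x‖ₑ + ‖v x‖ₑ) ^ 2 ≤ (‖u x‖ₑ + ‖u x‖ₑ) ^ 2 := by gcongr
        _ = 4 * ‖u x‖ₑ ^ 2 := by ring
        _ ≤ _ := by gcongr; exact le_self_add
  refine this.trans_lt (ENNReal.mul_lt_top (by simp) (ENNReal.add_lt_top.2 ⟨hu.finite, hv.finite⟩))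

theorem wsq_const_mul (s c : ℝ) (u : ℤ × ℝ → ℝ) :
    wsq s (fun x => c * u x) = ‖c‖ₑ ^ 2 * wsq s u := by
  unfold wsq
  rw [← lintegral_const_mul' _ _ (by simp)]
  congr with x
  rw [enorm_mul]
  ring

theorem WL2.const_mul {s : ℝ} {u : ℤ × ℝ → ℝ} (hu : WL2 s u) (c : ℝ) :
    WL2 s (fun x => c * u x) := by
  refine ⟨hu.measurable.const_mul c, ?_⟩
  rw [wsq_const_mul]
  exact ENNReal.mul_lt_top (by simp) hu.finite

theorem WL2.triple {s : ℝ} (hs : 1 < s) {m : ℤ → ℤ → ℤ → ℝ} {M : ℝ} (hm : IsMask m M)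
    {u v w : ℤ × ℝ → ℝ} (hu : WL2 s u) (hv : WL2 s v) (hw : WL2 s w) :
    WL2 s (triple m u v w) := by
  refine ⟨measurable_triple m hu.measurable hv.measurable hw.measurable, ?_⟩
  refine (wsq_triple_le (by linarith) hm hu.measurable hv.measurable hw.measurable).trans_lt ?_
  exact ENNReal.mul_lt_top (ENNReal.pow_lt_top ENNReal.ofReal_lt_top)
    (ENNReal.mul_lt_top (tripleConst_lt_top hs)
      (ENNReal.mul_lt_top (ENNReal.mul_lt_top hu.finite hv.finite) hw.finite))

/-! Multilinearity of the trilinear convolution. -/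

section Multilinear

variable {s : ℝ} {m : ℤ → ℤ → ℤ → ℝ} {M : ℝ} {u u' v v' w w' : ℤ × ℝ → ℝ}

theorem triple_add_left (hs : 1 < s) (hm : IsMask m M) (hu : WL2 s u) (hu' : WL2 s u')
    (hv : WL2 s v) (hw : WL2 s w) (x : ℤ × ℝ) :
    triple m (fun y => u y + u' y) v w x = triple m u v w x + triple m u' v w x := by
  unfold triple
  rw [← integral_add (integrable_triple hs hm hu hv hw x) (integrable_triple hs hm hu' hv hw x)]
  congr with z
  ring

theorem triple_add_mid (hs : 1 < s) (hm : IsMask m M) (hu : WL2 s u) (hv : WL2 s v)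
    (hv' : WL2 s v') (hw : WL2 s w) (x : ℤ × ℝ) :
    triple m u (fun y => v y + v' y) w x = triple m u v w x + triple m u v' w x := by
  unfold triple
  rw [← integral_add (integrable_triple hs hm hu hv hw x) (integrable_triple hs hm hu hv' hw x)]
  congr with z
  ring

theorem triple_add_right (hs : 1 < s) (hm : IsMask m M) (hu : WL2 s u) (hv : WL2 s v)
    (hw : WL2 s w) (hw' : WL2 s w') (x : ℤ × ℝ) :
    triple m u v (fun y => w y + w' y) x = triple m u v w x + triple m u v w' x := by
  unfold triple
  rw [← integral_add (integrable_triple hs hm hu hv hw x) (integrable_triple hs hm hu hv hw' x)]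
  congr with z
  ring

theorem triple_mul_left (c : ℝ) (x : ℤ × ℝ) :
    triple m (fun y => c * u y) v w x = c * triple m u v w x := by
  unfold triple
  rw [← integral_const_mul]
  congr with z
  ring

theorem triple_mul_mid (c : ℝ) (x : ℤ × ℝ) :
    triple m u (fun y => c * v y) w x = c * triple m u v w x := by
  unfold triple
  rw [← integral_const_mul]
  congr with z
  ring

theorem triple_mul_right (c : ℝ) (x : ℤ × ℝ) :
    triple m u v (fun y => c * w y) x = c * triple m u v w x := by
  unfold triple
  rw [← integral_const_mul]
  congr with z
  ring

/-- The equality holds at every x, as x is only a parameter of the integral. Hence the trilinear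
convolution has well defined values at points on almost-everywhere classes, which the functionals in
the compactness proof need. -/
theorem triple_congr (hu : u =ᵐ[freqMeasure] u') (hv : v =ᵐ[freqMeasure] v')
    (hw : w =ᵐ[freqMeasure] w') (x : ℤ × ℝ) : triple m u v w x = triple m u' v' w' x := by
  unfold triple
  have h1 : ∀ᵐ z : (ℤ × ℝ) × (ℤ × ℝ) ∂(freqMeasure.prod freqMeasure), u z.1 = u' z.1 :=
    Measure.quasiMeasurePreserving_fst.ae hu
  have h2 : ∀ᵐ z : (ℤ × ℝ) × (ℤ × ℝ) ∂(freqMeasure.prod freqMeasure), v z.2 = v' z.2 :=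
    Measure.quasiMeasurePreserving_snd.ae hv
  have h3 : ∀ᵐ z : (ℤ × ℝ) × (ℤ × ℝ) ∂(freqMeasure.prod freqMeasure),
      w (x - z.1 - z.2 - (1, 0)) = w' (x - z.1 - z.2 - (1, 0)) := by
    -- Preimages of null sets are null: with the first variable fixed, the map is a reflection
    -- followed by a translation in the second.
    refine Measure.QuasiMeasurePreserving.ae
      (f := fun z : (ℤ × ℝ) × (ℤ × ℝ) => x - z.1 - z.2 - (1, 0)) ⟨by fun_prop, ?_⟩ hw
    refine Measure.AbsolutelyContinuous.mk fun A hA hA0 => ?_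
    rw [Measure.map_apply (by fun_prop) hA, ← lintegral_indicator_one
      (measurableSet_preimage (by fun_prop) hA), lintegral_prod _ (by
        refine Measurable.aemeasurable ?_
        exact measurable_one.indicator (measurableSet_preimage (by fun_prop) hA))]
    have : ∀ y z : ℤ × ℝ, ((fun z : (ℤ × ℝ) × (ℤ × ℝ) => x - z.1 - z.2 - (1, 0)) ⁻¹' A).indicator
        (1 : (ℤ × ℝ) × (ℤ × ℝ) → ℝ≥0∞) (y, z) = A.indicator 1 (x - y - z - (1, 0)) :=
      fun y z => rfl
    simp_rw [this, lintegral_third (fun t => A.indicator (1 : ℤ × ℝ → ℝ≥0∞) t)]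
    rw [lintegral_indicator_one hA, hA0]
    simp
  refine integral_congr_ae ?_
  filter_upwards [h1, h2, h3] with z e1 e2 e3
  rw [e1, e2, e3]

end Multilinear

/-! ### Reflections of the frequency space -/

/-- The reflection `p ↦ -p` of the harmonics. -/
def reflectHarmonic : ℤ × ℝ ≃ᵐ ℤ × ℝ where
  toFun x := (-1 - x.1, x.2)
  invFun x := (-1 - x.1, x.2)
  left_inv x := by simp
  right_inv x := by simp
  measurable_toFun := (by fun_prop : Measurable fun x : ℤ × ℝ => (-1 - x.1, x.2))
  measurable_invFun := (by fun_prop : Measurable fun x : ℤ × ℝ => (-1 - x.1, x.2))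

/-- The reflection `ξ ↦ -ξ` of the spatial frequency. -/
def reflectSpace : ℤ × ℝ ≃ᵐ ℤ × ℝ where
  toFun x := (x.1, -x.2)
  invFun x := (x.1, -x.2)
  left_inv x := by simp
  right_inv x := by simp
  measurable_toFun := (by fun_prop : Measurable fun x : ℤ × ℝ => (x.1, -x.2))
  measurable_invFun := (by fun_prop : Measurable fun x : ℤ × ℝ => (x.1, -x.2))

@[simp] theorem reflectHarmonic_apply (x : ℤ × ℝ) : reflectHarmonic x = (-1 - x.1, x.2) := rfl

@[simp] theorem reflectSpace_apply (x : ℤ × ℝ) : reflectSpace x = (x.1, -x.2) := rfl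

theorem measurePreserving_reflectHarmonic :
    MeasurePreserving reflectHarmonic freqMeasure freqMeasure := by
  have h1 : MeasurePreserving (fun n : ℤ => -1 - n) Measure.count Measure.count :=
    ⟨by fun_prop, by
      ext A hA
      have hinj : Function.Involutive (fun n : ℤ => -1 - n) := fun n => by simp
      rw [Measure.map_apply (by fun_prop) hA,
        Measure.count_apply (measurableSet_preimage (by fun_prop) hA), Measure.count_apply hA]
      congr 1
      exact Set.encard_preimage_of_bijective hinj.bijective A⟩
  exact h1.prod (MeasurePreserving.id volume)

theorem measurePreserving_reflectSpace :
    MeasurePreserving reflectSpace freqMeasure freqMeasure :=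
  (MeasurePreserving.id Measure.count).prod (Measure.measurePreserving_neg (volume : Measure ℝ))

theorem weight_reflectHarmonic (s : ℝ) (x : ℤ × ℝ) :
    weight s (reflectHarmonic x) = weight s x := by
  simp only [weight, reflectHarmonic_apply]
  congr 2
  push_cast
  ring

theorem weight_reflectSpace (s : ℝ) (x : ℤ × ℝ) : weight s (reflectSpace x) = weight s x := by
  simp [weight]

theorem triple_comp_equiv {m : ℤ → ℤ → ℤ → ℝ} {σ : ℤ × ℝ ≃ᵐ ℤ × ℝ}
    (hσ : MeasurePreserving σ freqMeasure freqMeasure)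
    (hthird : ∀ x y z, σ x - σ y - σ z - (1, 0) = σ (x - y - z - (1, 0)))
    (hm : ∀ x y z, m (σ x).1 (σ y).1 (σ z).1 = m x.1 y.1 z.1) (u v w : ℤ × ℝ → ℝ) (x : ℤ × ℝ) :
    triple m u v w (σ x) = triple m (u ∘ σ) (v ∘ σ) (w ∘ σ) x := by
  unfold triple
  rw [← (hσ.prod hσ).integral_comp (σ.prodCongr σ).measurableEmbedding]
  congr with z
  simp [hthird, hm]

/-! ### The space of symmetric weighted square integrable functions -/

/-- The measure `(p² + ξ²)^s dp dξ`. -/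
def weightedMeasure (s : ℝ) : Measure (ℤ × ℝ) := freqMeasure.withDensity (eweight s)

/-- The weight is positive and finite, so both measures have the same null sets; almost-everywhere
statements can pass between them. -/
theorem ae_weightedMeasure (s : ℝ) : ae (weightedMeasure s) = ae freqMeasure :=
  le_antisymm (withDensity_absolutelyContinuous _ _).ae_le
    (withDensity_absolutelyContinuous' (measurable_eweight s).aemeasurable
      (ae_of_all _ (eweight_ne_zero s))).ae_le

theorem lintegral_weightedMeasure (s : ℝ) {f : ℤ × ℝ → ℝ≥0∞} (hf : Measurable f) :
    ∫⁻ x, f x ∂weightedMeasure s = ∫⁻ x, eweight s x * f x ∂freqMeasure := by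
  rw [weightedMeasure, lintegral_withDensity_eq_lintegral_mul _ (measurable_eweight s) hf]
  rfl

theorem measurePreserving_weighted {s : ℝ} {σ : ℤ × ℝ ≃ᵐ ℤ × ℝ}
    (hσ : MeasurePreserving σ freqMeasure freqMeasure)
    (hw : ∀ x, weight s (σ x) = weight s x) :
    MeasurePreserving σ (weightedMeasure s) (weightedMeasure s) := by
  refine ⟨σ.measurable, ?_⟩
  ext A hA
  rw [Measure.map_apply σ.measurable hA, weightedMeasure, withDensity_apply _ hA,
    withDensity_apply _ (σ.measurable hA), ← hσ.setLIntegral_comp_preimage hA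
    (measurable_eweight s)]
  simp_rw [eweight, hw]

theorem eLpNorm_sq_eq_wsq (s : ℝ) {u : ℤ × ℝ → ℝ} (hu : Measurable u) :
    eLpNorm u 2 (weightedMeasure s) ^ 2 = wsq s u := by
  rw [eLpNorm_eq_lintegral_rpow_enorm_toReal (by simp) (by simp), ← ENNReal.rpow_natCast,
    ← ENNReal.rpow_mul]
  simp only [ENNReal.toReal_ofNat, Nat.cast_ofNat, ENNReal.rpow_ofNat]
  norm_num
  exact lintegral_weightedMeasure s (hu.enorm.pow_const 2)

theorem WL2.memLp {s : ℝ} {u : ℤ × ℝ → ℝ} (hu : WL2 s u) : MemLp u 2 (weightedMeasure s) := by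
  refine ⟨hu.measurable.aestronglyMeasurable, ?_⟩
  have h := hu.finite
  rw [← eLpNorm_sq_eq_wsq s hu.measurable] at h
  by_contra hcon
  rw [not_lt, top_le_iff] at hcon
  simp [hcon] at h

theorem WL2.coeFn {s : ℝ} (f : Lp ℝ 2 (weightedMeasure s)) : WL2 s f := by
  have hm : Measurable f := (Lp.stronglyMeasurable f).measurable
  refine ⟨hm, ?_⟩
  rw [← eLpNorm_sq_eq_wsq s hm]
  exact ENNReal.pow_lt_top (Lp.eLpNorm_lt_top f)

/-- Measurable functions in the weighted `L²` space that are even in the harmonic and in the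
spatial frequency. -/
structure EvenL2 (s : ℝ) (u : ℤ × ℝ → ℝ) : Prop extends WL2 s u where
  harmonic : u ∘ reflectHarmonic =ᵐ[freqMeasure] u
  space : u ∘ reflectSpace =ᵐ[freqMeasure] u

/-- The closed subspace of the symmetric functions in the weighted `L²` space. -/
def evenSubmodule (s : ℝ) : Submodule ℝ (Lp ℝ 2 (weightedMeasure s)) :=
  LinearMap.ker ((Lp.compMeasurePreservingₗᵢ ℝ reflectHarmonic (measurePreserving_weighted
      measurePreserving_reflectHarmonic (weight_reflectHarmonic s))).toContinuousLinearMap -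
      ContinuousLinearMap.id ℝ (Lp ℝ 2 (weightedMeasure s))).toLinearMap ⊓
  LinearMap.ker ((Lp.compMeasurePreservingₗᵢ ℝ reflectSpace (measurePreserving_weighted
      measurePreserving_reflectSpace (weight_reflectSpace s))).toContinuousLinearMap -
      ContinuousLinearMap.id ℝ (Lp ℝ 2 (weightedMeasure s))).toLinearMap

theorem isClosed_evenSubmodule (s : ℝ) :
    IsClosed (evenSubmodule s : Set (Lp ℝ 2 (weightedMeasure s))) :=
  (ContinuousLinearMap.isClosed_ker _).inter (ContinuousLinearMap.isClosed_ker _)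

/-- The Hilbert space of the symmetric functions in the weighted `L²` space. -/
def EvenSpace (s : ℝ) : Type := evenSubmodule s

instance (s : ℝ) : NormedAddCommGroup (EvenSpace s) :=
  inferInstanceAs (NormedAddCommGroup (evenSubmodule s))

instance (s : ℝ) : InnerProductSpace ℝ (EvenSpace s) :=
  inferInstanceAs (InnerProductSpace ℝ (evenSubmodule s))

instance (s : ℝ) : CompleteSpace (EvenSpace s) :=
  (isClosed_evenSubmodule s).completeSpace_coe

theorem mem_evenSubmodule {s : ℝ} {f : Lp ℝ 2 (weightedMeasure s)} :
    f ∈ evenSubmodule s ↔ (f ∘ reflectHarmonic =ᵐ[freqMeasure] f) ∧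
      (f ∘ reflectSpace =ᵐ[freqMeasure] f) := by
  have key : ∀ {σ : ℤ × ℝ ≃ᵐ ℤ × ℝ} (hσ : MeasurePreserving σ (weightedMeasure s)
      (weightedMeasure s)), Lp.compMeasurePreserving (p := 2) (E := ℝ) σ hσ f = f ↔
      (f ∘ σ =ᵐ[freqMeasure] f) := by
    intro σ hσ
    have h : Lp.compMeasurePreserving σ hσ f =ᵐ[freqMeasure] f ∘ σ := by
      rw [← ae_weightedMeasure s]
      exact Lp.coeFn_compMeasurePreserving f hσ
    rw [Lp.ext_iff, ae_weightedMeasure]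
    exact ⟨fun h' => h.symm.trans h', fun h' => h.trans h'⟩
  rw [evenSubmodule, Submodule.mem_inf, LinearMap.mem_ker, LinearMap.mem_ker]
  refine and_congr ?_ ?_
  · rw [← key (measurePreserving_weighted measurePreserving_reflectHarmonic
      (weight_reflectHarmonic s))]
    exact sub_eq_zero
  · rw [← key (measurePreserving_weighted measurePreserving_reflectSpace
      (weight_reflectSpace s))]
    exact sub_eq_zero

/-- A measurable representative. -/
def EvenSpace.fn {s : ℝ} (f : EvenSpace s) : ℤ × ℝ → ℝ := (f.1 : Lp ℝ 2 (weightedMeasure s))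

theorem EvenL2.coeFn {s : ℝ} (f : EvenSpace s) : EvenL2 s f.fn :=
  ⟨WL2.coeFn _, (mem_evenSubmodule.1 f.2).1, (mem_evenSubmodule.1 f.2).2⟩

theorem WL2.toLp_ae_eq {s : ℝ} {u : ℤ × ℝ → ℝ} (hu : WL2 s u) :
    hu.memLp.toLp u =ᵐ[freqMeasure] u := by
  have := hu.memLp.coeFn_toLp
  unfold EventuallyEq at this ⊢
  rwa [ae_weightedMeasure] at this

/-- The class of a symmetric function. -/
def EvenL2.toEvenSpace {s : ℝ} {u : ℤ × ℝ → ℝ} (hu : EvenL2 s u) : EvenSpace s :=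
  ⟨hu.memLp.toLp u, mem_evenSubmodule.2 (by
    have h := hu.toWL2.toLp_ae_eq
    exact ⟨(measurePreserving_reflectHarmonic.quasiMeasurePreserving.ae_eq_comp h).trans
        (hu.harmonic.trans h.symm),
      (measurePreserving_reflectSpace.quasiMeasurePreserving.ae_eq_comp h).trans
        (hu.space.trans h.symm)⟩)⟩

theorem EvenL2.coe_toEvenSpace {s : ℝ} {u : ℤ × ℝ → ℝ} (hu : EvenL2 s u) :
    hu.toEvenSpace.fn =ᵐ[freqMeasure] u := hu.toWL2.toLp_ae_eq

theorem EvenSpace.ext {s : ℝ} {f g : EvenSpace s} (h : f.fn =ᵐ[freqMeasure] g.fn) :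
    f = g := by
  apply Subtype.ext
  rw [Lp.ext_iff, ae_weightedMeasure]
  exact h

theorem coe_add_ae {s : ℝ} (f g : EvenSpace s) :
    (f + g).fn =ᵐ[freqMeasure] fun x => f.fn x + g.fn x := by
  have := Lp.coeFn_add f.1 g.1
  rw [ae_weightedMeasure] at this
  exact this

theorem coe_sub_ae {s : ℝ} (f g : EvenSpace s) :
    (f - g).fn =ᵐ[freqMeasure] fun x => f.fn x - g.fn x := by
  have := Lp.coeFn_sub f.1 g.1
  rw [ae_weightedMeasure] at this
  exact this

theorem coe_smul_ae {s : ℝ} (c : ℝ) (f : EvenSpace s) :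
    (c • f).fn =ᵐ[freqMeasure] fun x => c * f.fn x := by
  have := Lp.coeFn_smul c f.1
  rw [ae_weightedMeasure] at this
  exact this

theorem enorm_sq_eq_wsq {s : ℝ} (f : EvenSpace s) : ‖f‖ₑ ^ 2 = wsq s f.fn := by
  rw [← eLpNorm_sq_eq_wsq s (EvenL2.coeFn f).measurable, EvenSpace.fn, ← Lp.enorm_def]
  rfl

theorem wsq_congr {s : ℝ} {u v : ℤ × ℝ → ℝ} (h : u =ᵐ[freqMeasure] v) : wsq s u = wsq s v := by
  refine lintegral_congr_ae ?_
  filter_upwards [h] with x hx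
  rw [hx]

theorem EvenL2.enorm_sq_toEvenSpace {s : ℝ} {u : ℤ × ℝ → ℝ} (hu : EvenL2 s u) :
    ‖hu.toEvenSpace‖ₑ ^ 2 = wsq s u := by
  rw [enorm_sq_eq_wsq, wsq_congr hu.coe_toEvenSpace]

/-! ### The interaction operator -/

/-- The trilinear convolution followed by `p² (p² - ∂²)⁻¹`. -/
def interaction (m : ℤ → ℤ → ℤ → ℝ) (u v w : ℤ × ℝ → ℝ) (x : ℤ × ℝ) : ℝ :=
  resolvent (2 * x.1 + 1) x.2 * triple m u v w x

theorem measurable_resolvent_prod : Measurable fun x : ℤ × ℝ => resolvent (2 * x.1 + 1) x.2 :=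
  measurable_from_prod_countable_right fun n => measurable_resolvent (2 * n + 1)

theorem resolvent_odd_neg (n : ℤ) (η : ℝ) :
    resolvent (2 * (-1 - n) + 1) η = resolvent (2 * n + 1) η := by
  simp only [resolvent]
  push_cast
  have : (2 * (-1 - (n : ℝ)) + 1) ^ 2 = (2 * n + 1) ^ 2 := by ring
  rw [this]

theorem wsq_resolvent_mul_le {s : ℝ} (u : ℤ × ℝ → ℝ) :
    wsq s (fun x => resolvent (2 * x.1 + 1) x.2 * u x) ≤ wsq s u := by
  refine lintegral_mono fun x => ?_
  gcongr
  rw [enorm_mul, Real.enorm_of_nonneg (resolvent_nonneg _ _)]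
  refine mul_le_of_le_one_left zero_le ?_
  rw [← ENNReal.ofReal_one]
  exact ENNReal.ofReal_le_ofReal (resolvent_le_one _ _)

/-- Both reflections preserve the measure, the mask, the symbol and the relation among the three
frequencies, so the change of variables moves them onto the factors, where symmetry removes them. -/
theorem EvenL2.interaction {s : ℝ} (hs : 1 < s) {m : ℤ → ℤ → ℤ → ℝ} {M : ℝ} (hm : IsMask m M)
    {u v w : ℤ × ℝ → ℝ} (hu : EvenL2 s u) (hv : EvenL2 s v) (hw : EvenL2 s w) :
    EvenL2 s (interaction m u v w) := by
  have ht := WL2.triple hs hm hu.toWL2 hv.toWL2 hw.toWL2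
  refine ⟨⟨measurable_resolvent_prod.mul ht.measurable,
    (wsq_resolvent_mul_le _).trans_lt ht.finite⟩, ae_of_all _ fun x => ?_, ae_of_all _ fun x => ?_⟩
  · simp only [Function.comp_apply, XNLS.interaction]
    rw [triple_comp_equiv measurePreserving_reflectHarmonic
      (fun x y z => by ext <;> simp; ring) (fun x y z => hm.symm _ _ _),
      triple_congr hu.harmonic hv.harmonic hw.harmonic, reflectHarmonic_apply, resolvent_odd_neg]
  · simp only [Function.comp_apply, XNLS.interaction]
    rw [triple_comp_equiv measurePreserving_reflectSpace
      (fun x y z => by ext <;> simp; ring) (fun x y z => rfl),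
      triple_congr hu.space hv.space hw.space, reflectSpace_apply, resolvent_neg]

theorem wsq_interaction_le {s : ℝ} (hs : 0 ≤ s) {m : ℤ → ℤ → ℤ → ℝ} {M : ℝ} (hm : IsMask m M)
    {u v w : ℤ × ℝ → ℝ} (hu : Measurable u) (hv : Measurable v) (hw : Measurable w) :
    wsq s (interaction m u v w) ≤ ENNReal.ofReal M ^ 2 * (tripleConst s *
      (wsq s u * wsq s v * wsq s w)) :=
  (wsq_resolvent_mul_le _).trans (wsq_triple_le hs hm hu hv hw)

/-- The interaction as a map on symmetric functions. -/
def interactionFun {s : ℝ} (hs : 1 < s) {m : ℤ → ℤ → ℤ → ℝ} {M : ℝ} (hm : IsMask m M)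
    (u v w : EvenSpace s) : EvenSpace s :=
  (EvenL2.interaction hs hm (EvenL2.coeFn u) (EvenL2.coeFn v) (EvenL2.coeFn w)).toEvenSpace

section

variable {s : ℝ} (hs : 1 < s) {m : ℤ → ℤ → ℤ → ℝ} {M : ℝ} (hm : IsMask m M)

theorem interactionFun_ae (u v w : EvenSpace s) :
    (interactionFun hs hm u v w).fn =ᵐ[freqMeasure] interaction m u.fn v.fn w.fn :=
  EvenL2.coe_toEvenSpace _

theorem norm_interactionFun_le (hM : 0 ≤ M) (u v w : EvenSpace s) :
    ‖interactionFun hs hm u v w‖ ≤ M * Real.sqrt (tripleConst s).toReal * ‖u‖ * ‖v‖ * ‖w‖ := by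
  have h := wsq_interaction_le (by linarith) hm (EvenL2.coeFn u).measurable
    (EvenL2.coeFn v).measurable (EvenL2.coeFn w).measurable (s := s)
  rw [← EvenL2.enorm_sq_toEvenSpace (EvenL2.interaction hs hm (EvenL2.coeFn u) (EvenL2.coeFn v)
    (EvenL2.coeFn w)), ← enorm_sq_eq_wsq, ← enorm_sq_eq_wsq, ← enorm_sq_eq_wsq] at h
  have h2 := ENNReal.toReal_mono (by
    refine ENNReal.mul_ne_top (by simp) (ENNReal.mul_ne_top (tripleConst_lt_top hs).ne ?_)
    exact ENNReal.mul_ne_top (ENNReal.mul_ne_top (by simp) (by simp)) (by simp)) h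
  simp only [ENNReal.toReal_mul, ENNReal.toReal_pow, toReal_enorm,
    ENNReal.toReal_ofReal hM] at h2
  refine abs_le_of_sq_le_sq' ?_ (by positivity) |>.2
  refine h2.trans_eq ?_
  rw [mul_pow, mul_pow, mul_pow, mul_pow, Real.sq_sqrt ENNReal.toReal_nonneg]
  ring

theorem interactionFun_add_left (u u' v w : EvenSpace s) :
    interactionFun hs hm (u + u') v w =
      interactionFun hs hm u v w + interactionFun hs hm u' v w := by
  have hW := fun f : EvenSpace s => (EvenL2.coeFn f).toWL2
  apply EvenSpace.ext
  refine (interactionFun_ae hs hm _ _ _).trans (EventuallyEq.trans ?_ (coe_add_ae _ _).symm)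
  filter_upwards [interactionFun_ae hs hm u v w, interactionFun_ae hs hm u' v w]
    with x h1 h2
  rw [h1, h2]
  simp only [interaction]
  rw [triple_congr (coe_add_ae u u') (EventuallyEq.refl _ _) (EventuallyEq.refl _ _),
    triple_add_left hs hm (hW u) (hW u') (hW v) (hW w), mul_add]

theorem interactionFun_smul_left (c : ℝ) (u v w : EvenSpace s) :
    interactionFun hs hm (c • u) v w = c • interactionFun hs hm u v w := by
  apply EvenSpace.ext
  refine (interactionFun_ae hs hm _ _ _).trans (EventuallyEq.trans ?_ (coe_smul_ae _ _).symm)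
  filter_upwards [interactionFun_ae hs hm u v w] with x h1
  rw [h1]
  simp only [interaction]
  rw [triple_congr (coe_smul_ae c u) (EventuallyEq.refl _ _) (EventuallyEq.refl _ _),
    triple_mul_left]
  ring

theorem interactionFun_add_mid (u v v' w : EvenSpace s) :
    interactionFun hs hm u (v + v') w =
      interactionFun hs hm u v w + interactionFun hs hm u v' w := by
  have hW := fun f : EvenSpace s => (EvenL2.coeFn f).toWL2
  apply EvenSpace.ext
  refine (interactionFun_ae hs hm _ _ _).trans (EventuallyEq.trans ?_ (coe_add_ae _ _).symm)
  filter_upwards [interactionFun_ae hs hm u v w, interactionFun_ae hs hm u v' w]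
    with x h1 h2
  rw [h1, h2]
  simp only [interaction]
  rw [triple_congr (EventuallyEq.refl _ _) (coe_add_ae v v') (EventuallyEq.refl _ _),
    triple_add_mid hs hm (hW u) (hW v) (hW v') (hW w), mul_add]

theorem interactionFun_smul_mid (c : ℝ) (u v w : EvenSpace s) :
    interactionFun hs hm u (c • v) w = c • interactionFun hs hm u v w := by
  apply EvenSpace.ext
  refine (interactionFun_ae hs hm _ _ _).trans (EventuallyEq.trans ?_ (coe_smul_ae _ _).symm)
  filter_upwards [interactionFun_ae hs hm u v w] with x h1
  rw [h1]
  simp only [interaction]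
  rw [triple_congr (EventuallyEq.refl _ _) (coe_smul_ae c v) (EventuallyEq.refl _ _),
    triple_mul_mid]
  ring

theorem interactionFun_add_right (u v w w' : EvenSpace s) :
    interactionFun hs hm u v (w + w') =
      interactionFun hs hm u v w + interactionFun hs hm u v w' := by
  have hW := fun f : EvenSpace s => (EvenL2.coeFn f).toWL2
  apply EvenSpace.ext
  refine (interactionFun_ae hs hm _ _ _).trans (EventuallyEq.trans ?_ (coe_add_ae _ _).symm)
  filter_upwards [interactionFun_ae hs hm u v w, interactionFun_ae hs hm u v w']
    with x h1 h2
  rw [h1, h2]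
  simp only [interaction]
  rw [triple_congr (EventuallyEq.refl _ _) (EventuallyEq.refl _ _) (coe_add_ae w w'),
    triple_add_right hs hm (hW u) (hW v) (hW w) (hW w'), mul_add]

theorem interactionFun_smul_right (c : ℝ) (u v w : EvenSpace s) :
    interactionFun hs hm u v (c • w) = c • interactionFun hs hm u v w := by
  apply EvenSpace.ext
  refine (interactionFun_ae hs hm _ _ _).trans (EventuallyEq.trans ?_ (coe_smul_ae _ _).symm)
  filter_upwards [interactionFun_ae hs hm u v w] with x h1
  rw [h1]
  simp only [interaction]
  rw [triple_congr (EventuallyEq.refl _ _) (EventuallyEq.refl _ _) (coe_smul_ae c w),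
    triple_mul_right]
  ring

/-- The interaction with a fixed first argument as a continuous bilinear map. -/
def interactionCLM₂ (hM : 0 ≤ M) (u : EvenSpace s) :
    EvenSpace s →L[ℝ] EvenSpace s →L[ℝ] EvenSpace s :=
  LinearMap.mkContinuous₂
    (LinearMap.mk₂ ℝ (fun v w => interactionFun hs hm u v w)
      (interactionFun_add_mid hs hm u) (fun c v w => interactionFun_smul_mid hs hm c u v w)
      (interactionFun_add_right hs hm u)
      (fun c v w => interactionFun_smul_right hs hm c u v w))
    (M * Real.sqrt (tripleConst s).toReal * ‖u‖)
    (fun v w => norm_interactionFun_le hs hm hM u v w)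

theorem interactionCLM₂_apply (hM : 0 ≤ M) (u v w : EvenSpace s) :
    interactionCLM₂ hs hm hM u v w = interactionFun hs hm u v w :=
  LinearMap.mkContinuous₂_apply _ _ v w

theorem norm_interactionCLM₂_le (hM : 0 ≤ M) (u : EvenSpace s) :
    ‖interactionCLM₂ hs hm hM u‖ ≤ M * Real.sqrt (tripleConst s).toReal * ‖u‖ :=
  LinearMap.mkContinuous₂_norm_le _ (by positivity)
    (fun v w => norm_interactionFun_le hs hm hM u v w)

/-- The interaction as a linear map with values in the continuous bilinear maps. -/
def interactionLM (hM : 0 ≤ M) :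
    EvenSpace s →ₗ[ℝ] EvenSpace s →L[ℝ] EvenSpace s →L[ℝ] EvenSpace s where
  toFun := interactionCLM₂ hs hm hM
  map_add' u u' := by
    ext1 v
    ext1 w
    rw [add_apply, add_apply, interactionCLM₂_apply, interactionCLM₂_apply,
      interactionCLM₂_apply]
    exact interactionFun_add_left hs hm u u' v w
  map_smul' c u := by
    ext1 v
    ext1 w
    rw [smul_apply, smul_apply, interactionCLM₂_apply, interactionCLM₂_apply]
    exact interactionFun_smul_left hs hm c u v w

/-- The interaction as a continuous trilinear map. -/
def interactionCLM (hM : 0 ≤ M) :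
    EvenSpace s →L[ℝ] EvenSpace s →L[ℝ] EvenSpace s →L[ℝ] EvenSpace s :=
  ⟨interactionLM hs hm hM, AddMonoidHomClass.continuous_of_bound (interactionLM hs hm hM)
    (M * Real.sqrt (tripleConst s).toReal) (norm_interactionCLM₂_le hs hm hM)⟩

theorem interactionCLM_apply (hM : 0 ≤ M) (u v w : EvenSpace s) :
    interactionCLM hs hm hM u v w = interactionFun hs hm u v w := by
  rw [← interactionCLM₂_apply hs hm hM]
  rfl

theorem interactionCLM_ae (hM : 0 ≤ M) (u v w : EvenSpace s) :
    (interactionCLM hs hm hM u v w).fn =ᵐ[freqMeasure] interaction m u.fn v.fn w.fn := by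
  rw [interactionCLM_apply]
  exact interactionFun_ae hs hm u v w

end

/-! ### Slices and integrals over the frequency space -/

theorem ae_freqMeasure_slice {P : ℤ × ℝ → Prop} (h : ∀ᵐ x ∂freqMeasure, P x) (n : ℤ) :
    ∀ᵐ η : ℝ, P (n, η) :=
  Measure.ae_count_iff.1 (Measure.ae_ae_of_ae_prod h) n

theorem ae_freqMeasure_of_slices {P : ℤ × ℝ → Prop} (hP : MeasurableSet {x | P x})
    (h : ∀ n, ∀ᵐ η : ℝ, P (n, η)) : ∀ᵐ x ∂freqMeasure, P x :=
  (Measure.ae_prod_iff_ae_ae hP).2 (Measure.ae_count_iff.2 h)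

theorem lintegral_freqMeasure {f : ℤ × ℝ → ℝ≥0∞} (hf : Measurable f) :
    ∫⁻ x, f x ∂freqMeasure = ∑' n : ℤ, ∫⁻ η : ℝ, f (n, η) := by
  rw [lintegral_prod _ hf.aemeasurable, lintegral_count]

theorem lintegral_slice_le {f : ℤ × ℝ → ℝ≥0∞} (hf : Measurable f) (n : ℤ) :
    ∫⁻ η : ℝ, f (n, η) ≤ ∫⁻ x, f x ∂freqMeasure := by
  rw [lintegral_freqMeasure hf]
  exact ENNReal.le_tsum n

theorem integrable_slice {f : ℤ × ℝ → ℂ} (hf : Integrable f freqMeasure) (n : ℤ) :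
    Integrable fun η : ℝ => f (n, η) :=
  Measure.ae_count_iff.1 hf.prod_right_ae n

theorem summable_integral_norm_slice {f : ℤ × ℝ → ℂ} (hf : Integrable f freqMeasure) :
    Summable fun n : ℤ => ∫ η : ℝ, ‖f (n, η)‖ := by
  have := integrable_count_iff.1 hf.integral_norm_prod_left
  refine this.congr fun n => ?_
  rw [Real.norm_of_nonneg (by positivity)]

theorem integral_freqMeasure {f : ℤ × ℝ → ℂ} (hf : Integrable f freqMeasure) :
    ∫ x, f x ∂freqMeasure = ∑' n : ℤ, ∫ η : ℝ, f (n, η) := by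
  rw [integral_prod _ hf, integral_countable hf.integral_prod_left]
  simp

/-- The coefficient g sees only the harmonics, so the two frequency integrals factor and a double
sum remains. It converges absolutely as the L¹ norms of the slices are summable. -/
theorem integral_pair {g : ℤ → ℤ → ℂ} {M : ℝ} (hg : ∀ q r, ‖g q r‖ ≤ M) {a b : ℤ × ℝ → ℂ}
    (ha : Integrable a freqMeasure) (hb : Integrable b freqMeasure) :
    (Summable fun k : ℤ × ℤ => ‖g k.1 k.2 * (∫ η : ℝ, a (k.1, η)) * ∫ η : ℝ, b (k.2, η)‖) ∧
    ∫ z : (ℤ × ℝ) × (ℤ × ℝ), g z.1.1 z.2.1 * a z.1 * b z.2 ∂(freqMeasure.prod freqMeasure) =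
      ∑' k : ℤ × ℤ, g k.1 k.2 * (∫ η : ℝ, a (k.1, η)) * ∫ η : ℝ, b (k.2, η) := by
  have hM : 0 ≤ M := (norm_nonneg _).trans (hg 0 0)
  have hsum : Summable fun k : ℤ × ℤ =>
      ‖g k.1 k.2 * (∫ η : ℝ, a (k.1, η)) * ∫ η : ℝ, b (k.2, η)‖ := by
    refine Summable.of_nonneg_of_le (fun k => norm_nonneg _) (fun k => ?_)
      (((summable_integral_norm_slice ha).mul_of_nonneg (summable_integral_norm_slice hb)
        (fun _ => by positivity) (fun _ => by positivity)).mul_left M)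
    rw [norm_mul, norm_mul, mul_assoc]
    gcongr
    · exact hg _ _
    · exact norm_integral_le_integral_norm _
    · exact norm_integral_le_integral_norm _
  refine ⟨hsum, ?_⟩
  have hgm : Measurable fun z : (ℤ × ℝ) × (ℤ × ℝ) => g z.1.1 z.2.1 :=
    (measurable_of_countable (fun k : ℤ × ℤ => g k.1 k.2)).comp
      (by fun_prop : Measurable fun z : (ℤ × ℝ) × (ℤ × ℝ) => (z.1.1, z.2.1))
  have hint : Integrable (fun z : (ℤ × ℝ) × (ℤ × ℝ) => g z.1.1 z.2.1 * a z.1 * b z.2)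
      (freqMeasure.prod freqMeasure) := by
    simp_rw [mul_assoc]
    exact (ha.mul_prod hb).bdd_mul hgm.aestronglyMeasurable (ae_of_all _ fun z => hg _ _)
  have hinner : ∀ y : ℤ × ℝ, ∫ z, g y.1 z.1 * a y * b z ∂freqMeasure =
      a y * ∑' r, g y.1 r * ∫ η : ℝ, b (r, η) := by
    intro y
    have hi : Integrable (fun z : ℤ × ℝ => g y.1 z.1 * b z) freqMeasure :=
      hb.bdd_mul ((measurable_of_countable (g y.1)).comp measurable_fst).aestronglyMeasurable
        (ae_of_all _ fun z => hg _ _)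
    calc ∫ z, g y.1 z.1 * a y * b z ∂freqMeasure = ∫ z, a y * (g y.1 z.1 * b z) ∂freqMeasure := by
          congr with z
          ring
      _ = _ := by
          rw [integral_const_mul, integral_freqMeasure hi]
          simp_rw [integral_const_mul]
  rw [integral_prod _ hint]
  dsimp only
  simp_rw [hinner]
  have hi2 : Integrable (fun y : ℤ × ℝ => a y * ∑' r, g y.1 r * ∫ η : ℝ, b (r, η))
      freqMeasure := by
    simpa only [hinner] using hint.integral_prod_left
  rw [integral_freqMeasure hi2, hsum.of_norm.tsum_prod]
  congr with q
  dsimp only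
  rw [integral_mul_const, ← tsum_mul_left]
  congr with r
  ring

/-! ### Envelopes of the harmonics -/

/-- The plane wave `e^{i ξ ζ}` with `ξ = 2 π η`. -/
def wave (ζ η : ℝ) : ℂ := Complex.exp (2 * Real.pi * η * ζ * Complex.I)

theorem norm_wave (ζ η : ℝ) : ‖wave ζ η‖ = 1 := by
  have : (2 * Real.pi * η * ζ * Complex.I : ℂ) = ((2 * Real.pi * η * ζ : ℝ) : ℂ) * Complex.I := by
    push_cast; ring
  rw [wave, this, Complex.norm_exp_ofReal_mul_I]

theorem wave_add (ζ a b : ℝ) : wave ζ (a + b) = wave ζ a * wave ζ b := by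
  rw [wave, wave, wave, ← Complex.exp_add]
  push_cast
  congr 1
  ring

theorem conj_wave (ζ η : ℝ) : conj (wave ζ η) = wave ζ (-η) := by
  rw [wave, wave, ← Complex.exp_conj]
  congr 1
  apply Complex.ext <;> simp

theorem wave_neg_left (ζ η : ℝ) : wave (-ζ) η = wave ζ (-η) := by
  rw [wave, wave]
  push_cast
  congr 1
  ring

theorem continuous_wave (ζ : ℝ) : Continuous (wave ζ) := by
  unfold wave
  fun_prop

theorem fourierInv_eq_integral_wave (f : ℝ → ℂ) (ζ : ℝ) : 𝓕⁻ f ζ = ∫ η : ℝ, wave ζ η * f η := by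
  rw [Real.fourierInv_eq']
  congr with η
  rw [smul_eq_mul, wave]
  congr 2
  simp
  ring

theorem integrable_wave_mul {f : ℝ → ℂ} (hf : Integrable f) (ζ : ℝ) :
    Integrable fun η => wave ζ η * f η :=
  hf.bdd_mul (c := 1) (continuous_wave ζ).aestronglyMeasurable
    (ae_of_all _ fun η => (norm_wave ζ η).le)

/-- The envelope of the harmonic `p = 2 n + 1` of the field with Fourier transform `u`. -/
def envelope (u : ℤ × ℝ → ℝ) (n : ℤ) : ℝ → ℂ := 𝓕⁻ fun η : ℝ => (u (n, η) : ℂ)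

theorem envelope_eq (u : ℤ × ℝ → ℝ) (n : ℤ) (ζ : ℝ) :
    envelope u n ζ = ∫ η : ℝ, wave ζ η * (u (n, η) : ℂ) :=
  fourierInv_eq_integral_wave _ _

theorem envelope_congr {u v : ℤ × ℝ → ℝ} (h : u =ᵐ[freqMeasure] v) (n : ℤ) :
    envelope u n = envelope v n := by
  funext ζ
  refine Real.fourierInv_congr_ae ?_ ζ
  filter_upwards [ae_freqMeasure_slice h n] with η hη
  rw [hη]

section

variable {s : ℝ} {u v w : ℤ × ℝ → ℝ}

theorem WL2.integrable_complex (hs : 1 < s) (hu : WL2 s u) :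
    Integrable (fun x => (u x : ℂ)) freqMeasure :=
  (hu.integrable hs).ofReal

theorem WL2.integrable_slice (hs : 1 < s) (hu : WL2 s u) (n : ℤ) :
    Integrable fun η : ℝ => (u (n, η) : ℂ) :=
  XNLS.integrable_slice (hu.integrable_complex hs) n

theorem WL2.memLp_slice (hs : 1 < s) (hu : WL2 s u) (n : ℤ) :
    MemLp (fun η : ℝ => (u (n, η) : ℂ)) 2 := by
  refine ⟨(hu.integrable_slice hs n).aestronglyMeasurable, ?_⟩
  rw [eLpNorm_lt_top_iff_lintegral_rpow_enorm_lt_top (by simp) (by simp)]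
  have h := (lintegral_slice_le (hu.measurable.enorm.pow_const 2) n).trans_lt
    (hu.lintegral_sq_lt_top hs)
  simpa [← ofReal_norm] using h

theorem norm_envelope_le (u : ℤ × ℝ → ℝ) (n : ℤ) (ζ : ℝ) :
    ‖envelope u n ζ‖ ≤ ∫ η : ℝ, ‖(u (n, η) : ℂ)‖ := norm_fourierInv_le _ _

theorem WL2.summable_norm (hs : 1 < s) (hu : WL2 s u) :
    Summable fun n : ℤ => ∫ η : ℝ, ‖(u (n, η) : ℂ)‖ :=
  summable_integral_norm_slice (f := fun x => (u x : ℂ)) (hu.integrable_complex hs)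

theorem WL2.summable_envelope (hs : 1 < s) (hu : WL2 s u) (ζ : ℝ) :
    Summable fun n : ℤ => ‖envelope u n ζ‖ :=
  Summable.of_nonneg_of_le (fun _ => norm_nonneg _) (fun n => norm_envelope_le u n ζ)
    (hu.summable_norm hs)

theorem WL2.exists_norm_envelope_le (hs : 1 < s) (hu : WL2 s u) :
    ∃ M, ∀ n ζ, ‖envelope u n ζ‖ ≤ M :=
  ⟨_, fun n ζ => (norm_envelope_le u n ζ).trans
    ((hu.summable_norm hs).le_tsum n fun _ _ => by positivity)⟩

theorem WL2.continuous_envelope (hs : 1 < s) (hu : WL2 s u) (n : ℤ) :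
    Continuous (envelope u n) := continuous_fourierInv (hu.integrable_slice hs n)

theorem EvenL2.slice_neg (hu : EvenL2 s u) (n : ℤ) : ∀ᵐ η : ℝ, u (n, -η) = u (n, η) :=
  ae_freqMeasure_slice (P := fun x => u (reflectSpace x) = u x) hu.space n

theorem EvenL2.slice_harmonic (hu : EvenL2 s u) (n : ℤ) :
    ∀ᵐ η : ℝ, u (-1 - n, η) = u (n, η) :=
  ae_freqMeasure_slice (P := fun x => u (reflectHarmonic x) = u x) hu.harmonic n

theorem EvenL2.envelope_neg (hu : EvenL2 s u) (n : ℤ) (ζ : ℝ) :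
    envelope u n (-ζ) = envelope u n ζ := by
  rw [envelope_eq, envelope_eq, ← integral_neg_eq_self]
  refine integral_congr_ae ?_
  filter_upwards [hu.slice_neg n] with η hη
  rw [hη, wave_neg_left, neg_neg]

/-- Conjugation turns ζ into -ζ because u is real, and evenness in η undoes this. -/
theorem EvenL2.conj_envelope (hu : EvenL2 s u) (n : ℤ) (ζ : ℝ) :
    conj (envelope u n ζ) = envelope u n ζ := by
  refine Eq.trans ?_ (hu.envelope_neg n ζ)
  rw [envelope_eq, envelope_eq, ← integral_conj]
  congr with η
  rw [map_mul, conj_wave, wave_neg_left, Complex.conj_ofReal]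

theorem EvenL2.envelope_reflect (hu : EvenL2 s u) (n : ℤ) :
    envelope u (-1 - n) = envelope u n := by
  funext ζ
  rw [envelope_eq, envelope_eq]
  refine integral_congr_ae ?_
  filter_upwards [hu.slice_harmonic n] with η hη
  rw [hη]

theorem ae_eq_of_envelope_eq (hs : 1 < s) (hu : WL2 s u) (hv : WL2 s v)
    (h : ∀ n, envelope u n = envelope v n) : u =ᵐ[freqMeasure] v := by
  refine ae_freqMeasure_of_slices (measurableSet_eq_fun hu.measurable hv.measurable) fun n => ?_
  filter_upwards [ae_eq_of_fourierInv_eq (hu.integrable_slice hs n) (hu.memLp_slice hs n)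
    (hv.integrable_slice hs n) (hv.memLp_slice hs n) (h n)] with η hη
  exact_mod_cast hη

theorem integrable_wave_mul_freq {f : ℤ × ℝ → ℂ} (hf : Integrable f freqMeasure) (ζ : ℝ) :
    Integrable (fun x : ℤ × ℝ => wave ζ x.2 * f x) freqMeasure :=
  hf.bdd_mul (c := 1) ((continuous_wave ζ).comp continuous_snd).aestronglyMeasurable
    (ae_of_all _ fun x => (norm_wave ζ x.2).le)

/-- The convolution theorem: by Fubini and a translation in η, the multiplicative wave splits into
three waves, one per factor. Absolute convergence of the double sum comes along, since the system
requires it. -/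
theorem envelope_triple (hs : 1 < s) {m : ℤ → ℤ → ℤ → ℝ} {M : ℝ} (hm : IsMask m M)
    (hu : WL2 s u) (hv : WL2 s v) (hw : WL2 s w) (n : ℤ) (ζ : ℝ) :
    (Summable fun k : ℤ × ℤ => ‖(m n k.1 k.2 : ℂ) * (envelope u k.1 ζ * envelope v k.2 ζ *
      envelope w (n - k.1 - k.2 - 1) ζ)‖) ∧
    envelope (triple m u v w) n ζ = ∑' k : ℤ × ℤ, (m n k.1 k.2 : ℂ) *
      (envelope u k.1 ζ * envelope v k.2 ζ * envelope w (n - k.1 - k.2 - 1) ζ) := by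
  have hmu := hu.measurable
  have hmv := hv.measurable
  have hmw := hw.measurable
  obtain ⟨Mw, hMw⟩ := hw.exists_norm_envelope_le hs
  have hM0 : 0 ≤ M := (abs_nonneg _).trans (hm.bound 0 0 0)
  -- Once η is integrated out, the third factor depends on the two harmonics alone, so its envelope
  -- joins the mask as a bounded coefficient.
  have hpair := integral_pair (g := fun q r => (m n q r : ℂ) * envelope w (n - q - r - 1) ζ)
    (M := M * Mw) (fun q r => by
      rw [norm_mul, Complex.norm_real]
      exact mul_le_mul (hm.bound _ _ _) (hMw _ _) (norm_nonneg _) hM0)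
    (integrable_wave_mul_freq (hu.integrable_complex hs) ζ)
    (integrable_wave_mul_freq (hv.integrable_complex hs) ζ)
  simp only [← envelope_eq] at hpair
  have hre : ∀ k : ℤ × ℤ, (m n k.1 k.2 : ℂ) * envelope w (n - k.1 - k.2 - 1) ζ *
      envelope u k.1 ζ * envelope v k.2 ζ = (m n k.1 k.2 : ℂ) * (envelope u k.1 ζ *
      envelope v k.2 ζ * envelope w (n - k.1 - k.2 - 1) ζ) := fun k => by ring
  simp only [hre] at hpair
  refine ⟨hpair.1, ?_⟩
  rw [← hpair.2]
  let F : ℝ → (ℤ × ℝ) × (ℤ × ℝ) → ℂ := fun η z => wave ζ η *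
    ((m n z.1.1 z.2.1 * (u z.1 * v z.2 * w ((n, η) - z.1 - z.2 - (1, 0))) : ℝ) : ℂ)
  have hFm : Measurable (Function.uncurry F) := by
    have h1 := (measurable_triple_integrand m hmu hmv hmw).comp
      (by fun_prop : Measurable fun p : ℝ × ((ℤ × ℝ) × (ℤ × ℝ)) => (((n, p.1) : ℤ × ℝ), p.2))
    have h2 := (continuous_wave ζ).measurable
    exact (h2.comp measurable_fst).mul (Complex.measurable_ofReal.comp h1)
  have hFi : Integrable (Function.uncurry F) (volume.prod (freqMeasure.prod freqMeasure)) := by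
    refine ⟨hFm.aestronglyMeasurable, ?_⟩
    rw [hasFiniteIntegral_iff_enorm, lintegral_prod_symm _ hFm.enorm.aemeasurable]
    -- Integrating over η first removes the translation, leaving one slice of w, whose L¹ norm is at
    -- most that of w.
    have hb : ∀ z : (ℤ × ℝ) × (ℤ × ℝ), ∫⁻ η : ℝ, ‖Function.uncurry F (η, z)‖ₑ ≤
        ENNReal.ofReal M * ((∫⁻ x, ‖w x‖ₑ ∂freqMeasure) * (‖u z.1‖ₑ * ‖v z.2‖ₑ)) := by
      intro z
      have h1 : ∀ η : ℝ, ‖Function.uncurry F (η, z)‖ₑ ≤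
          ENNReal.ofReal M * (‖u z.1‖ₑ * ‖v z.2‖ₑ) *
            ‖w (n - z.1.1 - z.2.1 - 1, η - (z.1.2 + z.2.2))‖ₑ := by
        intro η
        have e : ‖Function.uncurry F (η, z)‖ₑ = ‖m n z.1.1 z.2.1 * (u z.1 * v z.2 *
            w ((n, η) - z.1 - z.2 - (1, 0)))‖ₑ := by
          simp only [Function.uncurry, F, enorm_mul]
          rw [← ofReal_norm (wave ζ η), norm_wave, ENNReal.ofReal_one, one_mul,
            ← ofReal_norm, Complex.norm_real, ofReal_norm]
          simp only [enorm_mul]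
        rw [e]
        refine (enorm_triple_integrand_le hm u v w (n, η) z).trans_eq ?_
        have : ((n, η) : ℤ × ℝ) - z.1 - z.2 - (1, 0) =
            (n - z.1.1 - z.2.1 - 1, η - (z.1.2 + z.2.2)) := by
          ext <;> simp
          ring
        rw [this]
        ring
      refine (lintegral_mono h1).trans ?_
      rw [lintegral_const_mul _ (by fun_prop),
        lintegral_sub_right_eq_self (fun η => ‖w (n - z.1.1 - z.2.1 - 1, η)‖ₑ)]
      refine (mul_le_mul_right (lintegral_slice_le hmw.enorm _) _).trans_eq ?_
      ring
    refine (lintegral_mono hb).trans_lt ?_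
    rw [lintegral_const_mul _ (by fun_prop), lintegral_const_mul _ (by fun_prop),
      lintegral_prod_mul (f := fun y => ‖u y‖ₑ) (g := fun y => ‖v y‖ₑ) (by fun_prop)
        (by fun_prop)]
    exact ENNReal.mul_lt_top ENNReal.ofReal_lt_top (ENNReal.mul_lt_top (hw.lintegral_lt_top hs)
      (ENNReal.mul_lt_top (hu.lintegral_lt_top hs) (hv.lintegral_lt_top hs)))
  calc envelope (triple m u v w) n ζ = ∫ η : ℝ, ∫ z, F η z ∂(freqMeasure.prod freqMeasure) := by
        rw [envelope_eq]
        congr with η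
        rw [integral_const_mul, integral_complex_ofReal]
        rfl
    _ = ∫ z, (∫ η : ℝ, F η z) ∂(freqMeasure.prod freqMeasure) := integral_integral_swap hFi
    _ = _ := by
        congr with z
        have h1 : ∀ η : ℝ, F η z = (fun t : ℝ => (m n z.1.1 z.2.1 : ℂ) *
            (wave ζ z.1.2 * u z.1) * (wave ζ z.2.2 * v z.2) * (wave ζ t *
            (w (n - z.1.1 - z.2.1 - 1, t) : ℂ))) (η - (z.1.2 + z.2.2)) := by
          intro η
          have e1 : ((n, η) : ℤ × ℝ) - z.1 - z.2 - (1, 0) =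
              (n - z.1.1 - z.2.1 - 1, η - (z.1.2 + z.2.2)) := by
            ext <;> simp
            ring
          have e2 : wave ζ η = wave ζ z.1.2 * wave ζ z.2.2 * wave ζ (η - (z.1.2 + z.2.2)) := by
            rw [← wave_add, ← wave_add]
            congr 1
            ring
          simp only [F]
          rw [e1, e2]
          push_cast
          ring
        simp_rw [h1]
        rw [integral_sub_right_eq_self (fun t : ℝ => (m n z.1.1 z.2.1 : ℂ) *
            (wave ζ z.1.2 * u z.1) * (wave ζ z.2.2 * v z.2) * (wave ζ t *
            (w (n - z.1.1 - z.2.1 - 1, t) : ℂ))), integral_const_mul, ← envelope_eq]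
        ring

end

/-! ### The field with given Fourier transform -/

/-- The harmonic `e^{ipφ}` with `p = 2 n + 1`. -/
def carrier (n : ℤ) (φ : ℝ) : ℂ := Complex.exp (Complex.I * ((2 * n + 1 : ℤ) : ℂ) * φ)

theorem norm_carrier (n : ℤ) (φ : ℝ) : ‖carrier n φ‖ = 1 := by
  have : (Complex.I * ((2 * n + 1 : ℤ) : ℂ) * φ) =
      (((2 * n + 1 : ℤ) * φ : ℝ) : ℂ) * Complex.I := by push_cast; ring
  rw [carrier, this, Complex.norm_exp_ofReal_mul_I]

theorem continuous_carrier (n : ℤ) : Continuous (carrier n) := by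
  unfold carrier; fun_prop

theorem conj_carrier (n : ℤ) (φ : ℝ) : conj (carrier n φ) = carrier (-1 - n) φ := by
  rw [carrier, carrier, ← Complex.exp_conj]
  congr 1
  simp only [map_mul, Complex.conj_I, Complex.conj_ofReal, map_intCast]
  push_cast
  ring

theorem carrier_add_two_pi (n : ℤ) (φ : ℝ) : carrier n (φ + 2 * Real.pi) = carrier n φ := by
  rw [carrier, carrier, Complex.exp_eq_exp_iff_exists_int]
  exact ⟨2 * n + 1, by push_cast; ring⟩

theorem integral_exp_int_mul (k : ℤ) :
    ∫ φ in (-Real.pi)..Real.pi, Complex.exp (Complex.I * k * φ) =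
      if k = 0 then (2 * Real.pi : ℂ) else 0 := by
  split_ifs with hk
  · subst hk
    simp
    ring
  · have hc : Complex.I * (k : ℂ) ≠ 0 := mul_ne_zero Complex.I_ne_zero (by exact_mod_cast hk)
    rw [integral_exp_mul_complex hc, div_eq_zero_iff, sub_eq_zero]
    left
    rw [Complex.exp_eq_exp_iff_exists_int]
    exact ⟨k, by push_cast; ring⟩

/-- The field with Fourier transform `u`, as a complex number. -/
def cfield (u : ℤ × ℝ → ℝ) (ζ φ : ℝ) : ℂ := ∑' n : ℤ, envelope u n ζ * carrier n φ

/-- The field with Fourier transform `u`. -/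
def field (u : ℤ × ℝ → ℝ) (ζ φ : ℝ) : ℝ := (cfield u ζ φ).re

section

variable {s : ℝ} {u : ℤ × ℝ → ℝ}

theorem EvenL2.conj_cfield (hu : EvenL2 s u) (ζ φ : ℝ) :
    conj (cfield u ζ φ) = cfield u ζ φ := by
  have hinv : Function.Involutive (fun n : ℤ => -1 - n) := fun n => by simp
  rw [cfield, Complex.conj_tsum, ← (hinv.toPerm).tsum_eq (fun n => envelope u n ζ * carrier n φ)]
  congr with n
  rw [map_mul, hu.conj_envelope, conj_carrier]
  change _ = envelope u (-1 - n) ζ * carrier (-1 - n) φ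
  rw [hu.envelope_reflect]

theorem EvenL2.ofReal_field (hu : EvenL2 s u) (ζ φ : ℝ) : (field u ζ φ : ℂ) = cfield u ζ φ :=
  Complex.conj_eq_iff_re.1 (hu.conj_cfield ζ φ)

theorem norm_envelope_mul_carrier (n : ℤ) (ζ φ : ℝ) :
    ‖envelope u n ζ * carrier n φ‖ = ‖envelope u n ζ‖ := by
  rw [norm_mul, norm_carrier, mul_one]

theorem WL2.continuous_cfield (hs : 1 < s) (hu : WL2 s u) :
    Continuous (Function.uncurry (cfield u)) := by
  refine continuous_tsum (fun n => ?_) (hu.summable_norm hs) fun n x => ?_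
  · exact ((hu.continuous_envelope hs n).comp continuous_fst).mul
      ((continuous_carrier n).comp continuous_snd)
  · rw [norm_envelope_mul_carrier]
    exact norm_envelope_le u n x.1

theorem WL2.continuous_field (hs : 1 < s) (hu : WL2 s u) :
    Continuous (Function.uncurry (field u)) :=
  Complex.continuous_re.comp (hu.continuous_cfield hs)

theorem field_periodic (u : ℤ × ℝ → ℝ) (ζ : ℝ) :
    Function.Periodic (field u ζ) (2 * Real.pi) := fun φ => by
  simp only [field, cfield, carrier_add_two_pi]

theorem tendsto_envelope (u : ℤ × ℝ → ℝ) (n : ℤ) :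
    Tendsto (envelope u n) (cocompact ℝ) (𝓝 0) := by
  rw [envelope, Real.fourierInv_eq_fourier_comp_neg]
  exact Real.zero_at_infty_fourier _

/-- Riemann-Lebesgue for each envelope, with the summable L¹ norms of the slices as a dominating
sequence. -/
theorem WL2.tendsto_field (hs : 1 < s) (hu : WL2 s u) (φ : ℝ) :
    Tendsto (fun ζ => field u ζ φ) (cocompact ℝ) (𝓝 0) := by
  have h : Tendsto (fun ζ => cfield u ζ φ) (cocompact ℝ) (𝓝 (∑' _ : ℤ, 0)) := by
    refine tendsto_tsum_of_dominated_convergence (hu.summable_norm hs) (fun n => ?_)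
      (Eventually.of_forall fun ζ n => ?_)
    · simpa using (tendsto_envelope u n).mul_const (carrier n φ)
    · rw [norm_envelope_mul_carrier]
      exact norm_envelope_le u n ζ
  rw [tsum_zero] at h
  exact (Complex.continuous_re.tendsto 0).comp h

theorem EvenL2.mode_field (hs : 1 < s) (hu : EvenL2 s u) (p : ℤ) (ζ : ℝ) :
    mode (field u) p ζ = ∑' n : ℤ, if 2 * n + 1 - p = 0 then envelope u n ζ else 0 := by
  have h := intervalIntegral.hasSum_integral_of_dominated_convergence (μ := volume)
    (a := -Real.pi) (b := Real.pi)
    (F := fun (n : ℤ) (φ : ℝ) => envelope u n ζ * carrier n φ *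
      Complex.exp (-(Complex.I * p * φ)))
    (f := fun φ => (field u ζ φ : ℂ) * Complex.exp (-(Complex.I * p * φ)))
    (fun n _ => ‖envelope u n ζ‖)
    (fun n => by
      have := continuous_carrier n
      exact Continuous.aestronglyMeasurable (by fun_prop))
    (fun n => ae_of_all _ fun φ _ => by
      have hn : ‖Complex.exp (-(Complex.I * p * φ))‖ = 1 := by
        have : -(Complex.I * p * φ) = ((-(p * φ) : ℝ) : ℂ) * Complex.I := by push_cast; ring
        rw [this, Complex.norm_exp_ofReal_mul_I]
      rw [norm_mul, norm_envelope_mul_carrier, hn, mul_one])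
    (ae_of_all _ fun φ _ => hu.summable_envelope hs ζ)
    intervalIntegrable_const
    (ae_of_all _ fun φ _ => by
      rw [hu.ofReal_field]
      refine HasSum.mul_right _ ?_
      refine Summable.hasSum (Summable.of_norm ?_)
      simpa only [norm_envelope_mul_carrier] using hu.summable_envelope hs ζ)
  rw [mode, ← h.tsum_eq, ← tsum_mul_left]
  congr with n
  have e : ∀ φ : ℝ, envelope u n ζ * carrier n φ * Complex.exp (-(Complex.I * p * φ)) =
      envelope u n ζ * Complex.exp (Complex.I * ((2 * n + 1 - p : ℤ) : ℂ) * φ) := fun φ => by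
    rw [carrier, mul_assoc, ← Complex.exp_add]
    congr 2
    push_cast
    ring
  simp_rw [e]
  rw [intervalIntegral.integral_const_mul, integral_exp_int_mul]
  have hpi : (Real.pi : ℂ) ≠ 0 := by exact_mod_cast Real.pi_ne_zero
  split_ifs
  · field_simp
  · simp

theorem EvenL2.mode_field_odd (hs : 1 < s) (hu : EvenL2 s u) (n : ℤ) :
    mode (field u) (2 * n + 1) = envelope u n := by
  funext ζ
  rw [hu.mode_field hs, tsum_eq_single n]
  · simp
  · intro k hk
    rw [if_neg]
    omega

theorem EvenL2.mode_field_even (hs : 1 < s) (hu : EvenL2 s u) {p : ℤ} (hp : Even p) (ζ : ℝ) :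
    mode (field u) p ζ = 0 := by
  rw [hu.mode_field hs]
  convert tsum_zero with n
  rw [if_neg]
  obtain ⟨k, rfl⟩ := hp
  omega

/-! ### Energies -/

/-- Odd integers as `2 n + 1`. -/
def oddEquiv : ℤ ≃ {p : ℤ // Odd p} where
  toFun n := ⟨2 * n + 1, ⟨n, rfl⟩⟩
  invFun p := p.1 / 2
  left_inv n := by simp; omega
  right_inv p := by
    obtain ⟨_, k, rfl⟩ := p
    apply Subtype.ext
    simp
    omega

/-- The Plancherel transform of the envelope is the slice of u from which it was built, so the
energy is exactly the weighted L² norm of that slice. -/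
theorem modeEnergy_envelope (hs : 1 < s) (hu : WL2 s u) (n : ℤ) :
    modeEnergy s (2 * n + 1) (envelope u n) = ∫⁻ η : ℝ, eweight s (n, η) * ‖u (n, η)‖ₑ ^ 2 := by
  have h := memLp_fourierInv (hu.integrable_slice hs n) (hu.memLp_slice hs n)
  have h' : MemLp (envelope u n) 2 (volume : Measure ℝ) := h
  rw [modeEnergy, dif_pos h']
  refine lintegral_congr_ae ?_
  have e : 𝓕 (h'.toLp (envelope u n)) = (hu.memLp_slice hs n).toLp _ :=
    fourier_toLp_fourierInv (hu.integrable_slice hs n) (hu.memLp_slice hs n) h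
  rw [e]
  filter_upwards [(hu.memLp_slice hs n).coeFn_toLp] with η hη
  rw [hη, eweight, weight, ← ofReal_norm, ← ofReal_norm, Complex.norm_real]

theorem wsq_eq_tsum (hu : Measurable u) :
    wsq s u = ∑' n : ℤ, ∫⁻ η : ℝ, eweight s (n, η) * ‖u (n, η)‖ₑ ^ 2 := by
  have := measurable_eweight s
  exact lintegral_freqMeasure (by fun_prop)

theorem xNorm_eq_tsum (s : ℝ) (U : ℝ → ℝ → ℝ) :
    xNorm s U = (∑' n : ℤ, modeEnergy s (2 * n + 1) (mode U (2 * n + 1))) ^ (1 / 2 : ℝ) := by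
  rw [xNorm, ← oddEquiv.tsum_eq]
  rfl

theorem xNorm_eq_of_mode_eq (hs : 1 < s) (hu : WL2 s u) {U : ℝ → ℝ → ℝ}
    (h : ∀ n, mode U (2 * n + 1) = envelope u n) : xNorm s U = wsq s u ^ (1 / 2 : ℝ) := by
  rw [xNorm_eq_tsum, wsq_eq_tsum hu.measurable]
  simp_rw [h, modeEnergy_envelope hs hu]

/-- Handles the dependence of the L² class on the membership proof, which blocks rewriting f by g
directly. -/
theorem fourier_toLp_congr {f g : ℝ → ℂ} (hf : MemLp f 2) (hg : MemLp g 2) (h : f = g) :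
    (𝓕 (hf.toLp f) : Lp ℂ 2 (volume : Measure ℝ)) = 𝓕 (hg.toLp g) := by
  subst h
  rfl

/-- Real, even, continuous envelopes of finite energy are the envelopes of a symmetric
function. -/
theorem exists_evenL2_of_modeEnergy (hs : 1 < s) {f : ℤ → ℝ → ℂ} (hcont : ∀ n, Continuous (f n))
    (hreal : ∀ n ζ, conj (f n ζ) = f n ζ) (heven : ∀ n ζ, f n (-ζ) = f n ζ)
    (hrefl : ∀ n, f (-1 - n) = f n)
    (hfin : ∑' n : ℤ, modeEnergy s (2 * n + 1) (f n) < ⊤) :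
    ∃ u, EvenL2 s u ∧ ∀ n, f n = envelope u n := by
  have hne : ∀ n, modeEnergy s (2 * n + 1) (f n) < ⊤ := fun n =>
    (ENNReal.le_tsum n).trans_lt hfin
  have hmem : ∀ n, MemLp (f n) 2 (volume : Measure ℝ) := fun n => by
    by_contra hcon
    have := hne n
    rw [modeEnergy, dif_neg hcon] at this
    exact lt_irrefl _ this
  let d : ℤ → ℝ → ℂ := fun n => (𝓕 ((hmem n).toLp (f n)) : Lp ℂ 2 (volume : Measure ℝ))
  have hdm : ∀ n, Measurable (d n) := fun n => (Lp.stronglyMeasurable _).measurable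
  have hd2 : ∀ n, MemLp (d n) 2 := fun n => Lp.memLp _
  have hden : ∀ n, modeEnergy s (2 * n + 1) (f n) =
      ∫⁻ η : ℝ, eweight s (n, η) * ‖d n η‖ₑ ^ 2 := fun n => by
    rw [modeEnergy, dif_pos (hmem n)]
    rfl
  have hW := measurable_eweight s
  -- Finite energy and Cauchy-Schwarz against the weight make the transform integrable, so that
  -- pointwise Fourier inversion is available.
  have hdi : ∀ n, Integrable (d n) := fun n => by
    refine ⟨(hdm n).aestronglyMeasurable, ?_⟩
    have h1 := sq_lintegral_le_weighted (μ := volume) (f := fun η => ‖d n η‖ₑ)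
      (h := fun η : ℝ => eweight s (n, η)) (hdm n).enorm.aemeasurable (by fun_prop)
      (fun η => eweight_ne_zero s _) (fun η => eweight_ne_top s _)
    have h2 : ∫⁻ η : ℝ, (eweight s (n, η))⁻¹ < ⊤ :=
      (lintegral_slice_le hW.inv n).trans_lt (lintegral_inv_eweight_lt_top hs)
    have h3 := h1.trans_lt (ENNReal.mul_lt_top h2 ((hden n).symm ▸ hne n))
    by_contra hcon
    rw [hasFiniteIntegral_iff_enorm, not_lt, top_le_iff] at hcon
    simp [hcon] at h3
  have hfd : ∀ n, f n = 𝓕⁻ (d n) := fun n => eq_fourierInv_of_integrable (hcont n) (hmem n) (hdi n)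
  -- The inverse transform of the conjugate of `d n` at ζ is the conjugate of f_n(-ζ), which is
  -- f_n(ζ) for a real even envelope; injectivity of the inverse transform concludes.
  have hconj : ∀ n, (fun η => conj (d n η)) =ᵐ[volume] d n := fun n => by
    refine ae_eq_of_fourierInv_eq (Complex.conjLIE.toContinuousLinearEquiv.integrable_comp_iff.2
      (hdi n)) ((hd2 n).star) (hdi n) (hd2 n) ?_
    funext ζ
    rw [← hfd n, ← heven n ζ, ← hreal n (-ζ), hfd n, fourierInv_eq_integral_wave,
      fourierInv_eq_integral_wave, ← integral_conj]
    congr with η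
    rw [map_mul, conj_wave, wave_neg_left, neg_neg]
  have hneg : ∀ n, (fun η => d n (-η)) =ᵐ[volume] d n := fun n => by
    refine ae_eq_of_fourierInv_eq (hdi n).comp_neg
      ((hd2 n).comp_measurePreserving (Measure.measurePreserving_neg volume)) (hdi n) (hd2 n) ?_
    funext ζ
    rw [← hfd n, ← heven n ζ, hfd n, fourierInv_eq_integral_wave, fourierInv_eq_integral_wave,
      ← integral_neg_eq_self]
    congr with η
    rw [wave_neg_left, neg_neg]
  have hdr : ∀ n, d (-1 - n) = d n := fun n => by
    simp only [d]
    rw [fourier_toLp_congr (hmem (-1 - n)) (hmem n) (hrefl n)]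
  -- Nothing is lost in taking the real part, since `d n` is real almost everywhere.
  let u : ℤ × ℝ → ℝ := fun x => (d x.1 x.2).re
  have hum : Measurable u := measurable_from_prod_countable_right fun n =>
    Complex.measurable_re.comp (hdm n)
  have hud : ∀ n, (fun η : ℝ => (u (n, η) : ℂ)) =ᵐ[volume] d n := fun n => by
    filter_upwards [hconj n] with η hη
    exact Complex.conj_eq_iff_re.1 hη
  have hws : wsq s u < ⊤ := by
    rw [wsq_eq_tsum hum]
    refine (ENNReal.tsum_le_tsum fun n => ?_).trans_lt hfin
    rw [hden]
    refine lintegral_mono fun η => ?_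
    gcongr
    rw [← ofReal_norm, ← ofReal_norm]
    exact ENNReal.ofReal_le_ofReal (Complex.abs_re_le_norm _)
  refine ⟨u, ⟨⟨hum, hws⟩, ?_, ?_⟩, fun n => ?_⟩
  · refine ae_of_all _ fun x => ?_
    simp only [Function.comp_apply, reflectHarmonic_apply, u, hdr]
  · refine ae_freqMeasure_of_slices (measurableSet_eq_fun
      (hum.comp reflectSpace.measurable) hum) fun n => ?_
    filter_upwards [hneg n] with η hη
    simp only [Function.comp_apply, reflectSpace_apply, u, hη]
  · rw [hfd n]
    funext ζ
    exact Real.fourierInv_congr_ae (hud n).symm ζ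

end

/-! ### Modes determine a continuous periodic function -/

/-- For fixed ζ the difference is a continuous function on the circle with zero Fourier
coefficients. These are trivially summable, so its Fourier series converges pointwise to it, and the
sum is 0. -/
theorem eq_of_mode_eq {U V : ℝ → ℝ → ℝ} (hU : Continuous (Function.uncurry U))
    (hV : Continuous (Function.uncurry V)) (hUp : ∀ ζ, Function.Periodic (U ζ) (2 * Real.pi))
    (hVp : ∀ ζ, Function.Periodic (V ζ) (2 * Real.pi)) (h : ∀ p ζ, mode U p ζ = mode V p ζ) :
    U = V := by
  funext ζ φ
  have : Fact (0 < 2 * Real.pi) := ⟨Real.two_pi_pos⟩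
  have hUc : Continuous (U ζ) := hU.comp (Continuous.prodMk_right ζ)
  have hVc : Continuous (V ζ) := hV.comp (Continuous.prodMk_right ζ)
  let D : ℝ → ℂ := fun φ => (U ζ φ : ℂ) - V ζ φ
  have hDc : Continuous D := by fun_prop
  have hDp : Function.Periodic D (2 * Real.pi) := fun φ => by
    simp only [D, hUp ζ φ, hVp ζ φ]
  let F : C(AddCircle (2 * Real.pi), ℂ) :=
    ⟨hDp.lift, continuous_coinduced_dom.mpr hDc⟩
  have hF : ∀ x : ℝ, F (x : AddCircle (2 * Real.pi)) = D x := fun x => hDp.lift_coe x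
  have hzero : fourierCoeff F = 0 := by
    funext p
    rw [fourierCoeff_eq_intervalIntegral _ p (-Real.pi)]
    have e : -Real.pi + 2 * Real.pi = Real.pi := by ring
    rw [e]
    have e1 : ∀ x : ℝ, fourier (-p) (x : AddCircle (2 * Real.pi)) • F (x : AddCircle (2 * Real.pi))
        = (U ζ x : ℂ) * Complex.exp (-(Complex.I * p * x)) -
          (V ζ x : ℂ) * Complex.exp (-(Complex.I * p * x)) := by
      intro x
      have hpi : (Real.pi : ℂ) ≠ 0 := by exact_mod_cast Real.pi_ne_zero
      have e2 : fourier (-p) (x : AddCircle (2 * Real.pi)) =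
          Complex.exp (-(Complex.I * p * x)) := by
        rw [fourier_coe_apply]
        congr 1
        push_cast
        field_simp
      rw [hF, e2, smul_eq_mul]
      simp only [D]
      ring
    simp_rw [e1]
    rw [intervalIntegral.integral_sub (Continuous.intervalIntegrable (by fun_prop) _ _)
      (Continuous.intervalIntegrable (by fun_prop) _ _)]
    have hm := h p ζ
    have hpi : (1 / (2 * Real.pi) : ℂ) ≠ 0 := by
      have : (Real.pi : ℂ) ≠ 0 := by exact_mod_cast Real.pi_ne_zero
      exact one_div_ne_zero (mul_ne_zero two_ne_zero this)
    rw [mode, mode, mul_right_inj' hpi] at hm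
    rw [hm, sub_self]
    simp
  have hs : Summable (fourierCoeff F) := by rw [hzero]; exact summable_zero
  have := has_pointwise_sum_fourier_series_of_summable hs (φ : AddCircle (2 * Real.pi))
  rw [hzero] at this
  simp only [Pi.zero_apply, zero_smul] at this
  have h0 := this.unique hasSum_zero
  rw [hF] at h0
  have h1 : (U ζ φ : ℂ) = V ζ φ := sub_eq_zero.1 h0
  exact_mod_cast h1

theorem mode_sub {U V : ℝ → ℝ → ℝ} (hU : Continuous (Function.uncurry U))
    (hV : Continuous (Function.uncurry V)) (p : ℤ) (ζ : ℝ) :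
    mode (U - V) p ζ = mode U p ζ - mode V p ζ := by
  have hUc : Continuous (U ζ) := hU.comp (Continuous.prodMk_right ζ)
  have hVc : Continuous (V ζ) := hV.comp (Continuous.prodMk_right ζ)
  rw [mode, mode, mode, ← mul_sub, ← intervalIntegral.integral_sub
    (Continuous.intervalIntegrable (by fun_prop) _ _)
    (Continuous.intervalIntegrable (by fun_prop) _ _)]
  congr 1
  refine intervalIntegral.integral_congr fun φ _ => ?_
  simp only [Pi.sub_apply, Complex.ofReal_sub]
  ring

/-! ### The differential equation on the Fourier side -/

section

variable {s : ℝ} {u v w g : ℤ × ℝ → ℝ}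

theorem envelope_add (hs : 1 < s) (hu : WL2 s u) (hv : WL2 s v) (n : ℤ) (ζ : ℝ) :
    envelope (fun x => u x + v x) n ζ = envelope u n ζ + envelope v n ζ := by
  rw [envelope_eq, envelope_eq, envelope_eq, ← integral_add
    (integrable_wave_mul (hu.integrable_slice hs n) ζ)
    (integrable_wave_mul (hv.integrable_slice hs n) ζ)]
  congr with η
  push_cast
  ring

theorem envelope_const_mul (c : ℝ) (u : ℤ × ℝ → ℝ) (n : ℤ) (ζ : ℝ) :
    envelope (fun x => c * u x) n ζ = c * envelope u n ζ := by
  rw [envelope_eq, envelope_eq, ← integral_const_mul]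
  congr with η
  push_cast
  ring

theorem envelope_resolvent (hs : 1 < s) (hg : WL2 s g)
    (h : u =ᵐ[freqMeasure] fun x => resolvent (2 * x.1 + 1) x.2 * g x) (n : ℤ) :
    ContDiff ℝ 2 (envelope u n) ∧ (∃ M, ∀ ζ, ‖deriv (envelope u n) ζ‖ ≤ M) ∧
      ∀ ζ, deriv (deriv (envelope u n)) ζ = ((2 * n + 1 : ℤ) : ℂ) ^ 2 * envelope u n ζ -
        ((2 * n + 1 : ℤ) : ℂ) ^ 2 * envelope g n ζ := by
  refine fourierInv_resolvent (by omega) (hg.integrable_slice hs n) ?_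
  filter_upwards [ae_freqMeasure_slice h n] with η hη
  rw [hη]
  push_cast
  rfl

theorem WL2.resolvent_mul (hg : WL2 s g) :
    WL2 s (fun x => resolvent (2 * x.1 + 1) x.2 * g x) :=
  ⟨measurable_resolvent_prod.mul hg.measurable, (wsq_resolvent_mul_le _).trans_lt hg.finite⟩

/-- On each harmonic the resolvent applied to g gives another bounded solution of the same
inhomogeneous equation. The difference is a bounded solution of D'' = p² D, hence 0. -/
theorem ae_eq_resolvent_of_ode (hs : 1 < s) (hu : WL2 s u) (hg : WL2 s g)
    (hc : ∀ n, ContDiff ℝ 2 (envelope u n))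
    (hode : ∀ n ζ, deriv (deriv (envelope u n)) ζ = ((2 * n + 1 : ℤ) : ℂ) ^ 2 * envelope u n ζ -
        ((2 * n + 1 : ℤ) : ℂ) ^ 2 * envelope g n ζ) :
    u =ᵐ[freqMeasure] fun x => resolvent (2 * x.1 + 1) x.2 * g x := by
  refine ae_eq_of_envelope_eq hs hu hg.resolvent_mul fun n => ?_
  obtain ⟨hc', -, hode'⟩ := envelope_resolvent hs hg (EventuallyEq.refl _ _) n
  set y := envelope (fun x => resolvent (2 * x.1 + 1) x.2 * g x) n
  obtain ⟨M₁, hM₁⟩ := hu.exists_norm_envelope_le hs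
  obtain ⟨M₂, hM₂⟩ := hg.resolvent_mul.exists_norm_envelope_le hs
  have hd : ∀ {f : ℝ → ℂ}, ContDiff ℝ 2 f → Differentiable ℝ f ∧ Differentiable ℝ (deriv f) :=
    fun hf => ⟨hf.differentiable (by norm_num),
      ((contDiff_succ_iff_deriv (n := 1)).1 hf).2.2.differentiable (by norm_num)⟩
  have hsub : deriv (fun ζ => envelope u n ζ - y ζ) =
      fun ζ => deriv (envelope u n) ζ - deriv y ζ := by
    funext ζ
    exact deriv_fun_sub ((hd (hc n)).1 ζ) ((hd hc').1 ζ)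
  have hpos : 0 < |((2 * n + 1 : ℤ) : ℝ)| := abs_pos.2 (by
    have : (2 * n + 1 : ℤ) ≠ 0 := by omega
    exact_mod_cast this)
  have h0 := eq_zero_of_bounded_of_deriv_deriv (D := fun ζ => envelope u n ζ - y ζ)
    (a := |((2 * n + 1 : ℤ) : ℝ)|) hpos ((hc n).sub hc') (fun ζ => by
      rw [hsub, deriv_fun_sub ((hd (hc n)).2 ζ) ((hd hc').2 ζ), hode, hode']
      have : ((|((2 * n + 1 : ℤ) : ℝ)| : ℝ) : ℂ) ^ 2 = ((2 * n + 1 : ℤ) : ℂ) ^ 2 := by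
        exact_mod_cast congrArg (fun t : ℝ => (t : ℂ)) (sq_abs ((2 * n + 1 : ℤ) : ℝ))
      rw [this]
      ring) (M := M₁ + M₂) (fun ζ => (norm_sub_le _ _).trans (add_le_add (hM₁ n ζ) (hM₂ n ζ)))
  funext ζ
  exact sub_eq_zero.1 (congrFun h0 ζ)

/-! ### The masks of the system -/

/-- The mask of the self-interaction `U_p³ = U_p U_p U_{-p}`. -/
def selfMask (n q r : ℤ) : ℝ := if q = n ∧ r = n then 1 else 0

/-- The mask of `U_p ∑ |U_q|²`, with `|U_q|² = U_q U_{-q}`. -/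
def pairMask (n q r : ℤ) : ℝ := if q = n ∧ |2 * r + 1| ≠ |2 * n + 1| then 1 else 0

/-- The mask of `∑ U_q U_r U_{p-q-r}` without self-interaction. -/
def mixMask (n q r : ℤ) : ℝ :=
  if |2 * q + 1| = |2 * n + 1| ∧ |2 * r + 1| = |2 * n + 1| ∧
    |2 * (n - q - r - 1) + 1| = |2 * n + 1| then 0 else 1

theorem abs_odd_reflect (n : ℤ) : |2 * (-1 - n) + 1| = |2 * n + 1| := by
  rw [← abs_neg]
  congr 1
  ring

theorem isMask_selfMask : IsMask selfMask 1 where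
  bound n q r := by unfold selfMask; split_ifs <;> simp
  symm n q r := by
    have h1 : ∀ a b : ℤ, -1 - a = -1 - b ↔ a = b := fun a b => by omega
    simp only [selfMask, h1]

theorem isMask_pairMask : IsMask pairMask 1 where
  bound n q r := by unfold pairMask; split_ifs <;> simp
  symm n q r := by
    have h1 : ∀ a b : ℤ, -1 - a = -1 - b ↔ a = b := fun a b => by omega
    simp only [pairMask, h1, abs_odd_reflect]

theorem isMask_mixMask : IsMask mixMask 1 where
  bound n q r := by unfold mixMask; split_ifs <;> simp
  symm n q r := by
    have h1 : -1 - n - (-1 - q) - (-1 - r) - 1 = -1 - (n - q - r - 1) := by ring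
    simp only [mixMask, h1, abs_odd_reflect]

/-- With q = r = n the third index is -1 - n, the harmonic -p, and the symmetry of w brings it back
to p. The pointwise product in physical space is thus one term of the convolution sum. -/
theorem envelope_triple_selfMask (hs : 1 < s) (hu : WL2 s u) (hv : WL2 s v) (hw : EvenL2 s w)
    (n : ℤ) (ζ : ℝ) : envelope (triple selfMask u v w) n ζ =
      envelope u n ζ * envelope v n ζ * envelope w n ζ := by
  rw [(envelope_triple hs isMask_selfMask hu hv hw.toWL2 n ζ).2, tsum_eq_single (n, n)]
  · have : n - n - n - 1 = -1 - n := by ring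
    simp only [selfMask, and_self, if_true, this, hw.envelope_reflect]
    simp
  · rintro ⟨q, r⟩ hqr
    have : ¬ (q = n ∧ r = n) := fun h => hqr (Prod.ext h.1 h.2)
    simp only [selfMask, if_neg this]
    simp

theorem EvenL2.envelope_mul_reflect (hu : EvenL2 s u) (n : ℤ) (ζ : ℝ) :
    envelope u n ζ * envelope u (-1 - n) ζ = ((‖envelope u n ζ‖ ^ 2 : ℝ) : ℂ) := by
  rw [hu.envelope_reflect]
  nth_rw 2 [← hu.conj_envelope]
  rw [Complex.mul_conj, Complex.normSq_eq_norm_sq]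

theorem injective_odd : Function.Injective fun n : ℤ => 2 * n + 1 := fun a b h => by
  simpa using h

theorem tsum_crossIndex {U : ℝ → ℝ → ℝ} (h : ∀ n, mode U (2 * n + 1) = envelope u n)
    (n : ℤ) (ζ : ℝ) :
    ∑' q : crossIndex (2 * n + 1), ((‖mode U q ζ‖ ^ 2 : ℝ) : ℂ) =
      ∑' r : ℤ, if |2 * r + 1| ≠ |2 * n + 1| then ((‖envelope u r ζ‖ ^ 2 : ℝ) : ℂ) else 0 := by
  rw [tsum_subtype (crossIndex (2 * n + 1)) fun q => ((‖mode U q ζ‖ ^ 2 : ℝ) : ℂ),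
    ← injective_odd.tsum_eq]
  · congr with r
    rw [← h]
    by_cases hr : |2 * r + 1| ≠ |2 * n + 1|
    · rw [if_pos hr, Set.indicator_of_mem]
      exact ⟨⟨r, rfl⟩, hr⟩
    · rw [if_neg hr, Set.indicator_of_notMem]
      exact fun h => hr h.2
  · intro q hq
    obtain ⟨k, rfl⟩ : Odd q := (Set.mem_of_indicator_ne_zero hq).1
    exact ⟨k, rfl⟩

/-- The mask keeps the row q = n only; there the third index is -1 - r, and U_r U_{-r} = |U_r|²
since the envelopes are real and symmetric. -/
theorem envelope_triple_pairMask (hs : 1 < s) (hu : EvenL2 s u) {U : ℝ → ℝ → ℝ}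
    (h : ∀ n, mode U (2 * n + 1) = envelope u n) (n : ℤ) (ζ : ℝ) :
    envelope (triple pairMask u u u) n ζ = envelope u n ζ *
      ∑' q : crossIndex (2 * n + 1), ((‖mode U q ζ‖ ^ 2 : ℝ) : ℂ) := by
  have hinj : Function.Injective fun r : ℤ => (n, r) := fun a b h => (Prod.ext_iff.1 h).2
  rw [(envelope_triple hs isMask_pairMask hu.toWL2 hu.toWL2 hu.toWL2 n ζ).2, tsum_crossIndex h,
    ← tsum_mul_left, ← hinj.tsum_eq]
  · congr with r
    have e : n - n - r - 1 = -1 - r := by ring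
    simp only [pairMask, true_and, e, mul_assoc, hu.envelope_mul_reflect]
    split_ifs <;> simp
  · rintro ⟨q, r⟩ hqr
    have : q = n := by
      by_contra hq
      apply hqr
      have : ¬ (q = n ∧ |2 * r + 1| ≠ |2 * n + 1|) := fun h => hq h.1
      simp only [pairMask, if_neg this]
      simp
    exact ⟨r, by rw [this]⟩

theorem envelope_triple_mixMask (hs : 1 < s) (hu : EvenL2 s u) {U : ℝ → ℝ → ℝ}
    (h : ∀ n, mode U (2 * n + 1) = envelope u n) (n : ℤ) (ζ : ℝ) :
    envelope (triple mixMask u u u) n ζ = ∑' m : mixIndex (2 * n + 1),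
      mode U m.1.1 ζ * mode U m.1.2 ζ * mode U (2 * n + 1 - m.1.1 - m.1.2) ζ := by
  have hinj : Function.Injective fun k : ℤ × ℤ => (2 * k.1 + 1, 2 * k.2 + 1) := fun a b h => by
    simpa [Prod.ext_iff] using h
  rw [(envelope_triple hs isMask_mixMask hu.toWL2 hu.toWL2 hu.toWL2 n ζ).2,
    tsum_subtype (mixIndex (2 * n + 1)) fun m : ℤ × ℤ =>
      mode U m.1 ζ * mode U m.2 ζ * mode U (2 * n + 1 - m.1 - m.2) ζ,
    ← hinj.tsum_eq (f := (mixIndex (2 * n + 1)).indicator fun m : ℤ × ℤ =>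
      mode U m.1 ζ * mode U m.2 ζ * mode U (2 * n + 1 - m.1 - m.2) ζ)]
  · congr with k
    have e : 2 * n + 1 - (2 * k.1 + 1) - (2 * k.2 + 1) = 2 * (n - k.1 - k.2 - 1) + 1 := by ring
    by_cases hk : |2 * k.1 + 1| = |2 * n + 1| ∧ |2 * k.2 + 1| = |2 * n + 1| ∧
        |2 * (n - k.1 - k.2 - 1) + 1| = |2 * n + 1|
    · rw [Set.indicator_of_notMem]
      · simp only [mixMask, if_pos hk]
        simp
      · rintro ⟨-, -, hk'⟩
        simp only [e] at hk'
        exact hk' hk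
    · rw [Set.indicator_of_mem]
      · simp only [mixMask, if_neg hk, e, h]
        simp
      · refine ⟨⟨_, rfl⟩, ⟨_, rfl⟩, ?_⟩
        simp only [e]
        exact hk
  · rintro ⟨q, r⟩ hqr
    obtain ⟨⟨k, rfl⟩, ⟨l, rfl⟩, -⟩ := Set.mem_of_indicator_ne_zero hqr
    exact ⟨(k, l), rfl⟩

theorem summable_crossIndex (hs : 1 < s) (hu : WL2 s u) {U : ℝ → ℝ → ℝ}
    (h : ∀ n, mode U (2 * n + 1) = envelope u n) (p : ℤ) (ζ : ℝ) :
    Summable fun q : crossIndex p => ‖mode U q ζ‖ ^ 2 := by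
  obtain ⟨M, hM⟩ := hu.exists_norm_envelope_le hs
  have h1 : Summable fun n : ℤ => ‖envelope u n ζ‖ ^ 2 := by
    refine Summable.of_nonneg_of_le (fun n => by positivity) (fun n => ?_)
      ((hu.summable_envelope hs ζ).mul_left M)
    rw [pow_two]
    exact mul_le_mul_of_nonneg_right (hM n ζ) (norm_nonneg _)
  have hodd : ∀ q : crossIndex p, (q : ℤ) = 2 * ((q : ℤ) / 2) + 1 := fun q => by
    obtain ⟨k, hk⟩ := q.2.1
    omega
  have hinj : Function.Injective fun q : crossIndex p => (q : ℤ) / 2 := fun a b hab => by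
    apply Subtype.ext
    rw [hodd a, hodd b]
    simp only at hab
    rw [hab]
  refine (h1.comp_injective hinj).congr fun q => ?_
  simp only [Function.comp_apply]
  rw [← h, ← hodd]

theorem summable_mixIndex (hs : 1 < s) (hu : EvenL2 s u) {U : ℝ → ℝ → ℝ}
    (h : ∀ n, mode U (2 * n + 1) = envelope u n) (n : ℤ) (ζ : ℝ) :
    Summable fun m : mixIndex (2 * n + 1) =>
      ‖mode U m.1.1 ζ * mode U m.1.2 ζ * mode U (2 * n + 1 - m.1.1 - m.1.2) ζ‖ := by
  have h1 := (envelope_triple hs isMask_mixMask hu.toWL2 hu.toWL2 hu.toWL2 n ζ).1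
  have hodd : ∀ m : mixIndex (2 * n + 1), m.1.1 = 2 * (m.1.1 / 2) + 1 ∧
      m.1.2 = 2 * (m.1.2 / 2) + 1 := fun m => by
    obtain ⟨k, hk⟩ := m.2.1
    obtain ⟨l, hl⟩ := m.2.2.1
    omega
  have hinj : Function.Injective fun m : mixIndex (2 * n + 1) => (m.1.1 / 2, m.1.2 / 2) := by
    intro a b hab
    simp only [Prod.mk.injEq] at hab
    apply Subtype.ext
    refine Prod.ext ?_ ?_
    · rw [(hodd a).1, (hodd b).1, hab.1]
    · rw [(hodd a).2, (hodd b).2, hab.2]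
  refine (h1.comp_injective hinj).congr fun m => ?_
  obtain ⟨⟨⟨k, hk⟩, ⟨l, hl⟩, hm⟩, e1, e2⟩ := And.intro m.2 (hodd m)
  have e3 : 2 * n + 1 - m.1.1 - m.1.2 = 2 * (n - m.1.1 / 2 - m.1.2 / 2 - 1) + 1 := by omega
  simp only [Function.comp_apply]
  have hmask : mixMask n (m.1.1 / 2) (m.1.2 / 2) = 1 := by
    rw [mixMask, if_neg]
    rw [← e1, ← e2, ← e3]
    exact hm
  rw [hmask, e3, ← h, ← h, ← h, ← e1, ← e2]
  simp

/-- The nonlinearity of the system on the Fourier side. -/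
def nonlinearity (Γ ε : ℝ) (u : ℤ × ℝ → ℝ) (x : ℤ × ℝ) : ℝ :=
  6 * Γ * triple selfMask u u u x +
    2 / 3 * ε * Γ * (3 * triple pairMask u u u x + triple mixMask u u u x)

theorem WL2.nonlinearity (hs : 1 < s) (hu : WL2 s u) (Γ ε : ℝ) :
    WL2 s (nonlinearity Γ ε u) :=
  ((WL2.triple hs isMask_selfMask hu hu hu).const_mul (6 * Γ)).add
    ((((WL2.triple hs isMask_pairMask hu hu hu).const_mul 3).add
      (WL2.triple hs isMask_mixMask hu hu hu)).const_mul (2 / 3 * ε * Γ))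

/-- The common factor p² of the system is absent here, as it is the numerator of `resolvent`. -/
theorem envelope_nonlinearity (hs : 1 < s) (hu : EvenL2 s u) {U : ℝ → ℝ → ℝ}
    (h : ∀ n, mode U (2 * n + 1) = envelope u n) (Γ ε : ℝ) (n : ℤ) (ζ : ℝ) :
    envelope (nonlinearity Γ ε u) n ζ = 6 * Γ * mode U (2 * n + 1) ζ ^ 3 +
      2 / 3 * ε * Γ * coupling U (2 * n + 1) ζ := by
  have h1 := WL2.triple hs isMask_selfMask hu.toWL2 hu.toWL2 hu.toWL2
  have h2 := WL2.triple hs isMask_pairMask hu.toWL2 hu.toWL2 hu.toWL2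
  have h3 := WL2.triple hs isMask_mixMask hu.toWL2 hu.toWL2 hu.toWL2
  unfold nonlinearity
  rw [envelope_add hs (h1.const_mul (6 * Γ)) (((h2.const_mul 3).add h3).const_mul
    (2 / 3 * ε * Γ)), envelope_const_mul, envelope_const_mul, envelope_add hs (h2.const_mul 3) h3,
    envelope_const_mul, envelope_triple_selfMask hs hu.toWL2 hu.toWL2 hu,
    envelope_triple_pairMask hs hu h, envelope_triple_mixMask hs hu h, coupling, h]
  push_cast
  ring

/-- The bridge between the system and the Hilbert space. From left to right it rests on uniqueness
of bounded solutions of the linear equation; from right to left, on the two derivatives that the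
resolvent gains. -/
theorem solves_iff (hs : 1 < s) (hu : EvenL2 s u) {U : ℝ → ℝ → ℝ}
    (h : ∀ n, mode U (2 * n + 1) = envelope u n) (Γ ε : ℝ) :
    Solves Γ ε U ↔
      u =ᵐ[freqMeasure] fun x => resolvent (2 * x.1 + 1) x.2 * nonlinearity Γ ε u x := by
  have hN := hu.toWL2.nonlinearity hs Γ ε
  constructor
  · intro hS
    refine ae_eq_resolvent_of_ode hs hu.toWL2 hN (fun n => ?_) fun n ζ => ?_
    · rw [← h]
      exact hS.contDiff _ ⟨n, rfl⟩
    · have := hS.equation (2 * n + 1) ⟨n, rfl⟩ ζ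
      rw [envelope_nonlinearity hs hu h, ← h]
      linear_combination this
  · intro hfix
    have hode := envelope_resolvent hs hN hfix
    refine ⟨?_, fun p _ ζ => summable_crossIndex hs hu.toWL2 h p ζ, ?_, ?_⟩
    · rintro _ ⟨n, rfl⟩
      rw [h]
      exact (hode n).1
    · rintro _ ⟨n, rfl⟩ ζ
      exact summable_mixIndex hs hu h n ζ
    · rintro _ ⟨n, rfl⟩ ζ
      have := (hode n).2.2 ζ
      rw [envelope_nonlinearity hs hu h, ← h] at this
      linear_combination this

end

/-! ### The soliton -/

theorem hasDerivAt_sech (ζ : ℝ) :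
    HasDerivAt (fun x => 1 / Real.cosh x) (-(Real.sinh ζ / Real.cosh ζ ^ 2)) ζ := by
  have h := (Real.hasDerivAt_cosh ζ).inv (Real.cosh_pos ζ).ne'
  simp only [one_div]
  exact h.congr_deriv (by ring)

theorem hasDerivAt_sinh_div_cosh (ζ : ℝ) :
    HasDerivAt (fun x => Real.sinh x / Real.cosh x) (1 - (Real.sinh ζ / Real.cosh ζ) ^ 2) ζ := by
  have hc := (Real.cosh_pos ζ).ne'
  refine ((Real.hasDerivAt_sinh ζ).div (Real.hasDerivAt_cosh ζ) hc).congr_deriv ?_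
  field_simp

/-- Since tanh' = 1 - tanh² and sech' = -tanh · sech, the form P(tanh) · sech is stable under
differentiation, with P replaced by P' (1 - X²) - P X. As |tanh| < 1, every derivative decays like
sech. -/
theorem iteratedDeriv_sech (c : ℝ) (n : ℕ) : ∃ P : Polynomial ℝ,
    iteratedDeriv n (fun ζ : ℝ => ((c * (1 / Real.cosh ζ) : ℝ) : ℂ)) =
      fun ζ => ((P.eval (Real.sinh ζ / Real.cosh ζ) * (1 / Real.cosh ζ) : ℝ) : ℂ) := by
  induction n with
  | zero => exact ⟨Polynomial.C c, by simp⟩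
  | succ n ih =>
    obtain ⟨P, hP⟩ := ih
    refine ⟨P.derivative * (1 - Polynomial.X ^ 2) - P * Polynomial.X, ?_⟩
    rw [iteratedDeriv_succ, hP]
    funext ζ
    have h1 := ((P.hasDerivAt (Real.sinh ζ / Real.cosh ζ)).comp ζ
      (hasDerivAt_sinh_div_cosh ζ)).mul (hasDerivAt_sech ζ)
    refine HasDerivAt.deriv (h1.ofReal_comp.congr_deriv ?_)
    congr 1
    simp only [Polynomial.eval_sub, Polynomial.eval_mul, Polynomial.eval_one,
      Polynomial.eval_pow, Polynomial.eval_X, Function.comp_apply]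
    field_simp [(Real.cosh_pos ζ).ne']
    ring

theorem contDiff_sech (c : ℝ) {n : WithTop ℕ∞} :
    ContDiff ℝ n (fun ζ : ℝ => ((c * (1 / Real.cosh ζ) : ℝ) : ℂ)) :=
  Complex.ofRealCLM.contDiff.comp
    (contDiff_const.mul (contDiff_const.div Real.contDiff_cosh fun ζ => (Real.cosh_pos ζ).ne'))

/-- Combines cosh ζ ≥ e^|ζ| / 2 with e^|ζ| ≥ |ζ|^k / k!. -/
theorem abs_pow_mul_sech_le (k : ℕ) (ζ : ℝ) :
    |ζ| ^ k * (1 / Real.cosh ζ) ≤ 2 * k.factorial := by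
  have h1 := Real.pow_div_factorial_le_exp |ζ| (abs_nonneg ζ) k
  have h2 : Real.exp |ζ| / 2 ≤ Real.cosh ζ := by
    rw [← Real.cosh_abs, Real.cosh_eq]
    have := Real.exp_pos (-|ζ|)
    linarith
  rw [mul_one_div, div_le_iff₀ (Real.cosh_pos ζ)]
  have hk : (0 : ℝ) < k.factorial := by exact_mod_cast k.factorial_pos
  rw [div_le_iff₀ hk] at h1
  nlinarith

/-- The NLS soliton as a Schwartz function. -/
def solitonSchwartz (Γ : ℝ) : SchwartzMap ℝ ℂ where
  toFun ζ := soliton Γ ζ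
  smooth' := contDiff_sech _
  decay' k n := by
    obtain ⟨P, hP⟩ := iteratedDeriv_sech (1 / Real.sqrt (3 * Γ)) n
    obtain ⟨M, hM⟩ := isCompact_Icc.exists_bound_of_continuousOn
      (s := Set.Icc (-1 : ℝ) 1) P.continuous.continuousOn
    refine ⟨M * (2 * k.factorial), fun ζ => ?_⟩
    have hf : iteratedDeriv n (fun ζ : ℝ => (soliton Γ ζ : ℂ)) = _ := hP
    rw [norm_iteratedFDeriv_eq_norm_iteratedDeriv, hf, Complex.norm_real, norm_mul,
      Real.norm_eq_abs ζ, Real.norm_of_nonneg (r := 1 / Real.cosh ζ) (by have := Real.cosh_pos ζ; positivity)]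
    have ht := abs_le.1 (Real.abs_tanh_lt_one ζ).le
    rw [Real.tanh_eq_sinh_div_cosh] at ht
    have h1 := hM _ ⟨ht.1, ht.2⟩
    have h2 := abs_pow_mul_sech_le k ζ
    have h3 : 0 ≤ |ζ| ^ k * (1 / Real.cosh ζ) := by have := Real.cosh_pos ζ; positivity
    calc |ζ| ^ k * (‖P.eval (Real.sinh ζ / Real.cosh ζ)‖ * (1 / Real.cosh ζ))
        = ‖P.eval (Real.sinh ζ / Real.cosh ζ)‖ * (|ζ| ^ k * (1 / Real.cosh ζ)) := by ring
      _ ≤ M * (2 * k.factorial) :=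
        mul_le_mul h1 h2 h3 ((norm_nonneg _).trans h1)

theorem solitonSchwartz_apply (Γ ζ : ℝ) : solitonSchwartz Γ ζ = soliton Γ ζ := rfl

theorem coe_solitonSchwartz (Γ : ℝ) :
    (solitonSchwartz Γ : ℝ → ℂ) = fun ζ => (soliton Γ ζ : ℂ) := rfl

theorem soliton_neg (Γ ζ : ℝ) : soliton Γ (-ζ) = soliton Γ ζ := by
  simp [soliton]

theorem hasDerivAt_soliton (Γ ζ : ℝ) :
    HasDerivAt (soliton Γ) (-(1 / Real.sqrt (3 * Γ)) * (Real.sinh ζ / Real.cosh ζ ^ 2)) ζ :=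
  ((hasDerivAt_sech ζ).const_mul (1 / Real.sqrt (3 * Γ))).congr_deriv (by ring)

theorem six_mul_soliton_sq {Γ : ℝ} (hΓ : 0 < Γ) (ζ : ℝ) :
    6 * Γ * soliton Γ ζ ^ 2 = 2 / Real.cosh ζ ^ 2 := by
  have hc := (Real.cosh_pos ζ).ne'
  have h3 : Real.sqrt (3 * Γ) ^ 2 = 3 * Γ := Real.sq_sqrt (by positivity)
  rw [soliton, mul_pow, div_pow, div_pow, h3]
  field_simp
  norm_num

theorem hasDerivAt_sinh_div_cosh_sq (ζ : ℝ) :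
    HasDerivAt (fun x => Real.sinh x / Real.cosh x ^ 2)
      (2 / Real.cosh ζ ^ 3 - 1 / Real.cosh ζ) ζ := by
  have hc := (Real.cosh_pos ζ).ne'
  refine ((Real.hasDerivAt_sinh ζ).div ((Real.hasDerivAt_cosh ζ).pow 2)
    (pow_ne_zero 2 hc)).congr_deriv ?_
  simp only [Nat.cast_ofNat, Nat.add_one_sub_one, pow_one, Pi.pow_apply]
  field_simp
  linear_combination 2 * Real.cosh_sq_sub_sinh_sq ζ

theorem deriv_deriv_soliton {Γ : ℝ} (hΓ : 0 < Γ) (ζ : ℝ) :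
    deriv (deriv fun x => (soliton Γ x : ℂ)) ζ =
      (soliton Γ ζ : ℂ) - 6 * Γ * (soliton Γ ζ : ℂ) ^ 3 := by
  have h1 : (deriv fun x => (soliton Γ x : ℂ)) =
      fun x => ((-(1 / Real.sqrt (3 * Γ)) * (Real.sinh x / Real.cosh x ^ 2) : ℝ) : ℂ) := by
    funext x
    exact (hasDerivAt_soliton Γ x).ofReal_comp.deriv
  rw [h1, (((hasDerivAt_sinh_div_cosh_sq ζ).const_mul
    (-(1 / Real.sqrt (3 * Γ)))).ofReal_comp).deriv]
  have h2 : soliton Γ ζ - 6 * Γ * soliton Γ ζ ^ 3 =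
      soliton Γ ζ - 2 / Real.cosh ζ ^ 2 * soliton Γ ζ := by
    rw [← six_mul_soliton_sq hΓ]; ring
  have h3 : -(1 / Real.sqrt (3 * Γ)) * (2 / Real.cosh ζ ^ 3 - 1 / Real.cosh ζ) =
      soliton Γ ζ - 6 * Γ * soliton Γ ζ ^ 3 := by
    rw [h2, soliton]
    field_simp
    ring
  rw [h3]
  push_cast
  ring

/-! ### Functions that are carried by the first harmonics -/

/-- The function that is `f` on the harmonics `±1`. -/
def firstHarmonic (f : ℝ → ℝ) (x : ℤ × ℝ) : ℝ := if x.1 = 0 ∨ x.1 = -1 then f x.2 else 0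

/-- On the harmonics ±1 the weight grows only polynomially in η. The constant 7 exceeds 2π, and the
two extra powers pay for the factor 1 + η², which later leaves the integrable 1 / (1 + η²). -/
theorem weight_zero_le (s : ℝ) (hs : 0 ≤ s) (n : ℤ) (hn : n = 0 ∨ n = -1) (η : ℝ) :
    weight s (n, η) * (1 + η ^ 2) ≤ (7 : ℝ) ^ (2 * s) * (1 + |η|) ^ (⌈2 * s⌉₊ + 2) := by
  have h0 : 0 ≤ |η| := abs_nonneg η
  have h1 : (((2 * n + 1 : ℤ) : ℝ)) ^ 2 = 1 := by
    rcases hn with rfl | rfl <;> norm_num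
  have hb : 1 + (2 * Real.pi * η) ^ 2 ≤ (7 * (1 + |η|)) ^ 2 := by
    have hpi := Real.pi_lt_d2
    have hpi0 := Real.pi_pos
    have : (2 * Real.pi * η) ^ 2 ≤ (6.3 * |η|) ^ 2 := by
      rw [mul_pow _ η, mul_pow _ |η|, sq_abs]
      refine mul_le_mul_of_nonneg_right ?_ (sq_nonneg η)
      exact pow_le_pow_left₀ (by positivity) (by linarith) 2
    nlinarith
  have h2 : weight s (n, η) ≤ (7 : ℝ) ^ (2 * s) * (1 + |η|) ^ (2 * s) := by
    rw [weight, h1, ← Real.mul_rpow (by norm_num) (by positivity), Real.rpow_mul (by positivity)]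
    refine Real.rpow_le_rpow (by positivity) ?_ hs
    rw [Real.rpow_two]
    exact hb
  have h3 : (1 + |η|) ^ (2 * s) ≤ (1 + |η|) ^ ⌈2 * s⌉₊ := by
    rw [← Real.rpow_natCast]
    exact Real.rpow_le_rpow_of_exponent_le (by linarith) (Nat.le_ceil _)
  have h4 : 1 + η ^ 2 ≤ (1 + |η|) ^ 2 := by
    rw [← sq_abs η]; nlinarith
  calc weight s (n, η) * (1 + η ^ 2)
      ≤ ((7 : ℝ) ^ (2 * s) * (1 + |η|) ^ ⌈2 * s⌉₊) * (1 + |η|) ^ 2 := by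
        refine mul_le_mul (h2.trans (mul_le_mul_of_nonneg_left h3 (by positivity))) h4
          (by positivity) (by positivity)
    _ = _ := by rw [pow_add]; ring

theorem lintegral_firstHarmonic_lt_top {F : ℤ × ℝ → ℝ≥0∞} (hF : Measurable F) {C : ℝ}
    (h0 : ∀ n η, ¬ (n = 0 ∨ n = -1) → F (n, η) = 0)
    (h1 : ∀ n η, (n = 0 ∨ n = -1) → F (n, η) ≤ ENNReal.ofReal (C * (1 + η ^ 2)⁻¹)) :
    ∫⁻ x, F x ∂freqMeasure < ⊤ := by
  rw [lintegral_freqMeasure hF, tsum_eq_sum (s := {0, -1})]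
  · refine ENNReal.sum_lt_top.2 fun n hn => ?_
    have hn' : n = 0 ∨ n = -1 := by simpa using hn
    refine (lintegral_mono fun η => h1 n η hn').trans_lt ?_
    exact (integrable_inv_one_add_sq.const_mul C).lintegral_lt_top
  · intro n hn
    have hn' : ¬ (n = 0 ∨ n = -1) := by simpa using hn
    simp [h0 n _ hn']

theorem measurable_firstHarmonic {f : ℝ → ℝ} (hf : Measurable f) :
    Measurable (firstHarmonic f) :=
  Measurable.ite (measurable_fst (Set.to_countable {n : ℤ | n = 0 ∨ n = -1}).measurableSet)
    (hf.comp measurable_snd) measurable_const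

/-- Functions of rapid decay. -/
def RapidDecay (f : ℝ → ℝ) : Prop := ∀ k : ℕ, ∃ C, ∀ η, (1 + |η|) ^ k * |f η| ≤ C

theorem RapidDecay.weight_le {f : ℝ → ℝ} (hf : RapidDecay f) {s : ℝ} (hs : 0 ≤ s) :
    ∃ C, 0 ≤ C ∧ ∀ n η, (n = 0 ∨ n = -1) → weight s (n, η) * |f η| ≤ C * (1 + η ^ 2)⁻¹ := by
  obtain ⟨C, hC⟩ := hf (⌈2 * s⌉₊ + 2)
  have hC0 : 0 ≤ C := le_trans (by positivity) (hC 0)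
  refine ⟨(7 : ℝ) ^ (2 * s) * C, by positivity, fun n η hn => ?_⟩
  rw [← div_eq_mul_inv, le_div_iff₀ (by positivity)]
  calc weight s (n, η) * |f η| * (1 + η ^ 2) = weight s (n, η) * (1 + η ^ 2) * |f η| := by ring
    _ ≤ (7 : ℝ) ^ (2 * s) * (1 + |η|) ^ (⌈2 * s⌉₊ + 2) * |f η| :=
      mul_le_mul_of_nonneg_right (weight_zero_le s hs n hn η) (abs_nonneg _)
    _ = (7 : ℝ) ^ (2 * s) * ((1 + |η|) ^ (⌈2 * s⌉₊ + 2) * |f η|) := by ring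
    _ ≤ _ := mul_le_mul_of_nonneg_left (hC η) (by positivity)

theorem RapidDecay.lintegral_rpow_eweight_lt_top {f : ℝ → ℝ} (hf : RapidDecay f)
    (hm : Measurable f) {s : ℝ} (hs : 0 ≤ s) :
    ∫⁻ x, eweight s x ^ (1 / 2 : ℝ) * ‖firstHarmonic f x‖ₑ ∂freqMeasure < ⊤ := by
  obtain ⟨C, -, hC⟩ := hf.weight_le hs
  refine lintegral_firstHarmonic_lt_top (C := C) (((measurable_eweight s).pow_const _).mul
    (measurable_firstHarmonic hm).enorm) (fun n η hn => by simp [firstHarmonic, hn])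
    fun n η hn => ?_
  have h1 : eweight s (n, η) ^ (1 / 2 : ℝ) ≤ eweight s (n, η) := by
    conv_rhs => rw [← ENNReal.rpow_one (eweight s (n, η))]
    exact ENNReal.rpow_le_rpow_of_exponent_le (one_le_eweight hs _) (by norm_num)
  refine (mul_le_mul_left h1 _).trans ?_
  rw [firstHarmonic, if_pos hn, Real.enorm_eq_ofReal_abs, eweight,
    ← ENNReal.ofReal_mul (weight_pos _ _).le]
  exact ENNReal.ofReal_le_ofReal (hC n η hn)

theorem RapidDecay.evenL2 {f : ℝ → ℝ} (hf : RapidDecay f) (hm : Measurable f)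
    (he : ∀ η, f (-η) = f η) {s : ℝ} (hs : 0 ≤ s) : EvenL2 s (firstHarmonic f) where
  measurable := measurable_firstHarmonic hm
  finite := by
    obtain ⟨C, hC0, hC⟩ := hf.weight_le hs
    refine lintegral_firstHarmonic_lt_top (C := C * C) ((measurable_eweight s).mul
      ((measurable_firstHarmonic hm).enorm.pow_const _)) (fun n η hn => by simp [firstHarmonic, hn])
      fun n η hn => ?_
    rw [firstHarmonic, if_pos hn, Real.enorm_eq_ofReal_abs, eweight,
      ← ENNReal.ofReal_pow (abs_nonneg _), ← ENNReal.ofReal_mul (weight_pos _ _).le]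
    refine ENNReal.ofReal_le_ofReal ?_
    have h1 := hC n η hn
    have h2 : |f η| ≤ C := by
      have := one_le_weight hs (n, η)
      have h3 : C * (1 + η ^ 2)⁻¹ ≤ C :=
        mul_le_of_le_one_right hC0 (inv_le_one_of_one_le₀ (by nlinarith [sq_nonneg η]))
      exact (le_mul_of_one_le_left (abs_nonneg _) this).trans (h1.trans h3)
    calc weight s (n, η) * |f η| ^ 2 = (weight s (n, η) * |f η|) * |f η| := by ring
      _ ≤ (C * (1 + η ^ 2)⁻¹) * C := mul_le_mul h1 h2 (abs_nonneg _) (by positivity)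
      _ = _ := by ring
  harmonic := Eventually.of_forall fun x => by
    have : (-1 - x.1 = 0 ∨ -1 - x.1 = -1) ↔ (x.1 = 0 ∨ x.1 = -1) := by omega
    simp only [Function.comp_apply, firstHarmonic, reflectHarmonic_apply, this]
  space := Eventually.of_forall fun x => by
    simp [firstHarmonic, he]

theorem envelope_firstHarmonic (f : ℝ → ℝ) {n : ℤ} (hn : n = 0 ∨ n = -1) :
    envelope (firstHarmonic f) n = 𝓕⁻ fun η => (f η : ℂ) := by
  simp only [envelope, firstHarmonic, if_pos hn]

theorem envelope_firstHarmonic_of_ne (f : ℝ → ℝ) {n : ℤ} (hn : ¬ (n = 0 ∨ n = -1)) (ζ : ℝ) :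
    envelope (firstHarmonic f) n ζ = 0 := by
  simp [envelope_eq, firstHarmonic, if_neg hn]

theorem rapidDecay_re (f : SchwartzMap ℝ ℂ) : RapidDecay fun η => (f η).re := fun k => by
  refine ⟨2 ^ k * (Finset.Iic (k, 0)).sup (fun m => SchwartzMap.seminorm ℝ m.1 m.2) f,
    fun η => ?_⟩
  have h := SchwartzMap.one_add_le_sup_seminorm_apply (𝕜 := ℝ) (m := (k, 0)) (k := k) (n := 0)
    le_rfl le_rfl f η
  rw [norm_iteratedFDeriv_zero] at h
  refine le_trans ?_ h
  exact mul_le_mul_of_nonneg_left (Complex.abs_re_le_norm _) (by positivity)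

theorem measurable_re_schwartz (f : SchwartzMap ℝ ℂ) : Measurable fun η => (f η).re :=
  (Complex.continuous_re.comp f.continuous).measurable

/-- The Fourier transform of the soliton. -/
def solitonHat (Γ : ℝ) (η : ℝ) : ℝ := ((𝓕⁻ (solitonSchwartz Γ)) η).re

/-- Here the soliton plays the role of a function of frequency, so that the general facts on
envelopes show that its inverse transform is real and even. -/
theorem evenL2_solitonSpace (Γ : ℝ) {s : ℝ} (hs : 0 ≤ s) :
    EvenL2 s (firstHarmonic (soliton Γ)) := by
  have h := (rapidDecay_re (solitonSchwartz Γ)).evenL2 (measurable_re_schwartz _)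
    (fun η => by simp only [solitonSchwartz_apply, soliton_neg]) hs
  simpa only [solitonSchwartz_apply, Complex.ofReal_re] using h

theorem fourierInv_solitonSchwartz (Γ : ℝ) :
    (𝓕⁻ (solitonSchwartz Γ) : SchwartzMap ℝ ℂ) =
      (envelope (firstHarmonic (soliton Γ)) 0 : ℝ → ℂ) := by
  rw [envelope_firstHarmonic _ (Or.inl rfl), SchwartzMap.fourierInv_coe, coe_solitonSchwartz]

theorem ofReal_solitonHat (Γ η : ℝ) :
    (solitonHat Γ η : ℂ) = (𝓕⁻ (solitonSchwartz Γ) : SchwartzMap ℝ ℂ) η := by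
  refine Complex.conj_eq_iff_re.1 ?_
  rw [fourierInv_solitonSchwartz]
  exact (evenL2_solitonSpace Γ zero_le_one).conj_envelope 0 η

theorem solitonHat_neg (Γ η : ℝ) : solitonHat Γ (-η) = solitonHat Γ η := by
  rw [solitonHat, solitonHat, fourierInv_solitonSchwartz,
    (evenL2_solitonSpace Γ zero_le_one).envelope_neg]

theorem evenL2_soliton (Γ : ℝ) {s : ℝ} (hs : 0 ≤ s) :
    EvenL2 s (firstHarmonic (solitonHat Γ)) :=
  (rapidDecay_re _).evenL2 (measurable_re_schwartz _) (solitonHat_neg Γ) hs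

theorem lintegral_rpow_eweight_soliton_lt_top (Γ : ℝ) {s : ℝ} (hs : 0 ≤ s) :
    ∫⁻ x, eweight s x ^ (1 / 2 : ℝ) * ‖firstHarmonic (solitonHat Γ) x‖ₑ ∂freqMeasure < ⊤ :=
  (rapidDecay_re _).lintegral_rpow_eweight_lt_top (measurable_re_schwartz _) hs

/-- Evenness allows ζ to be replaced by -ζ, which turns the outer inverse transform into a forward
one; this cancels the inverse transform that defines `solitonHat`. -/
theorem envelope_soliton (Γ : ℝ) {n : ℤ} (hn : n = 0 ∨ n = -1) (ζ : ℝ) :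
    envelope (firstHarmonic (solitonHat Γ)) n ζ = soliton Γ ζ := by
  rw [← (evenL2_soliton Γ zero_le_one).envelope_neg, envelope_firstHarmonic _ hn,
    funext (ofReal_solitonHat Γ), Real.fourierInv_eq_fourier_neg, neg_neg,
    ← SchwartzMap.fourier_coe, FourierTransform.fourier_fourierInv_eq, solitonSchwartz_apply]

theorem field_soliton (Γ : ℝ) : field (firstHarmonic (solitonHat Γ)) = monoSoliton Γ := by
  funext ζ φ
  have h : cfield (firstHarmonic (solitonHat Γ)) ζ φ = (monoSoliton Γ ζ φ : ℂ) := by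
    rw [cfield, tsum_eq_sum (s := {0, -1})]
    · rw [Finset.sum_pair (by norm_num), envelope_soliton Γ (Or.inl rfl),
        envelope_soliton Γ (Or.inr rfl), carrier, carrier, monoSoliton]
      push_cast
      rw [Complex.cos]
      ring_nf
    · intro n hn
      rw [envelope_firstHarmonic_of_ne _ (by simpa using hn), zero_mul]
  rw [field, h, Complex.ofReal_re]

/-- At ε = 0 the harmonics decouple: on ±1 the equation is the soliton's own, and on the others both
sides vanish. -/
theorem soliton_fixed {Γ : ℝ} (hΓ : 0 < Γ) {s : ℝ} (hs : 1 < s) :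
    firstHarmonic (solitonHat Γ) =ᵐ[freqMeasure] fun x => resolvent (2 * x.1 + 1) x.2 *
      nonlinearity Γ 0 (firstHarmonic (solitonHat Γ)) x := by
  have hu := evenL2_soliton Γ (zero_le_one.trans hs.le)
  refine ae_eq_resolvent_of_ode hs hu.toWL2 (hu.toWL2.nonlinearity hs Γ 0) (fun n => ?_)
    fun n ζ => ?_
  · by_cases hn : n = 0 ∨ n = -1
    · rw [funext (envelope_soliton Γ hn)]
      exact contDiff_sech _
    · rw [funext (envelope_firstHarmonic_of_ne (solitonHat Γ) hn)]
      exact contDiff_const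
  · rw [envelope_nonlinearity hs hu (hu.mode_field_odd hs), hu.mode_field_odd hs]
    by_cases hn : n = 0 ∨ n = -1
    · rw [funext (envelope_soliton Γ hn), deriv_deriv_soliton hΓ]
      rcases hn with rfl | rfl <;> push_cast <;> ring
    · rw [funext (envelope_firstHarmonic_of_ne (solitonHat Γ) hn)]
      simp

/-! ### Hilbert-Schmidt operators -/

section

variable {H : Type*} [NormedAddCommGroup H] [InnerProductSpace ℝ H]

/-- Test the bound on x = ∑ L(v_i) v_i: both L x and ‖x‖² equal S = ∑ L(v_i)², so a S² ≤ k S, and S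
cancels. No continuity of L has to be assumed. -/
theorem mul_sum_enorm_sq_le_of_orthonormal {ι : Type*} {v : ι → H} (hv : Orthonormal ℝ v)
    (F : Finset ι) (L : H →ₗ[ℝ] ℝ) {a k : ℝ≥0∞}
    (h : ∀ x, a * ‖L x‖ₑ ^ 2 ≤ k * ‖x‖ₑ ^ 2) : a * ∑ i ∈ F, ‖L (v i)‖ₑ ^ 2 ≤ k := by
  set S : ℝ := ∑ i ∈ F, L (v i) ^ 2 with hS
  have hS0 : 0 ≤ S := Finset.sum_nonneg fun i _ => sq_nonneg _
  have hsum : ∑ i ∈ F, ‖L (v i)‖ₑ ^ 2 = ENNReal.ofReal S := by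
    rw [hS, ENNReal.ofReal_sum_of_nonneg fun i _ => sq_nonneg _]
    refine Finset.sum_congr rfl fun i _ => ?_
    rw [Real.enorm_eq_ofReal_abs, ← ENNReal.ofReal_pow (abs_nonneg _), sq_abs]
  have h1 := h (∑ i ∈ F, L (v i) • v i)
  have h2 : L (∑ i ∈ F, L (v i) • v i) = S := by
    rw [map_sum]
    exact Finset.sum_congr rfl fun i _ => by rw [map_smul, smul_eq_mul, pow_two]
  have h3 : ‖∑ i ∈ F, L (v i) • v i‖ₑ ^ 2 = ENNReal.ofReal S := by
    rw [← ofReal_norm, ← ENNReal.ofReal_pow (norm_nonneg _),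
      ← real_inner_self_eq_norm_sq, hv.inner_sum]
    simp only [conj_trivial, ← pow_two]
    rfl
  rw [h2, h3, Real.enorm_of_nonneg hS0, pow_two, ← mul_assoc] at h1
  rw [hsum]
  rcases eq_or_ne (ENNReal.ofReal S) 0 with h0 | h0
  · rw [h0, mul_zero]
    exact zero_le
  · exact (ENNReal.mul_le_mul_iff_left h0 ENNReal.ofReal_ne_top).1 h1

theorem isCompactOperator_smulRight (ℓ : H →L[ℝ] ℝ) (y : H) :
    IsCompactOperator (ℓ.smulRight y) := by
  have h : IsCompactOperator (ContinuousLinearMap.id ℝ ℝ) := by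
    refine ⟨Metric.closedBall 0 1, isCompact_closedBall 0 1, ?_⟩
    exact Metric.closedBall_mem_nhds 0 one_pos
  exact (h.comp_clm ℓ).clm_comp (ContinuousLinearMap.toSpanSingleton ℝ y)

variable [CompleteSpace H]

/-- A Hilbert-Schmidt operator is the norm limit of its finite rank truncations; Cauchy-Schwarz and
Bessel bound the error by the tail of ∑ ‖A b_i‖². -/
theorem isCompactOperator_of_summable {ι : Type*} (b : HilbertBasis ι ℝ H) (A : H →L[ℝ] H)
    (hA : Summable fun i => ‖A (b i)‖ ^ 2) : IsCompactOperator A := by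
  classical
  let P : Finset ι → H →L[ℝ] H := fun F => ∑ i ∈ F, (innerSL ℝ (b i)).smulRight (A (b i))
  have hP : ∀ F v, P F v = ∑ i ∈ F, inner ℝ (b i) v • A (b i) := fun F v => by
    simp [P]
  refine isCompactOperator_of_tendsto (F := P) (l := atTop) ?_ (Eventually.of_forall fun F => ?_)
  · rw [tendsto_iff_norm_sub_tendsto_zero, Metric.tendsto_atTop]
    intro ε hε
    obtain ⟨F₀, hF₀⟩ := summable_iff_vanishing_norm.1 hA ((ε / 2) ^ 2) (by positivity)
    refine ⟨F₀, fun F hF => ?_⟩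
    rw [Real.dist_eq, sub_zero, abs_norm]
    refine lt_of_le_of_lt (ContinuousLinearMap.opNorm_le_bound _ (by positivity : 0 ≤ ε / 2)
      fun v => ?_) (half_lt_self hε)
    -- The error of the truncation is a limit of differences of truncations, which are finite sums
    -- over indices outside F.
    have hlim : Tendsto (fun G : Finset ι => P F v - P G v) atTop (𝓝 (P F v - A v)) := by
      refine tendsto_const_nhds.sub ?_
      have := (b.hasSum_repr v).mapL A
      simp only [map_smul, b.repr_apply_apply] at this
      refine Tendsto.congr (fun G => (hP G v).symm) this
    refine le_of_tendsto hlim.norm ?_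
    filter_upwards [eventually_ge_atTop F] with G hG
    have hd : P F v - P G v = -∑ i ∈ G \ F, inner ℝ (b i) v • A (b i) := by
      rw [hP, hP, ← Finset.sum_sdiff hG]
      abel
    rw [hd, norm_neg]
    have hdisj : Disjoint (G \ F) F₀ := Finset.disjoint_of_subset_right hF Finset.sdiff_disjoint
    have h1 := hF₀ _ hdisj
    rw [Real.norm_of_nonneg (Finset.sum_nonneg fun i _ => by positivity)] at h1
    have h2 := b.orthonormal.sum_inner_products_le v (s := G \ F)
    calc ‖∑ i ∈ G \ F, inner ℝ (b i) v • A (b i)‖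
        ≤ ∑ i ∈ G \ F, ‖inner ℝ (b i) v‖ * ‖A (b i)‖ :=
          (norm_sum_le _ _).trans (Finset.sum_le_sum fun i _ => (norm_smul_le _ _))
      _ ≤ Real.sqrt (∑ i ∈ G \ F, ‖inner ℝ (b i) v‖ ^ 2) *
          Real.sqrt (∑ i ∈ G \ F, ‖A (b i)‖ ^ 2) := Real.sum_mul_le_sqrt_mul_sqrt _ _ _
      _ ≤ ‖v‖ * (ε / 2) := by
          refine mul_le_mul ?_ ?_ (Real.sqrt_nonneg _) (norm_nonneg _)
          · exact Real.sqrt_le_iff.2 ⟨norm_nonneg _, h2⟩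
          · exact Real.sqrt_le_iff.2 ⟨by positivity, h1.le⟩
      _ = ε / 2 * ‖v‖ := mul_comm _ _
  · induction F using Finset.induction with
    | empty =>
      simp only [P, Finset.sum_empty]
      exact isCompactOperator_zero
    | insert i F hi ih =>
      simp only [P, Finset.sum_insert hi]
      exact (isCompactOperator_smulRight _ _).add ih

/-- If A is evaluation by functionals L x with w(x) |L x v|² ≤ k(x) ‖v‖² and k integrable, then
every finite part of ∑ ‖A b_i‖² is at most ∫ k: exchange sum and integral and use the preceding
bound at each x. -/
theorem isCompactOperator_of_lintegral {X : Type*} [MeasurableSpace X] {μ : Measure X}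
    (A : H →L[ℝ] H) (L : X → H →ₗ[ℝ] ℝ) {w k : X → ℝ≥0∞}
    (hm : ∀ v, Measurable fun x => w x * ‖L x v‖ₑ ^ 2)
    (hA : ∀ v, ‖A v‖ₑ ^ 2 ≤ ∫⁻ x, w x * ‖L x v‖ₑ ^ 2 ∂μ)
    (hL : ∀ x v, w x * ‖L x v‖ₑ ^ 2 ≤ k x * ‖v‖ₑ ^ 2) (hk : ∫⁻ x, k x ∂μ < ⊤) :
    IsCompactOperator A := by
  obtain ⟨I, b, -⟩ := exists_hilbertBasis ℝ H
  refine isCompactOperator_of_summable b A ?_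
  have hF : ∀ F : Finset I, ∑ i ∈ F, ‖A (b i)‖ ^ 2 ≤ (∫⁻ x, k x ∂μ).toReal := fun F => by
    rw [← ENNReal.ofReal_le_iff_le_toReal hk.ne,
      ENNReal.ofReal_sum_of_nonneg fun i _ => by positivity]
    calc ∑ i ∈ F, ENNReal.ofReal (‖A (b i)‖ ^ 2) = ∑ i ∈ F, ‖A (b i)‖ₑ ^ 2 := by
          refine Finset.sum_congr rfl fun i _ => ?_
          rw [ENNReal.ofReal_pow (norm_nonneg _), ofReal_norm]
      _ ≤ ∑ i ∈ F, ∫⁻ x, w x * ‖L x (b i)‖ₑ ^ 2 ∂μ := Finset.sum_le_sum fun i _ => hA _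
      _ = ∫⁻ x, w x * ∑ i ∈ F, ‖L x (b i)‖ₑ ^ 2 ∂μ := by
          rw [← lintegral_finsetSum _ fun i _ => hm (b i)]
          simp only [Finset.mul_sum]
      _ ≤ ∫⁻ x, k x ∂μ := lintegral_mono fun x =>
          mul_sum_enorm_sq_le_of_orthonormal b.orthonormal F (L x) (hL x)
  exact summable_of_sum_le (fun i => by positivity) hF

end

/-! ### The linearized equation -/

/-- The function φ = sinh / cosh² = -sech' solves the same equation, by translation invariance of
the soliton equation. Its Wronskian with V is constant, and it decays because φ and φ' do while V
and V' are bounded, so it is 0. At the origin φ = 0 and φ' = 1, which gives V(0) = 0; evenness gives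
V'(0) = 0, and uniqueness for the initial value problem concludes. -/
theorem eq_zero_of_linearized {V : ℝ → ℂ} (hV : ContDiff ℝ 2 V) (heven : ∀ ζ, V (-ζ) = V ζ)
    {M₀ M₁ : ℝ} (hM₀ : ∀ ζ, ‖V ζ‖ ≤ M₀) (hM₁ : ∀ ζ, ‖deriv V ζ‖ ≤ M₁)
    (h : ∀ ζ, deriv (deriv V) ζ = ((1 - 6 / Real.cosh ζ ^ 2 : ℝ) : ℂ) * V ζ) : V = 0 := by
  have hd0 : ∀ x, HasDerivAt V (deriv V x) x := fun x =>
    (hV.differentiable (by norm_num) x).hasDerivAt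
  have hd1 : ∀ x, HasDerivAt (deriv V) (((1 - 6 / Real.cosh x ^ 2 : ℝ) : ℂ) * V x) x := fun x => by
    rw [← h x]
    have : ContDiff ℝ 1 (deriv V) := (contDiff_succ_iff_deriv.1 hV).2.2
    exact (this.differentiable (by norm_num) x).hasDerivAt
  set φ : ℝ → ℝ := fun x => Real.sinh x / Real.cosh x ^ 2 with hφ
  set ψ : ℝ → ℝ := fun x => 2 / Real.cosh x ^ 3 - 1 / Real.cosh x with hψ
  have hφd : ∀ x, HasDerivAt φ (ψ x) x := hasDerivAt_sinh_div_cosh_sq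
  have hψd : ∀ x, HasDerivAt ψ ((1 - 6 / Real.cosh x ^ 2) * φ x) x := fun x => by
    have hc := (Real.cosh_pos x).ne'
    refine (((hasDerivAt_const x (2 : ℝ)).div ((Real.hasDerivAt_cosh x).pow 3)
      (pow_ne_zero 3 hc)).sub (hasDerivAt_sech x)).congr_deriv ?_
    simp only [hφ, Pi.pow_apply]
    field_simp
    ring
  set W : ℝ → ℂ := fun x => deriv V x * φ x - V x * ψ x with hW
  have hWd : ∀ x, HasDerivAt W 0 x := fun x => by
    refine (((hd1 x).mul (hφd x).ofReal_comp).sub ((hd0 x).mul (hψd x).ofReal_comp)).congr_deriv ?_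
    push_cast
    ring
  have hWc : ∀ x, W x = W 0 := fun x =>
    is_const_of_deriv_eq_zero (fun y => (hWd y).differentiableAt) (fun y => (hWd y).deriv) x 0
  have hM₀' : 0 ≤ M₀ := (norm_nonneg _).trans (hM₀ 0)
  have hM₁' : 0 ≤ M₁ := (norm_nonneg _).trans (hM₁ 0)
  have hWb : ∀ x, ‖W x‖ ≤ (M₁ + 3 * M₀) * (1 / Real.cosh x) := fun x => by
    have hc := Real.cosh_pos x
    have hc1 := Real.one_le_cosh x
    have hφb : |φ x| ≤ 1 / Real.cosh x := by
      have ht := (Real.abs_tanh_lt_one x).le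
      rw [Real.tanh_eq_sinh_div_cosh] at ht
      have : φ x = Real.sinh x / Real.cosh x * (1 / Real.cosh x) := by
        simp only [hφ]; field_simp
      rw [this, abs_mul, abs_of_pos (by positivity : 0 < 1 / Real.cosh x)]
      exact mul_le_of_le_one_left (by positivity) ht
    have hψb : |ψ x| ≤ 3 * (1 / Real.cosh x) := by
      have : ψ x = (2 * (1 / Real.cosh x ^ 2) - 1) * (1 / Real.cosh x) := by
        simp only [hψ]; field_simp
      rw [this, abs_mul, abs_of_pos (by positivity : 0 < 1 / Real.cosh x)]
      refine mul_le_mul_of_nonneg_right ?_ (by positivity)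
      have h1 : 1 / Real.cosh x ^ 2 ≤ 1 := by
        rw [div_le_one (by positivity)]
        exact one_le_pow₀ hc1
      have h2 : 0 ≤ 1 / Real.cosh x ^ 2 := by positivity
      rw [abs_le]
      constructor <;> linarith
    calc ‖W x‖ ≤ ‖deriv V x‖ * |φ x| + ‖V x‖ * |ψ x| := by
          refine (norm_sub_le _ _).trans ?_
          rw [norm_mul, norm_mul, Complex.norm_real, Complex.norm_real, Real.norm_eq_abs,
            Real.norm_eq_abs]
      _ ≤ M₁ * (1 / Real.cosh x) + M₀ * (3 * (1 / Real.cosh x)) := by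
          refine add_le_add ?_ ?_
          · exact mul_le_mul (hM₁ x) hφb (abs_nonneg _) hM₁'
          · exact mul_le_mul (hM₀ x) hψb (abs_nonneg _) hM₀'
      _ = _ := by ring
  have hW0 : W 0 = 0 := by
    by_contra hne
    have hpos : 0 < ‖W 0‖ := norm_pos_iff.2 hne
    set R := M₁ + 3 * M₀ with hR
    have hR0 : 0 ≤ R := by positivity
    -- The decay gives x ‖W 0‖ ≤ 2R for all x > 0; this choice makes the left side 2R + 1.
    set x := (2 * R + 1) / ‖W 0‖ with hx
    have hx0 : 0 < x := by positivity
    have h1 := hWb x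
    rw [hWc] at h1
    have h2 := abs_pow_mul_sech_le 1 x
    rw [pow_one, abs_of_pos hx0, Nat.factorial_one, Nat.cast_one, mul_one] at h2
    have h3 : x * ‖W 0‖ ≤ R * 2 := by
      calc x * ‖W 0‖ ≤ x * (R * (1 / Real.cosh x)) := mul_le_mul_of_nonneg_left h1 hx0.le
        _ = R * (x * (1 / Real.cosh x)) := by ring
        _ ≤ R * 2 := mul_le_mul_of_nonneg_left h2 hR0
    rw [hx, div_mul_cancel₀ _ hpos.ne'] at h3
    linarith
  have hV0 : V 0 = 0 := by
    have : W 0 = -V 0 := by simp [hW, hφ, hψ]; norm_num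
    rw [hW0] at this
    exact neg_eq_zero.1 this.symm
  have hV1 : deriv V 0 = 0 := by
    have h1 : deriv (fun x => V (-x)) 0 = -deriv V 0 := by
      rw [deriv_comp_neg, neg_zero]
    rw [funext heven] at h1
    exact self_eq_neg.1 h1
  -- The equation as a first order system for (V, V'); its Lipschitz constant 7 = 1 + 6 is a crude
  -- bound of |1 - 6 sech²|.
  have key := ODE_solution_unique_univ (v := fun t (y : ℂ × ℂ) =>
      (y.2, ((1 - 6 / Real.cosh t ^ 2 : ℝ) : ℂ) * y.1)) (s := fun _ => Set.univ) (K := 7)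
    (f := fun t => (V t, deriv V t)) (g := fun _ => 0) (t₀ := 0) (fun t => ?_)
    (fun t => ⟨(hd0 t).prodMk (hd1 t), trivial⟩) (fun t => ⟨?_, trivial⟩) ?_
  · funext t
    exact congrArg Prod.fst (congrFun key t)
  · refine (LipschitzWith.of_dist_le_mul fun x y => ?_).lipschitzOnWith
    have h1 : 6 / Real.cosh t ^ 2 ≤ 6 := div_le_self (by norm_num)
      (one_le_pow₀ (Real.one_le_cosh t))
    have h2 : 0 ≤ 6 / Real.cosh t ^ 2 := by positivity
    rw [Prod.dist_eq, Prod.dist_eq]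
    have h3 : dist x.1 y.1 ≤ max (dist x.1 y.1) (dist x.2 y.2) := le_max_left _ _
    have h4 : dist x.2 y.2 ≤ max (dist x.1 y.1) (dist x.2 y.2) := le_max_right _ _
    have h5 : 0 ≤ dist x.1 y.1 := dist_nonneg
    refine max_le ?_ ?_
    · simp only [NNReal.coe_ofNat]
      linarith
    · rw [dist_eq_norm, ← mul_sub, norm_mul, ← dist_eq_norm, Complex.norm_real, Real.norm_eq_abs]
      have h6 : |1 - 6 / Real.cosh t ^ 2| ≤ 7 := by
        rw [abs_le]
        constructor <;> linarith
      simp only [NNReal.coe_ofNat]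
      nlinarith
  · exact (hasDerivAt_const t (0 : ℂ × ℂ)).congr_deriv
      (Prod.ext rfl (mul_zero _).symm)
  · simp [hV0, hV1]

/-! ### The linearization at the soliton -/

section

variable {s : ℝ} {u v w : ℤ × ℝ → ℝ}

theorem envelope_resolvent_mul_congr (hs : 1 < s) (hu : WL2 s u) (hv : WL2 s v)
    (h : ∀ n ζ, envelope u n ζ = envelope v n ζ) :
    (fun x => resolvent (2 * x.1 + 1) x.2 * u x) =ᵐ[freqMeasure]
      fun x => resolvent (2 * x.1 + 1) x.2 * v x := by
  filter_upwards [ae_eq_of_envelope_eq hs hu hv fun n => funext (h n)] with x hx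
  rw [hx]

/-- The trilinear map of the self-interaction. -/
def selfCLM (hs : 1 < s) :
    EvenSpace s →L[ℝ] EvenSpace s →L[ℝ] EvenSpace s →L[ℝ] EvenSpace s :=
  interactionCLM hs isMask_selfMask zero_le_one

theorem selfCLM_ae (hs : 1 < s) (f g h : EvenSpace s) : (selfCLM hs f g h).fn =ᵐ[freqMeasure]
    fun x => resolvent (2 * x.1 + 1) x.2 * triple selfMask f.fn g.fn h.fn x :=
  interactionCLM_ae hs isMask_selfMask zero_le_one f g h

theorem envelope_triple_selfMask_coeFn (hs : 1 < s) (f g h : EvenSpace s) (n : ℤ) (ζ : ℝ) :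
    envelope (triple selfMask f.fn g.fn h.fn) n ζ =
      envelope f.fn n ζ * envelope g.fn n ζ * envelope h.fn n ζ :=
  envelope_triple_selfMask hs (EvenL2.coeFn f).toWL2 (EvenL2.coeFn g).toWL2 (EvenL2.coeFn h) n ζ

theorem wL2_triple_coeFn (hs : 1 < s) (f g h : EvenSpace s) :
    WL2 s (triple selfMask f.fn g.fn h.fn) :=
  WL2.triple hs isMask_selfMask (EvenL2.coeFn f).toWL2 (EvenL2.coeFn g).toWL2
    (EvenL2.coeFn h).toWL2

/-- The symmetry is hidden in the masked convolution, where the third slot carries -p, but is plain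
for the envelopes, where the map is a pointwise product. -/
theorem selfCLM_swap_right (hs : 1 < s) (f g h : EvenSpace s) :
    selfCLM hs f g h = selfCLM hs f h g := by
  refine EvenSpace.ext ((selfCLM_ae hs f g h).trans (EventuallyEq.trans ?_
    (selfCLM_ae hs f h g).symm))
  refine envelope_resolvent_mul_congr hs (wL2_triple_coeFn hs f g h) (wL2_triple_coeFn hs f h g)
    fun n ζ => ?_
  rw [envelope_triple_selfMask_coeFn hs, envelope_triple_selfMask_coeFn hs]
  ring

theorem selfCLM_swap_left (hs : 1 < s) (f g h : EvenSpace s) :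
    selfCLM hs f g h = selfCLM hs g f h := by
  refine EvenSpace.ext ((selfCLM_ae hs f g h).trans (EventuallyEq.trans ?_
    (selfCLM_ae hs g f h).symm))
  refine envelope_resolvent_mul_congr hs (wL2_triple_coeFn hs f g h) (wL2_triple_coeFn hs g f h)
    fun n ζ => ?_
  rw [envelope_triple_selfMask_coeFn hs, envelope_triple_selfMask_coeFn hs]
  ring

/-- The soliton as an element of the Hilbert space. -/
def solitonPoint (Γ : ℝ) (hs : 1 < s) : EvenSpace s :=
  (evenL2_soliton Γ (zero_le_one.trans hs.le)).toEvenSpace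

theorem solitonPoint_ae (Γ : ℝ) (hs : 1 < s) :
    (solitonPoint Γ hs).fn =ᵐ[freqMeasure] firstHarmonic (solitonHat Γ) :=
  (evenL2_soliton Γ (zero_le_one.trans hs.le)).coe_toEvenSpace

/-- The self-interaction does not mix harmonics, so a factor carried by ±1 confines the result to
±1. -/
theorem triple_selfMask_firstHarmonic (f : ℝ → ℝ) (v w : ℤ × ℝ → ℝ) {x : ℤ × ℝ}
    (hx : ¬ (x.1 = 0 ∨ x.1 = -1)) : triple selfMask (firstHarmonic f) v w x = 0 := by
  have h : ∀ z : (ℤ × ℝ) × (ℤ × ℝ), selfMask x.1 z.1.1 z.2.1 *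
      (firstHarmonic f z.1 * v z.2 * w (x - z.1 - z.2 - (1, 0))) = 0 := fun z => by
    by_cases hz : z.1.1 = x.1
    · have : firstHarmonic f z.1 = 0 := if_neg (by rwa [hz])
      rw [this]
      ring
    · have : selfMask x.1 z.1.1 z.2.1 = 0 := if_neg fun h => hz h.1
      rw [this, zero_mul]
  simp only [triple, h, integral_zero]

theorem resolvent_sq_le {n : ℤ} (hn : n = 0 ∨ n = -1) (η : ℝ) :
    resolvent (2 * n + 1) η ^ 2 ≤ (1 + η ^ 2)⁻¹ := by
  have h1 : (((2 * n + 1 : ℤ) : ℝ)) ^ 2 = 1 := by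
    rcases hn with rfl | rfl <;> norm_num
  have h2 : resolvent (2 * n + 1) η ≤ (1 + η ^ 2)⁻¹ := by
    rw [resolvent, h1, one_div]
    refine inv_anti₀ (by positivity) ?_
    have : 1 ≤ (2 * Real.pi) ^ 2 := one_le_pow₀ (by linarith [Real.pi_gt_three])
    rw [mul_pow]
    nlinarith [sq_nonneg η]
  calc resolvent (2 * n + 1) η ^ 2 = resolvent (2 * n + 1) η * resolvent (2 * n + 1) η := by ring
    _ ≤ 1 * resolvent (2 * n + 1) η :=
      mul_le_mul_of_nonneg_right (resolvent_le_one _ _) (resolvent_nonneg _ _)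
    _ ≤ _ := by rwa [one_mul]

/-- The linearized interaction as a pointwise functional. -/
def linearizedFunctional (Γ : ℝ) (hs : 1 < s) (x : ℤ × ℝ) : EvenSpace s →ₗ[ℝ] ℝ where
  toFun v := interaction selfMask (firstHarmonic (solitonHat Γ))
    (firstHarmonic (solitonHat Γ)) v.fn x
  map_add' f g := by
    have hu := (evenL2_soliton Γ (zero_le_one.trans hs.le)).toWL2
    rw [interaction, triple_congr (EventuallyEq.refl _ _) (EventuallyEq.refl _ _) (coe_add_ae f g),
      triple_add_right hs isMask_selfMask hu hu (EvenL2.coeFn f).toWL2 (EvenL2.coeFn g).toWL2,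
      interaction, interaction]
    ring
  map_smul' c f := by
    rw [interaction, triple_congr (EventuallyEq.refl _ _) (EventuallyEq.refl _ _) (coe_smul_ae c f),
      triple_mul_right, interaction, RingHom.id_apply, smul_eq_mul]
    ring

theorem linearizedFunctional_apply (Γ : ℝ) (hs : 1 < s) (x : ℤ × ℝ) (v : EvenSpace s) :
    linearizedFunctional Γ hs x v = interaction selfMask (firstHarmonic (solitonHat Γ))
      (firstHarmonic (solitonHat Γ)) v.fn x := rfl

/-- The Hilbert-Schmidt bound: the soliton decays fast enough to take its share of the weight in L¹,
so w |K v|² is at most a constant times ‖v‖² times the squared symbol. On the two harmonics ±1 the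
squared symbol is integrable in η. -/
theorem isCompactOperator_selfCLM (Γ : ℝ) (hs : 1 < s) :
    IsCompactOperator (selfCLM hs (solitonPoint Γ hs) (solitonPoint Γ hs)) := by
  have hs0 : 0 ≤ s := zero_le_one.trans hs.le
  have hu := evenL2_soliton Γ hs0
  set f := firstHarmonic (solitonHat Γ) with hf
  set C : ℝ≥0∞ := ENNReal.ofReal (9 ^ s) * 3 *
    ((∫⁻ y, eweight s y ^ (1 / 2 : ℝ) * ‖f y‖ₑ ∂freqMeasure) ^ 2 * wsq s f) with hC
  have hCtop : C ≠ ⊤ := ENNReal.mul_ne_top (by finiteness) (ENNReal.mul_ne_top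
    (ENNReal.pow_ne_top (lintegral_rpow_eweight_soliton_lt_top Γ hs0).ne) hu.finite.ne)
  refine isCompactOperator_of_lintegral (μ := freqMeasure)
    (selfCLM hs (solitonPoint Γ hs) (solitonPoint Γ hs)) (linearizedFunctional Γ hs)
    (w := eweight s)
    (k := fun x => ‖firstHarmonic (fun η => resolvent 1 η) x‖ₑ ^ 2 * C) (fun v => ?_) (fun v => ?_)
    (fun x v => ?_) ?_
  · exact (measurable_eweight s).mul ((EvenL2.interaction hs isMask_selfMask hu hu
      (EvenL2.coeFn v)).measurable.enorm.pow_const _)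
  · rw [enorm_sq_eq_wsq, wsq_congr (selfCLM_ae hs _ _ _)]
    refine le_of_eq (lintegral_congr fun x => ?_)
    beta_reduce
    rw [linearizedFunctional_apply, interaction,
      triple_congr (solitonPoint_ae Γ hs) (solitonPoint_ae Γ hs) (EventuallyEq.refl _ _)]
  · rw [linearizedFunctional_apply, interaction]
    by_cases hx : x.1 = 0 ∨ x.1 = -1
    · have hres : firstHarmonic (fun η => resolvent 1 η) x = resolvent (2 * x.1 + 1) x.2 := by
        rw [firstHarmonic, if_pos hx]
        rcases hx with h | h <;> rw [h] <;> simp [resolvent]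
      have h1 := eweight_mul_etriple_sq_le hs0 hu.measurable.enorm hu.measurable.enorm
        (EvenL2.coeFn v).measurable.enorm x
      have h2 := enorm_triple_le isMask_selfMask hu.measurable hu.measurable
        (EvenL2.coeFn v).measurable x
      rw [ENNReal.ofReal_one, one_mul] at h2
      rw [hres, enorm_mul, mul_pow, enorm_sq_eq_wsq]
      calc eweight s x * (‖resolvent (2 * x.1 + 1) x.2‖ₑ ^ 2 * ‖triple selfMask f f v.fn x‖ₑ ^ 2)
          = ‖resolvent (2 * x.1 + 1) x.2‖ₑ ^ 2 *
            (eweight s x * ‖triple selfMask f f v.fn x‖ₑ ^ 2) := by ring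
        _ ≤ ‖resolvent (2 * x.1 + 1) x.2‖ₑ ^ 2 * (C * wsq s v.fn) := by
            refine mul_le_mul_right ?_ _
            refine (mul_le_mul_right (pow_le_pow_left' h2 2) _).trans (h1.trans (le_of_eq ?_))
            simp only [hC, wsq]
            ring
        _ = _ := by ring
    · rw [triple_selfMask_firstHarmonic _ _ _ hx]
      simp
  · rw [lintegral_mul_const' _ _ hCtop]
    refine ENNReal.mul_lt_top ?_ hCtop.lt_top
    refine lintegral_firstHarmonic_lt_top (C := 1) ((measurable_firstHarmonic
      (measurable_resolvent 1)).enorm.pow_const _) (fun n η hn => by simp [firstHarmonic, hn])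
      fun n η hn => ?_
    rw [firstHarmonic, if_pos hn, Real.enorm_of_nonneg (resolvent_nonneg _ _),
      ← ENNReal.ofReal_pow (resolvent_nonneg _ _), one_mul]
    exact ENNReal.ofReal_le_ofReal (by simpa using resolvent_sq_le (Or.inl rfl) η)

/-- Back in physical space the harmonics decouple. Since 18 Γ U_*² = 6 sech², the modes ±1 satisfy
V'' = (1 - 6 sech²) V, while every other mode satisfies V'' = p² V; both have only the zero solution
among bounded even ones. -/
theorem eq_zero_of_linearized_fixed {Γ : ℝ} (hΓ : 0 < Γ) (hs : 1 < s) {v : EvenSpace s}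
    (h : (18 * Γ) • selfCLM hs (solitonPoint Γ hs) (solitonPoint Γ hs) v = v) : v = 0 := by
  set p := solitonPoint Γ hs with hp
  have hv := EvenL2.coeFn v
  have hg := (wL2_triple_coeFn hs p p v).const_mul (18 * Γ)
  have hfix : v.fn =ᵐ[freqMeasure] fun x => resolvent (2 * x.1 + 1) x.2 *
      (18 * Γ * triple selfMask p.fn p.fn v.fn x) := by
    have h1 := coe_smul_ae (18 * Γ) (selfCLM hs p p v)
    rw [h] at h1
    filter_upwards [h1, selfCLM_ae hs p p v] with x hx hx'
    rw [hx, hx']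
    ring
  have hode := envelope_resolvent hs hg hfix
  obtain ⟨M, hM⟩ := hv.toWL2.exists_norm_envelope_le hs
  have henv : ∀ n, envelope v.fn n = 0 := fun n => by
    obtain ⟨hc, ⟨M₁, hM₁⟩, hn⟩ := hode n
    have hsub : ∀ ζ, envelope (fun x => 18 * Γ * triple selfMask p.fn p.fn v.fn x) n ζ =
        18 * Γ * (envelope (firstHarmonic (solitonHat Γ)) n ζ ^ 2 * envelope v.fn n ζ) := fun ζ => by
      rw [envelope_const_mul, envelope_triple_selfMask_coeFn hs,
        envelope_congr (solitonPoint_ae Γ hs)]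
      push_cast
      ring
    by_cases h01 : n = 0 ∨ n = -1
    · refine eq_zero_of_linearized hc (hv.envelope_neg n) (hM n) hM₁ fun ζ => ?_
      have h2 := congrArg (fun t : ℝ => (t : ℂ)) (six_mul_soliton_sq hΓ ζ)
      have h3 : ((2 * n + 1 : ℤ) : ℂ) ^ 2 = 1 := by
        rcases h01 with rfl | rfl <;> norm_num
      rw [hn, hsub, envelope_soliton Γ h01, h3]
      push_cast at h2 ⊢
      linear_combination -3 * envelope v.fn n ζ * h2
    · have hpos : 0 < |((2 * n + 1 : ℤ) : ℝ)| := abs_pos.2 (by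
        have : (2 * n + 1 : ℤ) ≠ 0 := by omega
        exact_mod_cast this)
      refine eq_zero_of_bounded_of_deriv_deriv hpos hc (fun ζ => ?_) (hM n)
      rw [hn, hsub, envelope_firstHarmonic_of_ne _ h01]
      have : ((|((2 * n + 1 : ℤ) : ℝ)| : ℝ) : ℂ) ^ 2 = ((2 * n + 1 : ℤ) : ℂ) ^ 2 := by
        exact_mod_cast congrArg (fun t : ℝ => (t : ℂ)) (sq_abs ((2 * n + 1 : ℤ) : ℝ))
      rw [this]
      ring
  have h0 : (0 : EvenSpace s).fn =ᵐ[freqMeasure] fun _ => 0 := by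
    have := coe_smul_ae 0 (0 : EvenSpace s)
    simpa using this
  have hz : WL2 s (fun _ => (0 : ℝ)) := by
    simpa using (EvenL2.coeFn v).toWL2.const_mul 0
  refine EvenSpace.ext (EventuallyEq.trans ?_ h0.symm)
  refine ae_eq_of_envelope_eq hs hv.toWL2 hz fun n => ?_
  rw [henv n]
  funext ζ
  simp [envelope_eq]

/-- The linearization of the system at the soliton. -/
def linearization (Γ : ℝ) (hs : 1 < s) : EvenSpace s →L[ℝ] EvenSpace s :=
  ContinuousLinearMap.id ℝ _ -
    (18 * Γ) • selfCLM hs (solitonPoint Γ hs) (solitonPoint Γ hs)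

/-- Fredholm alternative for the compact part: either 1 is an eigenvalue, excluded by
`eq_zero_of_linearized_fixed`, or it lies in the resolvent set. -/
theorem isInvertible_linearization {Γ : ℝ} (hΓ : 0 < Γ) (hs : 1 < s) :
    (linearization Γ hs).IsInvertible := by
  have hcomp : IsCompactOperator ((18 * Γ) • selfCLM hs (solitonPoint Γ hs) (solitonPoint Γ hs)) :=
    (isCompactOperator_selfCLM Γ hs).smul (18 * Γ)
  rcases hcomp.hasEigenvalue_or_mem_resolventSet one_ne_zero with h | h
  · obtain ⟨v, hv⟩ := h.exists_hasEigenvector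
    refine absurd (eq_zero_of_linearized_fixed hΓ hs ?_) hv.2
    simpa using hv.apply_eq_smul
  · rw [spectrum.mem_resolventSet_iff, map_one] at h
    obtain ⟨e, he⟩ := h
    exact ⟨ContinuousLinearEquiv.ofUnit e, he⟩

end

/-! ### Continuation in the parameter -/

section

variable {s : ℝ}

theorem hasStrictFDerivAt_diagonal {E : Type*} [NormedAddCommGroup E] [NormedSpace ℝ E]
    (T : E →L[ℝ] E →L[ℝ] E →L[ℝ] E) (u : E) :
    ∃ D : E →L[ℝ] E, HasStrictFDerivAt (fun u => T u u u) D u ∧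
      ∀ v, D v = T v u u + T u v u + T u u v := by
  have h := ((T.hasStrictFDerivAt (x := u)).clm_apply (hasStrictFDerivAt_id u)).clm_apply
    (hasStrictFDerivAt_id u)
  refine ⟨_, h, fun v => ?_⟩
  simp
  abel

/-- The trilinear map of the coupling between the harmonics. -/
def couplingCLM (hs : 1 < s) :
    EvenSpace s →L[ℝ] EvenSpace s →L[ℝ] EvenSpace s →L[ℝ] EvenSpace s :=
  (3 : ℝ) • interactionCLM hs isMask_pairMask zero_le_one +
    interactionCLM hs isMask_mixMask zero_le_one

theorem couplingCLM_ae (hs : 1 < s) (f : EvenSpace s) : (couplingCLM hs f f f).fn =ᵐ[freqMeasure]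
    fun x => resolvent (2 * x.1 + 1) x.2 *
      (3 * triple pairMask f.fn f.fn f.fn x + triple mixMask f.fn f.fn f.fn x) := by
  have h : couplingCLM hs f f f = (3 : ℝ) • interactionCLM hs isMask_pairMask zero_le_one f f f +
      interactionCLM hs isMask_mixMask zero_le_one f f f := rfl
  rw [h]
  filter_upwards [coe_add_ae ((3 : ℝ) • interactionCLM hs isMask_pairMask zero_le_one f f f)
      (interactionCLM hs isMask_mixMask zero_le_one f f f),
    coe_smul_ae 3 (interactionCLM hs isMask_pairMask zero_le_one f f f),
    interactionCLM_ae hs isMask_pairMask zero_le_one f f f,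
    interactionCLM_ae hs isMask_mixMask zero_le_one f f f] with x h1 h2 h3 h4
  rw [h1, h2, h3, h4, interaction, interaction]
  ring

/-- The system on the Fourier side as an equation in the Hilbert space. -/
def residual (Γ : ℝ) (hs : 1 < s) (q : ℝ × EvenSpace s) : EvenSpace s :=
  q.2 - ((6 * Γ) • selfCLM hs q.2 q.2 q.2 +
    (2 / 3 * q.1 * Γ) • couplingCLM hs q.2 q.2 q.2)

theorem residual_eq_zero_iff (Γ : ℝ) (hs : 1 < s) (ε : ℝ) (f : EvenSpace s) :
    residual Γ hs (ε, f) = 0 ↔ f.fn =ᵐ[freqMeasure] fun x =>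
      resolvent (2 * x.1 + 1) x.2 * nonlinearity Γ ε f.fn x := by
  have h : ((6 * Γ) • selfCLM hs f f f + (2 / 3 * ε * Γ) • couplingCLM hs f f f).fn
      =ᵐ[freqMeasure] fun x => resolvent (2 * x.1 + 1) x.2 * nonlinearity Γ ε f.fn x := by
    filter_upwards [coe_add_ae ((6 * Γ) • selfCLM hs f f f)
        ((2 / 3 * ε * Γ) • couplingCLM hs f f f), coe_smul_ae (6 * Γ) (selfCLM hs f f f),
      coe_smul_ae (2 / 3 * ε * Γ) (couplingCLM hs f f f), selfCLM_ae hs f f f,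
      couplingCLM_ae hs f] with x h1 h2 h3 h4 h5
    rw [h1, h2, h3, h4, h5, nonlinearity]
    ring
  rw [residual, sub_eq_zero]
  constructor
  · intro heq
    refine EventuallyEq.trans ?_ h
    rw [← heq]
  · intro heq
    exact EvenSpace.ext (heq.trans h.symm)

theorem hasStrictFDerivAt_residual (Γ : ℝ) (hs : 1 < s) :
    ∃ D : ℝ × EvenSpace s →L[ℝ] EvenSpace s,
      HasStrictFDerivAt (residual Γ hs) D (0, solitonPoint Γ hs) ∧
        D ∘L .inr ℝ ℝ (EvenSpace s) = linearization Γ hs := by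
  set p := solitonPoint Γ hs with hp
  obtain ⟨D₁, h1, e1⟩ := hasStrictFDerivAt_diagonal (selfCLM hs) p
  obtain ⟨D₂, h2, -⟩ := hasStrictFDerivAt_diagonal (couplingCLM hs) p
  have hfst : HasStrictFDerivAt (fun q : ℝ × EvenSpace s => q.1)
    (ContinuousLinearMap.fst ℝ ℝ (EvenSpace s)) (0, p) := hasStrictFDerivAt_fst
  have hsnd : HasStrictFDerivAt (fun q : ℝ × EvenSpace s => q.2)
    (ContinuousLinearMap.snd ℝ ℝ (EvenSpace s)) (0, p) := hasStrictFDerivAt_snd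
  have h1' := HasStrictFDerivAt.comp (0, p) (f := fun q : ℝ × EvenSpace s => q.2) h1 hsnd
  have h2' := HasStrictFDerivAt.comp (0, p) (f := fun q : ℝ × EvenSpace s => q.2) h2 hsnd
  have h := hsnd.sub ((h1'.const_smul (6 * Γ)).add
    (((hfst.const_mul (2 / 3)).mul_const Γ).smul h2'))
  refine ⟨_, h, ?_⟩
  ext1 v
  simp only [linearization, ContinuousLinearMap.comp_apply, ContinuousLinearMap.inr_apply]
  simp [e1]
  -- The coupling drops out as its coefficient vanishes at ε = 0. By symmetry the three terms of the
  -- derivative of the cube coincide, which turns 6 Γ into 18 Γ.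
  rw [selfCLM_swap_left hs v p p, selfCLM_swap_right hs p v p]
  module

theorem residual_soliton {Γ : ℝ} (hΓ : 0 < Γ) (hs : 1 < s) :
    residual Γ hs (0, solitonPoint Γ hs) = 0 := by
  rw [residual_eq_zero_iff]
  have h := solitonPoint_ae Γ hs
  filter_upwards [h, soliton_fixed hΓ hs] with x hx hx'
  rw [hx, hx']
  simp only [nonlinearity, triple_congr h h h]

/-- The implicit function describes all zeros in a ball around (0, soliton), which gives existence
and uniqueness together; its differentiability at 0 gives the linear bound in ε. -/
theorem exists_branch {Γ : ℝ} (hΓ : 0 < Γ) (hs : 1 < s) :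
    ∃ ε₀ > 0, ∃ C > 0, ∃ δ > 0, ∀ ε : ℝ, |ε| < ε₀ → ∃ f : EvenSpace s,
      residual Γ hs (ε, f) = 0 ∧ ‖f - solitonPoint Γ hs‖ < δ ∧
        ‖f - solitonPoint Γ hs‖ ≤ C * |ε| ∧
        ∀ g : EvenSpace s, residual Γ hs (ε, g) = 0 → ‖g - solitonPoint Γ hs‖ < δ → g = f := by
  set p := solitonPoint Γ hs with hp
  obtain ⟨D, hD, hinr⟩ := hasStrictFDerivAt_residual Γ hs
  have hinv : (D ∘L .inr ℝ ℝ (EvenSpace s)).IsInvertible := by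
    rw [hinr]
    exact isInvertible_linearization hΓ hs
  have h0 := residual_soliton hΓ hs
  have hiff := hD.eventually_apply_eq_iff_implicitFunctionOfProdDomain hinv
  have hder := hD.hasStrictFDerivAt_implicitFunctionOfProdDomain hinv
  set ψ := hD.implicitFunctionOfProdDomain hinv with hψ
  have hψ0 : ψ 0 = p := (hiff.self_of_nhds).1 rfl
  rw [h0] at hiff
  obtain ⟨r, hr, hball⟩ := Metric.eventually_nhds_iff.1 hiff
  obtain ⟨c, hc⟩ := hder.hasFDerivAt.isBigO_sub.bound
  have htend : Tendsto ψ (𝓝 0) (𝓝 p) := by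
    have := hder.hasFDerivAt.continuousAt.tendsto
    simp only at this
    rwa [hψ0] at this
  obtain ⟨r₁, hr₁, hc'⟩ := Metric.eventually_nhds_iff.1 hc
  obtain ⟨r₂, hr₂, hψr⟩ := Metric.tendsto_nhds_nhds.1 htend r hr
  -- The radius r of the ball where the zeros are known serves as δ. The bound on |ε| keeps (ε, g)
  -- in that ball (r), makes the linear estimate valid (r₁) and keeps the branch δ-close to the
  -- soliton (r₂). The maximum with 1 only ensures C > 0.
  refine ⟨min r (min r₁ r₂), by positivity, max c 1, by positivity, r, hr, fun ε hε => ?_⟩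
  have hε0 : dist ε 0 = |ε| := by rw [Real.dist_eq, sub_zero]
  have hε1 : |ε| < r := hε.trans_le (min_le_left _ _)
  have hε2 : dist ε 0 < r₁ := by
    rw [hε0]; exact hε.trans_le ((min_le_right _ _).trans (min_le_left _ _))
  have hε3 : dist ε 0 < r₂ := by
    rw [hε0]; exact hε.trans_le ((min_le_right _ _).trans (min_le_right _ _))
  have hclose : ‖ψ ε - p‖ < r := by
    rw [← dist_eq_norm]; exact hψr hε3
  have hnear : ∀ g : EvenSpace s, ‖g - p‖ < r → (residual Γ hs (ε, g) = 0 ↔ ψ ε = g) :=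
    fun g hg => hball (y := (ε, g)) (by
      rw [Prod.dist_eq, hε0, dist_eq_norm]
      exact max_lt hε1 hg)
  refine ⟨ψ ε, (hnear _ hclose).2 rfl, hclose, ?_, fun g hg hgr => ((hnear g hgr).1 hg).symm⟩
  have := hc' hε2
  simp only [hψ0, sub_zero, Real.norm_eq_abs] at this
  exact this.trans (mul_le_mul_of_nonneg_right (le_max_left _ _) (abs_nonneg _))

end

/-! ### From the Fourier side to the fields -/

section

variable {s : ℝ} {u v : ℤ × ℝ → ℝ}

/-- Fields and elements of the Hilbert space correspond isometrically, so δ and C carry over without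
change. -/
theorem xNorm_sub_eq (hs : 1 < s) {U V : ℝ → ℝ → ℝ} (hU : Continuous (Function.uncurry U))
    (hV : Continuous (Function.uncurry V)) {f g : EvenSpace s}
    (hf : ∀ n, mode U (2 * n + 1) = envelope f.fn n)
    (hg : ∀ n, mode V (2 * n + 1) = envelope g.fn n) :
    xNorm s (U - V) = ‖f - g‖ₑ := by
  rw [xNorm_eq_of_mode_eq (u := (f - g).fn) hs (EvenL2.coeFn (f - g)).toWL2, ← enorm_sq_eq_wsq,
    ← ENNReal.rpow_natCast, ← ENNReal.rpow_mul]
  · norm_num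
  · intro n
    have hneg := (EvenL2.coeFn g).toWL2.const_mul (-1)
    funext ζ
    rw [mode_sub hU hV, hf, hg, envelope_congr ((coe_sub_ae f g).trans (Eventually.of_forall
      fun x => by ring_nf : _ =ᵐ[freqMeasure] fun x => f.fn x + (-1) * g.fn x)),
      envelope_add hs (EvenL2.coeFn f).toWL2 hneg, envelope_const_mul]
    push_cast
    ring

theorem isEvenSolution_field (hs : 1 < s) (hu : EvenL2 s u) {Γ ε : ℝ}
    (h : u =ᵐ[freqMeasure] fun x => resolvent (2 * x.1 + 1) x.2 * nonlinearity Γ ε u x) :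
    IsEvenSolution s Γ ε (field u) where
  memX :=
    { continuous := hu.toWL2.continuous_field hs
      periodic := field_periodic u
      even_harmonics := fun p hp ζ => hu.mode_field_even hs hp ζ
      norm_lt_top := by
        rw [xNorm_eq_of_mode_eq hs hu.toWL2 (hu.mode_field_odd hs)]
        exact ENNReal.rpow_lt_top_of_nonneg (by norm_num) hu.finite.ne }
  realEnvelopes p ζ := by
    rcases Int.even_or_odd p with hp | ⟨n, rfl⟩
    · rw [hu.mode_field_even hs hp, hu.mode_field_even hs hp.neg]
      simp
    · have : -(2 * n + 1) = 2 * (-1 - n) + 1 := by ring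
      rw [this, hu.mode_field_odd hs, hu.mode_field_odd hs, hu.envelope_reflect]
      exact ⟨hu.conj_envelope n ζ, rfl⟩
  evenModes p ζ := by
    rcases Int.even_or_odd p with hp | ⟨n, rfl⟩
    · rw [hu.mode_field_even hs hp, hu.mode_field_even hs hp]
    · rw [hu.mode_field_odd hs, hu.envelope_neg]
  solves := (solves_iff hs hu (hu.mode_field_odd hs) Γ ε).2 h

theorem continuous_monoSoliton (Γ : ℝ) : Continuous (Function.uncurry (monoSoliton Γ)) := by
  rw [← field_soliton]
  exact (evenL2_soliton Γ zero_le_two).toWL2.continuous_field one_lt_two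

theorem mode_monoSoliton (Γ : ℝ) (hs : 1 < s) (n : ℤ) :
    mode (monoSoliton Γ) (2 * n + 1) = envelope (solitonPoint Γ hs).fn n := by
  rw [← field_soliton, (evenL2_soliton Γ (zero_le_one.trans hs.le)).mode_field_odd hs,
    envelope_congr (solitonPoint_ae Γ hs)]

theorem continuous_mode {U : ℝ → ℝ → ℝ} (hU : Continuous (Function.uncurry U)) (p : ℤ) :
    Continuous (mode U p) := by
  unfold mode
  refine continuous_const.mul (intervalIntegral.continuous_parametric_intervalIntegral_of_continuous'
    ?_ _ _)
  exact (Complex.continuous_ofReal.comp hU).mul (by fun_prop)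

/-- The modes of an even solution are the envelopes of an element of the Hilbert space. -/
theorem exists_evenSpace_of_isEvenSolution (hs : 1 < s) {Γ ε : ℝ} {V : ℝ → ℝ → ℝ}
    (hV : IsEvenSolution s Γ ε V) : ∃ f : EvenSpace s, ∀ n, mode V (2 * n + 1) = envelope f.fn n := by
  obtain ⟨u, hu, huV⟩ := exists_evenL2_of_modeEnergy hs
    (f := fun n => mode V (2 * n + 1)) (fun n => continuous_mode hV.memX.continuous _)
    (fun n ζ => (hV.realEnvelopes _ ζ).1) (fun n ζ => (hV.evenModes _ ζ).symm)
    (fun n => by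
      funext ζ
      have : 2 * (-1 - n) + 1 = -(2 * n + 1) := by ring
      rw [this]
      exact (hV.realEnvelopes _ ζ).2)
    (by
      have h := hV.memX.norm_lt_top
      rwa [xNorm_eq_tsum, ENNReal.rpow_lt_top_iff_of_pos (by norm_num)] at h)
  exact ⟨hu.toEvenSpace, fun n => by rw [envelope_congr hu.coe_toEvenSpace, ← huV]⟩

end

end XNLS

end

theorem theorem2 (Γ : ℝ) (hΓ : 0 < Γ) (s : ℝ) (hs : 1 < s) :
    ∃ ε₀ > 0, ∃ C > 0, ∃ δ > 0, ∀ ε : ℝ, |ε| < ε₀ →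
      ∃ U : ℝ → ℝ → ℝ,
        XNLS.IsEvenSolution s Γ ε U ∧
        (∀ φ : ℝ, Tendsto (fun ζ => U ζ φ) (cocompact ℝ) (𝓝 0)) ∧
        XNLS.xNorm s (U - XNLS.monoSoliton Γ) < ENNReal.ofReal δ ∧
        XNLS.xNorm s (U - XNLS.monoSoliton Γ) ≤ ENNReal.ofReal (C * |ε|) ∧
        ∀ V : ℝ → ℝ → ℝ, XNLS.IsEvenSolution s Γ ε V →
          XNLS.xNorm s (V - XNLS.monoSoliton Γ) < ENNReal.ofReal δ → V = U := by
  obtain ⟨ε₀, hε₀, C, hC, δ, hδ, h⟩ := XNLS.exists_branch hΓ hs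
  refine ⟨ε₀, hε₀, C, hC, δ, hδ, fun ε hε => ?_⟩
  obtain ⟨f, hf, hfδ, hfC, huniq⟩ := h ε hε
  have hu := XNLS.EvenL2.coeFn f
  have hsol := XNLS.isEvenSolution_field hs hu ((XNLS.residual_eq_zero_iff Γ hs ε f).1 hf)
  have hnorm : ∀ {V : ℝ → ℝ → ℝ} {g : XNLS.EvenSpace s}, Continuous (Function.uncurry V) →
      (∀ n, XNLS.mode V (2 * n + 1) = XNLS.envelope g.fn n) →
      XNLS.xNorm s (V - XNLS.monoSoliton Γ) =
        ENNReal.ofReal ‖g - XNLS.solitonPoint Γ hs‖ := fun hV hg => by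
    rw [XNLS.xNorm_sub_eq hs hV (XNLS.continuous_monoSoliton Γ) hg
      (XNLS.mode_monoSoliton Γ hs), ofReal_norm]
  have hUn := hnorm hsol.memX.continuous (hu.mode_field_odd hs)
  refine ⟨XNLS.field f.fn, hsol, hu.toWL2.tendsto_field hs, ?_, ?_, fun V hV hVδ => ?_⟩
  · rw [hUn]
    exact (ENNReal.ofReal_lt_ofReal_iff hδ).2 hfδ
  · rw [hUn]
    exact ENNReal.ofReal_le_ofReal hfC
  -- Any competing solution comes from a zero g of the residual at the same distance from the
  -- soliton, so g = f. The fields then share all modes, and continuity in (ζ, φ) makes them equal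
  -- everywhere.
  · obtain ⟨g, hg⟩ := XNLS.exists_evenSpace_of_isEvenSolution hs hV
    rw [hnorm hV.memX.continuous hg, ENNReal.ofReal_lt_ofReal_iff hδ] at hVδ
    have hgf := huniq g ((XNLS.residual_eq_zero_iff Γ hs ε g).2
      ((XNLS.solves_iff hs (XNLS.EvenL2.coeFn g) hg Γ ε).1 hV.solves)) hVδ
    subst hgf
    refine XNLS.eq_of_mode_eq hV.memX.continuous hsol.memX.continuous hV.memX.periodic
      hsol.memX.periodic fun p ζ => ?_
    rcases Int.even_or_odd p with hp | ⟨n, rfl⟩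
    · rw [hV.memX.even_harmonics p hp, hsol.memX.even_harmonics p hp]
    · rw [hg, hu.mode_field_odd hs]
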